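/- **Setting.** Fix $p$ and $\mathbb K\ge 2$. Let $(Y,\mathbf X)\in\mathbb R\times\mathbb R^p$ have a fixed law with $\mathbb E|Y|<\infty$ and $\mathbb E\exp(t\|\mathbf X\|_2)<\infty$ for every $t>0$; put $m(\mathbf x)=\mathbb E(Y\mid\mathbf X=\mathbf x)$, $\theta_0=\mathbb E(Y)$, $\vec{\mathbf X}=(1,\mathbf X^T)^T$, and let $\mu:\mathbb R^p\to\mathbb R$ be a fixed measurable function. For each $N$ let $R=R_N\in\{0,1\}$ satisfy $R\perp Y\mid\mathbf X$ and, with $\pi_N=\mathbb P(R=1)$ and $g(u)=e^u/(1+e^u)$, $$\pi_N(\mathbf X)=\mathbb P(R=1\mid\mathbf X)=\frac{\pi_N\exp(\vec{\mathbf X}^T\gamma_0)}{1+\pi_N\exp(\vec{\mathbf X}^T\gamma_0)}=g\big(\vec{\mathbf X}^T\gamma_0+\log\pi_N\big),$$ where $\gamma_0=\gamma_{0,N}\in\mathbb R^{p+1}$ may depend on $N$. Put $\dot g=g(1-g)$, $\mathcal J(\gamma_0,a)=\mathbb E\{\vec{\mathbf X}\vec{\mathbf X}^T\dot g(\vec{\mathbf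 X}^T\gamma_0+\log a)\}$, $a_N=1/\mathbb E\{\pi_N^{-1}(\mathbf X)\}$. Assume $N\pi_N\to\infty$, $\|\gamma_0\|_2<C$, $\mathcal J(\gamma_0,1)$ positive definite and $\|\mathcal J(\gamma_0,1)^{-1}\|_2<C$ with $C$ independent of $N$. Let $\mathbf Z_i=(R_i,Y_i,\mathbf X_i)$, $i\le N$, be i.i.d. copies of $(R,Y,\mathbf X)$, of which $(R_i,R_iY_i,\mathbf X_i)$ is observed, and let $\mathcal I_1,\dots,\mathcal I_{\mathbb K}$ be a random partition of $\{1,\dots,N\}$, independent of the data, with $|\mathcal I_k|/N\to1/\mathbb K$ in probability (e.g. folds of equal size). For a training index set $T$ let $\widehat\pi_T=|T|^{-1}\sum_{i\in T}R_i$, let $\widehat\gamma_T$ be a measurable function of the observations in $T$ that minimizes $$-|T|^{-1}\sum_{i\in T}\big[R_i\vec{\mathbf X}_i^T\gamma-\log\{1+\widehat\pi_T\exp(\vec{\mathbf X}_i^T\gamma)\}\big]$$ whenever a minimizer exists, and let $\widehat\pi_T(\mathbf x)=\widehat\pi_T\exp(\vec{\mathbf x}^T\widehat\gamma_T)/\{1+\widehat\pi_T\exp(\vec{\mathbf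 x}^T\widehat\gamma_T)\}$. Let $\widehat m_T(\cdot)$ be any (jointly measurable) estimator computed from the observations in $T$. For $i\in\mathcal I_k$ the cross-fitted $\widehat\pi_N(\mathbf X_i)$ and $\widehat m(\mathbf X_i)$ use $T=\mathcal I_k^c$. Expectations $\mathbb E_{\mathbf X}$ and norms $\|\cdot\|_{r,\mathbb P_{\mathbf X}}$ are over $\mathbf X$ only, with the estimators held fixed. **Theorem.** As $N\to\infty$: (i) For $T=\{1,\dots,N\}$, and also for $T=\mathcal I_k^c$ with each $k\le\mathbb K$, $$\widehat\gamma_T-\gamma_0=|T|^{-1}\sum_{i\in T}IF_\gamma(\mathbf Z_i)+o_p\big((N\pi_N)^{-1/2}\big),\qquad \|\widehat\gamma_T-\gamma_0\|_2=O_p\big((N\pi_N)^{-1/2}\big),$$ $$IF_\gamma(\mathbf Z)=\mathcal J^{-1}(\gamma_0,\pi_N)\{R-g(\vec{\mathbf X}^T\gamma_0+\log\pi_N)\}\vec{\mathbf X}-(\pi_N^{-1}R-1)\mathbf e_1 .$$ (ii) $\|\pi_N^{-1}(\mathbf X)\|_{r,\mathbb P_{\mathbf X}}\asymp\pi_N^{-1}$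 for every $r>0$, and $a_N\asymp\pi_N$. (iii) For the same $T$, $\|1-\pi_N(\mathbf X)/\widehat\pi_T(\mathbf X)\|_{2,\mathbb P_{\mathbf X}}=O_p((N\pi_N)^{-1/2})$ and $\mathbb E_{\mathbf X}\big[\frac{a_N}{\pi_N(\mathbf X)}\{1-\frac{\pi_N(\mathbf X)}{\widehat\pi_T(\mathbf X)}\}^2\big]=O_p((N\pi_N)^{-1})=o_p(1)$. (iv) If $\|m-\mu\|_{2+c,\mathbb P_{\mathbf X}}<\infty$ for some $c>0$, then, with the cross-fitted $\widehat\pi_N$, $$\widehat\Delta_N:=N^{-1}\sum_{i=1}^N\Big\{\frac{R_i}{\pi_N(\mathbf X_i)}-\frac{R_i}{\widehat\pi_N(\mathbf X_i)}\Big\}\{\mu(\mathbf X_i)-m(\mathbf X_i)\}=N^{-1}\sum_{i=1}^N IF_\pi(\mathbf Z_i)+o_p\big((N\pi_N)^{-1/2}\big),$$ $$IF_\pi(\mathbf Z)=\mathbb E\big[\{1-\pi_N(\mathbf X)\}\{\mu(\mathbf X)-m(\mathbf X)\}\vec{\mathbf X}^T\big]\,\mathcal J^{-1}(\gamma_0,\pi_N)\,\vec{\mathbf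 X}\{R-\pi_N(\mathbf X)\}.$$ (v) If $\|\widehat m_{\mathcal I_k^c}-\mu\|_{2+c',\mathbb P_{\mathbf X}}=o_p(1)$ for some $c'>0$ and all $k\le\mathbb K$, then $\mathbb E_{\mathbf X}\big[\frac{a_N}{\pi_N(\mathbf X)}\{\widehat m_{\mathcal I_k^c}(\mathbf X)-\mu(\mathbf X)\}^2\big]=o_p(1)$ for all $k$. (vi) Assume the condition of (iv), $\mathbb E(Y^2)<\infty$, and $\mathbb E[\{Y-\mu(\mathbf X)\}^2\mid\mathbf X]\le\sigma^2$ a.s. for a constant $\sigma$. Let $$\psi_{\mu,\pi}(\mathbf Z)=\mu(\mathbf X)+\frac{R}{\pi_N(\mathbf X)}\{Y-\mu(\mathbf X)\}-\theta_0,\qquad \Psi=\psi_{\mu,\pi}+IF_\pi .$$ Then $\mathbb E\{\Psi(\mathbf Z)\}=0$ whenever $\pi_N>0$, and $\mathbb E\{\Psi^2(\mathbf Z)\}=O(\pi_N^{-1})$. If in addition the condition of (v) holds, then $\widehat\theta_{\mathrm{DRSS}}:=N^{-1}\sum_i\widehat m(\mathbf X_i)+N^{-1}\sum_i\frac{R_i}{\widehat\pi_N(\mathbf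 X_i)}\{Y_i-\widehat m(\mathbf X_i)\}$ satisfies $$\widehat\theta_{\mathrm{DRSS}}-\theta_0=N^{-1}\sum_{i=1}^N\Psi(\mathbf Z_i)+o_p\big((N\pi_N)^{-1/2}\big).$$ -/

import Mathlib

open MeasureTheory ProbabilityTheory Filter Topology
open scoped ENNReal

noncomputable section

namespace OffsetPS

/-! ### Stochastic order symbols -/

/-- `U_N = O_p(r_N)`: for each `ε > 0` there is a constant `M` with
`P_N(‖U_N‖ > M r_N) ≤ ε` for all large `N`.  The values may be real, vectors, or extended
nonnegative reals (an infinite value counts as larger than every bound). -/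
def IsBigOp {Ω : ℕ → Type*} [∀ N, MeasurableSpace (Ω N)] (P : ∀ N, Measure (Ω N))
    {β : Type*} [ENorm β] (U : ∀ N, Ω N → β) (r : ℕ → ℝ) : Prop :=
  ∀ ε : ℝ, 0 < ε → ∃ M : ℝ, 0 < M ∧
    ∀ᶠ N in atTop, P N {ω | ENNReal.ofReal (M * r N) < ‖U N ω‖ₑ} ≤ ENNReal.ofReal ε

/-- `U_N = o_p(r_N)`: `P_N(‖U_N‖ > δ r_N) → 0` for each `δ > 0`. -/
def IsLittleOp {Ω : ℕ → Type*} [∀ N, MeasurableSpace (Ω N)] (P : ∀ N, Measure (Ω N))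
    {β : Type*} [ENorm β] (U : ∀ N, Ω N → β) (r : ℕ → ℝ) : Prop :=
  ∀ δ : ℝ, 0 < δ →
    Tendsto (fun N => P N {ω | ENNReal.ofReal (δ * r N) < ‖U N ω‖ₑ}) atTop (𝓝 0)

/-- `a_N ≍ b_N`. -/
def SameOrder (a b : ℕ → ℝ) : Prop :=
  ∃ c C : ℝ, 0 < c ∧ 0 < C ∧ ∀ᶠ N in atTop, c * b N < a N ∧ a N < C * b N

/-! ### Data points, covariates and parameters -/

/-- The covariate space `ℝ^p`. -/
abbrev Cov (p : ℕ) := EuclideanSpace ℝ (Fin p)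

/-- The parameter space `ℝ^(p+1)`; coordinate `0` is the intercept. -/
abbrev Par (p : ℕ) := EuclideanSpace ℝ (Fin (p + 1))

/-- A point `(R, Y, X)`. -/
abbrev Pt (p : ℕ) := ℝ × ℝ × Cov p

/-- What is observed of `(R, Y, X)`, namely `(R, R Y, X)`. -/
def observe {p : ℕ} (z : Pt p) : Pt p := (z.1, z.1 * z.2.1, z.2.2)

/-- The augmented covariate `(1, X)`. -/
def aug {p : ℕ} (x : Cov p) : Par p :=
  WithLp.toLp 2 (Fin.cons (1 : ℝ) (fun j => x j) : Fin (p + 1) → ℝ)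

/-- The logistic function `g`. -/
def logistic (u : ℝ) : ℝ := Real.exp u / (1 + Real.exp u)

/-- The derivative `g (1 - g)` of the logistic function. -/
def logisticDeriv (u : ℝ) : ℝ := logistic u * (1 - logistic u)

/-- The offset logistic propensity `a exp(xᵀγ) / (1 + a exp(xᵀγ))` at `(1, x)`, that is
`g(xᵀγ + log a)` when `a > 0`. -/
def offsetPS {p : ℕ} (a : ℝ) (γ : Par p) (x : Cov p) : ℝ :=
  a * Real.exp (inner ℝ (aug x) γ) / (1 + a * Real.exp (inner ℝ (aug x) γ))

theorem offsetPS_eq_logistic {p : ℕ} {a : ℝ} (ha : 0 < a) (γ : Par p) (x : Cov p) :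
    offsetPS a γ x = logistic (inner ℝ (aug x) γ + Real.log a) := by
  simp only [offsetPS, logistic, Real.exp_add, Real.exp_log ha, mul_comm]

/-! ### The population -/

/-- The σ-algebra generated by `X` on the space of points `(R, Y, X)`. -/
@[reducible] def sigmaX (p : ℕ) : MeasurableSpace (Pt p) :=
  MeasurableSpace.comap (fun z : Pt p => z.2.2) inferInstance

theorem sigmaX_le (p : ℕ) : sigmaX p ≤ (inferInstance : MeasurableSpace (Pt p)) :=
  Measurable.comap_le (measurable_snd.comp measurable_snd)

/-- The σ-algebra generated by `X` on the space of pairs `(Y, X)`. -/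
@[reducible] def sigmaX' (p : ℕ) : MeasurableSpace (ℝ × Cov p) :=
  MeasurableSpace.comap (fun w : ℝ × Cov p => w.2) inferInstance

/-- The labelling probability `P(R = 1)`. -/
def labelProb {p : ℕ} (Q : Measure (Pt p)) : ℝ := Q.real {z | z.1 = 1}

/-- The law `Q` of `(R, Y, X)` has `(Y, X)`-marginal `ν`, a binary `R` that is conditionally
independent of `Y` given `X`, and propensity score `E(R | X)` given by the offset logistic model
with offset `log P(R = 1)` and parameter `γ`. -/
structure IsOffsetModel {p : ℕ} (ν : Measure (ℝ × Cov p)) (Q : Measure (Pt p))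
    [IsProbabilityMeasure Q] (γ : Par p) : Prop where
  binary : ∀ᵐ z ∂Q, z.1 = 0 ∨ z.1 = 1
  marginal : Q.map Prod.snd = ν
  mar : CondIndepFun (sigmaX p) (sigmaX_le p) (fun z : Pt p => z.1) (fun z : Pt p => z.2.1) Q
  propensity : Q[fun z : Pt p => z.1 | sigmaX p] =ᵐ[Q]
    fun z => offsetPS (labelProb Q) γ z.2.2

/-- `π_N(x)`. -/
def truePS {p : ℕ} (Q : Measure (Pt p)) (γ : Par p) (x : Cov p) : ℝ :=
  offsetPS (labelProb Q) γ x

/-- `a_N = 1 / E{1 / π_N(X)}`. -/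
def invMeanInvPS {p : ℕ} (ν : Measure (ℝ × Cov p)) (Q : Measure (Pt p)) (γ : Par p) : ℝ :=
  (∫ x, (truePS Q γ x)⁻¹ ∂ν.snd)⁻¹

/-- `J(γ, a) = E{ X X' g'(X'γ + log a) }` for the augmented `X`;
`J(γ, 1)` is `E{ X X' g'(X'γ) }`. -/
def infoMatrix {p : ℕ} (ν : Measure (ℝ × Cov p)) (γ : Par p) (a : ℝ) :
    Matrix (Fin (p + 1)) (Fin (p + 1)) ℝ :=
  Matrix.of fun i j =>
    ∫ x, aug x i * aug x j * logisticDeriv (inner ℝ (aug x) γ + Real.log a) ∂ν.snd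

/-! ### Offset logistic regression on a subsample -/

/-- The fraction of labelled points in the subsample with index set `T`. -/
def labelFrac {p N : ℕ} (T : Finset (Fin N)) (z : Fin N → Pt p) : ℝ :=
  (T.card : ℝ)⁻¹ * ∑ i ∈ T, (z i).1

/-- The negative log-likelihood `ℓ(γ; a)` of the subsample `T` (up to a term free of `γ`). -/
def negLogLik {p N : ℕ} (T : Finset (Fin N)) (z : Fin N → Pt p) (a : ℝ) (γ : Par p) : ℝ :=
  -((T.card : ℝ)⁻¹ * ∑ i ∈ T, ((z i).1 * inner ℝ (aug (z i).2.2) γ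
    - Real.log (1 + a * Real.exp (inner ℝ (aug (z i).2.2) γ))))

/-- `ghat` is an offset logistic MLE with estimated offset: for each subsample `T`, `ghat T` is a
measurable function of the subsample, and it minimizes `ℓ(· ; labelled fraction)` whenever a
minimizer exists (its value is arbitrary otherwise). -/
def IsOffsetMLE {p N : ℕ} (ghat : Finset (Fin N) → (Fin N → Pt p) → Par p) : Prop :=
  ∀ T : Finset (Fin N), Measurable (ghat T) ∧ DependsOn (ghat T) (T : Set (Fin N)) ∧
    ∀ z : Fin N → Pt p, (∀ i ∈ T, (z i).1 = 0 ∨ (z i).1 = 1) →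
      (∃ γ, IsMinOn (negLogLik T z (labelFrac T z)) Set.univ γ) →
      IsMinOn (negLogLik T z (labelFrac T z)) Set.univ (ghat T z)

/-- The fitted propensity score from the subsample `T`. -/
def fittedPS {p N : ℕ} (ghat : Finset (Fin N) → (Fin N → Pt p) → Par p) (T : Finset (Fin N))
    (z : Fin N → Pt p) (x : Cov p) : ℝ :=
  offsetPS (labelFrac T z) (ghat T z) x

/-- `mhat` is an outcome regression estimator: for each subsample `T`, `mhat T z` is a function of
`x` that depends on the data only through the points in `T`, jointly measurably. -/
def IsOutcomeEstimator {p N : ℕ} (mhat : Finset (Fin N) → (Fin N → Pt p) → Cov p → ℝ) : Prop :=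
  ∀ T : Finset (Fin N), DependsOn (mhat T) (T : Set (Fin N)) ∧
    Measurable fun q : (Fin N → Pt p) × Cov p => mhat T q.1 q.2

/-! ### Sampling and cross-fitting -/

/-- `Z 1, …, Z N` are i.i.d. with law `Q`, and the partition `fold` of the indices into `K`
(labelled) folds is random and independent of the data. -/
structure IsSample {p N K : ℕ} {Ω : Type*} [MeasurableSpace Ω] (P : Measure Ω)
    (Q : Measure (Pt p)) (Z : Fin N → Ω → Pt p) (fold : Ω → Fin N → Fin K) : Prop where
  measurable : ∀ i, Measurable (Z i)
  indep : iIndepFun Z P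
  law : ∀ i, P.map (Z i) = Q
  measurable_fold : Measurable fold
  indep_fold : IndepFun fold (fun ω i => Z i ω) P

/-- The observed sample. -/
def obs {p N : ℕ} {Ω : Type*} (Z : Fin N → Ω → Pt p) (ω : Ω) : Fin N → Pt p :=
  fun i => observe (Z i ω)

/-- The training index sets: the full sample for `none`, and the complement of the `k`-th fold
for `some k`. -/
def trainSet {N K : ℕ} (fold : Fin N → Fin K) : Option (Fin K) → Finset (Fin N)
  | none => Finset.univ
  | some k => Finset.univ.filter fun i => fold i ≠ k

/-! ### Influence functions and estimators of the mean -/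

/-- `IF_γ(Z) = J⁻¹(γ, π) {R - g(X'γ + log π)} X - (R / π - 1) e₁`. -/
def ifGamma {p : ℕ} (ν : Measure (ℝ × Cov p)) (Q : Measure (Pt p)) (γ : Par p) (z : Pt p) :
    Par p :=
  (z.1 - logistic (inner ℝ (aug z.2.2) γ + Real.log (labelProb Q))) •
      Matrix.toEuclideanCLM (𝕜 := ℝ) (infoMatrix ν γ (labelProb Q))⁻¹ (aug z.2.2)
    - ((labelProb Q)⁻¹ * z.1 - 1) • EuclideanSpace.single 0 (1 : ℝ)

/-- The vector `E[{1 - π_N(X)} {μ(X) - m(X)} X]` for the augmented `X`. -/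
def biasVector {p : ℕ} (ν : Measure (ℝ × Cov p)) (Q : Measure (Pt p)) (γ : Par p)
    (m μ : Cov p → ℝ) : Par p :=
  WithLp.toLp 2 fun j => ∫ x, (1 - truePS Q γ x) * (μ x - m x) * aug x j ∂ν.snd

/-- `IF_π(Z) = E[{1 - π_N(X)} {μ(X) - m(X)} X'] J⁻¹(γ, π) X {R - π_N(X)}`. -/
def ifPi {p : ℕ} (ν : Measure (ℝ × Cov p)) (Q : Measure (Pt p)) (γ : Par p)
    (m μ : Cov p → ℝ) (z : Pt p) : ℝ :=
  inner ℝ (biasVector ν Q γ m μ)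
    (Matrix.toEuclideanCLM (𝕜 := ℝ) (infoMatrix ν γ (labelProb Q))⁻¹ (aug z.2.2))
    * (z.1 - truePS Q γ z.2.2)

/-- `θ₀ = E(Y)`. -/
def theta0 {p : ℕ} (ν : Measure (ℝ × Cov p)) : ℝ := ∫ w, w.1 ∂ν

/-- `ψ_{μ,π}(Z) = μ(X) + R {Y - μ(X)} / π_N(X) - θ₀`. -/
def psi {p : ℕ} (ν : Measure (ℝ × Cov p)) (Q : Measure (Pt p)) (γ : Par p)
    (μ : Cov p → ℝ) (z : Pt p) : ℝ :=
  μ z.2.2 + z.1 / truePS Q γ z.2.2 * (z.2.1 - μ z.2.2) - theta0 ν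

/-- The adjusted influence function `Ψ = ψ_{μ,π} + IF_π`. -/
def adjustedIF {p : ℕ} (ν : Measure (ℝ × Cov p)) (Q : Measure (Pt p)) (γ : Par p)
    (m μ : Cov p → ℝ) (z : Pt p) : ℝ :=
  psi ν Q γ μ z + ifPi ν Q γ m μ z

/-- `N⁻¹ ∑ᵢ {Rᵢ / π_N(Xᵢ) - Rᵢ / πhatᵢ(Xᵢ)} {μ(Xᵢ) - m(Xᵢ)}`, where `πhatᵢ` is the propensity
estimate used for unit `i`. -/
def deltaHat {p N : ℕ} (Q : Measure (Pt p)) (γ : Par p) (m μ : Cov p → ℝ)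
    (pihat : Fin N → Cov p → ℝ) (z : Fin N → Pt p) : ℝ :=
  (N : ℝ)⁻¹ * ∑ i, ((z i).1 / truePS Q γ (z i).2.2 - (z i).1 / pihat i (z i).2.2)
    * (μ (z i).2.2 - m (z i).2.2)

/-- The doubly robust estimator
`N⁻¹ ∑ᵢ mhatᵢ(Xᵢ) + N⁻¹ ∑ᵢ Rᵢ {Yᵢ - mhatᵢ(Xᵢ)} / πhatᵢ(Xᵢ)`. -/
def thetaDRSS {p N : ℕ} (mhat pihat : Fin N → Cov p → ℝ) (z : Fin N → Pt p) : ℝ :=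
  (N : ℝ)⁻¹ * ∑ i, mhat i (z i).2.2
    + (N : ℝ)⁻¹ * ∑ i, (z i).1 / pihat i (z i).2.2 * ((z i).2.1 - mhat i (z i).2.2)

/-- The cross-fitted propensity estimates: unit `i` uses the fit from the other folds. -/
def crossPS {p N K : ℕ} (ghat : Finset (Fin N) → (Fin N → Pt p) → Par p)
    (fold : Fin N → Fin K) (s : Fin N → Pt p) (i : Fin N) : Cov p → ℝ :=
  fittedPS ghat (trainSet fold (some (fold i))) s

/-- The cross-fitted outcome estimates: unit `i` uses the fit from the other folds. -/
def crossOutcome {p N K : ℕ} (mhat : Finset (Fin N) → (Fin N → Pt p) → Cov p → ℝ)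
    (fold : Fin N → Fin K) (s : Fin N → Pt p) (i : Fin N) : Cov p → ℝ :=
  mhat (trainSet fold (some (fold i))) s

end OffsetPS

end

/-! The offset can be absorbed into the intercept. As `aug x` has first coordinate one, an offset
log a only adds log a to the intercept, so a fit with estimated offset is an ordinary logistic MLE
in the parameter `shifted`. The estimated labelling fraction then enters γ̂ - γ₀ only through
-log(π̂/π_N) e₁, whose linearization is the second term of `ifGamma`.

Since π_N may tend to zero, every quantity is measured relative to π_N. The logarithmic derivative
of g' is bounded by one, so g' changes by a factor of at most e^|s| over a step s; score, Hessian
and Taylor remainders therefore all keep a factor g'(u), which is at most π_N times the envelope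
`env`. All envelopes are integrable under the exponential moments. Divided by π_N, the score and the
Hessian deviation have the order of `rate`, the third-order coefficient is bounded in probability,
and the information matrix is bounded below by π_N/C. Convexity does the rest
(`logisticRisk_minimizers`, `isNegl_mle`): the risk exceeds its value at the truth on a small
sphere, hence a minimizer exists, all minimizers lie inside, and the score equation gives the error
δ = J⁻¹ S up to smaller order.

The identity 1 - g(u)/g(u+t) = (1 - g(u))(1 - e^(-t)) turns δ into the relative error of the fitted
propensity score, and gives its rates at once. The same identity writes the inverse weighting error
of a variable W as an average of (R/π)(1 - π) W (1 - exp(-xᵀδ)). On each fold the linear part is, to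
leading order, the fold share times the inner product of `biasVector` with δ. The shares tend to 1/K
and each unit belongs to K - 1 training samples, so the errors of the K fits recombine into the
full-sample average of `ifPi` (`abs_crossfit_expansion_le`, `isLittleOp_expansion`). This part uses
no independence between δ and the fold it is applied to. It is used for W = μ - m in the bias
expansion, and for W = μ - Y in the doubly robust estimator; both have the same bias vector because
m is the conditional mean of Y.

The doubly robust estimator splits exactly (`thetaDRSS_decomposition`) into the expansion for μ - Y,
a term in mhat - μ weighted by the centred 1 - R/π, and a product of the two estimation errors. The
second is conditionally centred given the training folds with a vanishing relative variance, and the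
third is the rate times a vanishing factor. Conditioning on the training folds is carried out by
resampling the held-out coordinates (`lintegral_pi_eq_glue`, `isLittleOp_crossfit`). -/

noncomputable section

namespace OffsetPS

set_option linter.unusedSectionVars false

/-! ### Calculus of stochastic orders -/

section StochasticOrder

variable {Ω : ℕ → Type*} [∀ N, MeasurableSpace (Ω N)] {P : ∀ N, Measure (Ω N)}

/-- The probability of the event `B N` tends to zero. -/
def IsNegl (P : ∀ N, Measure (Ω N)) (B : ∀ N, Set (Ω N)) : Prop :=
  Tendsto (fun N => P N (B N)) atTop (𝓝 0)

theorem isNegl_iff {B : ∀ N, Set (Ω N)} :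
    IsNegl P B ↔ ∀ ε : ℝ, 0 < ε → ∀ᶠ N in atTop, P N (B N) ≤ ENNReal.ofReal ε := by
  rw [IsNegl, ENNReal.tendsto_nhds_zero]
  constructor
  · intro h ε hε
    exact h _ (by simpa using hε)
  · intro h ε hε
    rcases eq_or_ne ε ∞ with rfl | htop
    · simp
    · filter_upwards [h ε.toReal (ENNReal.toReal_pos hε.ne' htop)] with N hN
      rwa [ENNReal.ofReal_toReal htop] at hN

theorem IsNegl.mono' {A B : ∀ N, Set (Ω N)} (hB : IsNegl P B)
    (h : ∀ᶠ N in atTop, A N ⊆ B N) : IsNegl P A := by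
  refine tendsto_of_tendsto_of_tendsto_of_le_of_le' tendsto_const_nhds hB
    (Eventually.of_forall fun _ => zero_le) ?_
  filter_upwards [h] with N hN using measure_mono hN

theorem IsNegl.union {A B : ∀ N, Set (Ω N)} (hA : IsNegl P A) (hB : IsNegl P B) :
    IsNegl P (fun N => A N ∪ B N) := by
  have := Tendsto.add hA hB
  rw [add_zero] at this
  exact tendsto_of_tendsto_of_tendsto_of_le_of_le tendsto_const_nhds this
    (fun _ => zero_le) (fun N => measure_union_le _ _)

theorem IsNegl.iUnion {ι : Type*} [Fintype ι] {A : ι → ∀ N, Set (Ω N)}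
    (hA : ∀ i, IsNegl P (A i)) : IsNegl P (fun N => ⋃ i, A i N) := by
  have h : Tendsto (fun N => ∑ i, P N (A i N)) atTop (𝓝 (∑ _i : ι, 0)) :=
    tendsto_finsetSum _ fun i _ => hA i
  simp only [Finset.sum_const_zero] at h
  refine tendsto_of_tendsto_of_tendsto_of_le_of_le tendsto_const_nhds h
    (fun _ => zero_le) (fun N => ?_)
  simpa using measure_iUnion_fintype_le (P N) (fun i => A i N)

variable {β β' : Type*} [ENorm β] [ENorm β'] {r s : ℕ → ℝ}

theorem IsLittleOp.isNegl {U : ∀ N, Ω N → β} (h : IsLittleOp P U r) {δ : ℝ} (hδ : 0 < δ) :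
    IsNegl P (fun N => {ω | ENNReal.ofReal (δ * r N) < ‖U N ω‖ₑ}) := h δ hδ

/-- The standard way to conclude below: on an event of probability tending to one a deterministic
inequality holds, and the order of the dominating variable is known. Only monotonicity and
subadditivity of the measures enter, so neither the events nor the variables need be measurable. -/
theorem IsLittleOp.of_le {U : ∀ N, Ω N → β} {V : ∀ N, Ω N → β'} {B : ∀ N, Set (Ω N)}
    (hV : IsLittleOp P V r) (hB : IsNegl P B)
    (h : ∀ᶠ N in atTop, ∀ ω, ω ∉ B N → ‖U N ω‖ₑ ≤ ‖V N ω‖ₑ) : IsLittleOp P U r := by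
  intro δ hδ
  refine ((hV.isNegl hδ).union hB).mono' ?_
  filter_upwards [h] with N hN ω hω
  by_cases hb : ω ∈ B N
  · exact Or.inr hb
  · exact Or.inl (lt_of_lt_of_le hω (hN ω hb))

theorem IsBigOp.of_le {U : ∀ N, Ω N → β} {V : ∀ N, Ω N → β'} {B : ∀ N, Set (Ω N)}
    (hV : IsBigOp P V r) (hB : IsNegl P B)
    (h : ∀ᶠ N in atTop, ∀ ω, ω ∉ B N → ‖U N ω‖ₑ ≤ ‖V N ω‖ₑ) : IsBigOp P U r := by
  intro ε hε
  obtain ⟨M, hM, hM'⟩ := hV (ε / 2) (by positivity)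
  refine ⟨M, hM, ?_⟩
  filter_upwards [h, hM', isNegl_iff.1 hB (ε / 2) (by positivity)] with N h1 h2 h3
  calc _ ≤ P N ({ω | ENNReal.ofReal (M * r N) < ‖V N ω‖ₑ} ∪ B N) := by
        refine measure_mono fun ω hω => ?_
        by_cases hb : ω ∈ B N
        · exact Or.inr hb
        · exact Or.inl (lt_of_lt_of_le hω (h1 ω hb))
    _ ≤ _ := measure_union_le _ _
    _ ≤ ENNReal.ofReal (ε / 2) + ENNReal.ofReal (ε / 2) := add_le_add h2 h3
    _ = _ := by rw [← ENNReal.ofReal_add (by positivity) (by positivity), add_halves]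

theorem IsNegl.empty : IsNegl P (fun _ => ∅) := by simp [IsNegl]

theorem IsLittleOp.isBigOp {U : ∀ N, Ω N → β} (h : IsLittleOp P U r) : IsBigOp P U r :=
  fun ε hε => ⟨1, one_pos, isNegl_iff.1 (h 1 one_pos) ε hε⟩

/-- The hypothesis is r = o(s) written without a quotient, so that s may vanish. -/
theorem IsBigOp.isLittleOp {U : ∀ N, Ω N → β} (h : IsBigOp P U r)
    (hrs : ∀ η : ℝ, 0 < η → ∀ᶠ N in atTop, r N ≤ η * s N) : IsLittleOp P U s := by
  intro δ hδ
  refine isNegl_iff.2 fun ε hε => ?_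
  obtain ⟨M, hM, hM'⟩ := h ε hε
  filter_upwards [hM', hrs (δ / M) (by positivity)] with N h1 h2
  refine (measure_mono fun ω hω => ?_).trans h1
  refine lt_of_le_of_lt (ENNReal.ofReal_le_ofReal ?_) hω
  calc M * r N ≤ M * (δ / M * s N) := by gcongr
    _ = δ * s N := by field_simp

end StochasticOrder

/-! ### Algebra of stochastic orders for normed and real values. -/

section StochasticOrderNormed

variable {Ω : ℕ → Type*} [∀ N, MeasurableSpace (Ω N)] {P : ∀ N, Measure (Ω N)}
variable {E : Type*} [NormedAddCommGroup E] {r s : ℕ → ℝ}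

theorem IsLittleOp.of_norm_le {F : Type*} [NormedAddCommGroup F] {U : ∀ N, Ω N → E}
    {V : ∀ N, Ω N → F} {B : ∀ N, Set (Ω N)} (hV : IsLittleOp P V r) (hB : IsNegl P B)
    (h : ∀ᶠ N in atTop, ∀ ω, ω ∉ B N → ‖U N ω‖ ≤ ‖V N ω‖) : IsLittleOp P U r :=
  hV.of_le hB (h.mono fun _ hN ω hω => enorm_le_iff_norm_le.2 (hN ω hω))

theorem IsBigOp.of_norm_le {F : Type*} [NormedAddCommGroup F] {U : ∀ N, Ω N → E}
    {V : ∀ N, Ω N → F} {B : ∀ N, Set (Ω N)} (hV : IsBigOp P V r) (hB : IsNegl P B)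
    (h : ∀ᶠ N in atTop, ∀ ω, ω ∉ B N → ‖U N ω‖ ≤ ‖V N ω‖) : IsBigOp P U r :=
  hV.of_le hB (h.mono fun _ hN ω hω => enorm_le_iff_norm_le.2 (hN ω hω))

theorem ofReal_lt_enorm_iff {x : E} {t : ℝ} (ht : 0 ≤ t) : ENNReal.ofReal t < ‖x‖ₑ ↔ t < ‖x‖ := by
  rw [← ofReal_norm, ENNReal.ofReal_lt_ofReal_iff_of_nonneg ht]

theorem IsLittleOp.add {U V : ∀ N, Ω N → E} (hU : IsLittleOp P U r) (hV : IsLittleOp P V r)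
    (hr : ∀ᶠ N in atTop, 0 ≤ r N) : IsLittleOp P (fun N ω => U N ω + V N ω) r := by
  intro δ hδ
  refine ((hU.isNegl (half_pos hδ)).union (hV.isNegl (half_pos hδ))).mono' ?_
  filter_upwards [hr] with N hN ω hω
  by_contra hcon
  simp only [Set.mem_union, Set.mem_ofPred_eq, not_or, not_lt] at hcon hω
  rw [ofReal_lt_enorm_iff (by positivity)] at hω
  rw [← not_lt, ofReal_lt_enorm_iff (by positivity), ← not_lt,
    ofReal_lt_enorm_iff (by positivity)] at hcon
  have := norm_add_le (U N ω) (V N ω)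
  linarith [hcon.1, hcon.2]

theorem IsBigOp.add {U V : ∀ N, Ω N → E} (hU : IsBigOp P U r) (hV : IsBigOp P V r)
    (hr : ∀ᶠ N in atTop, 0 ≤ r N) : IsBigOp P (fun N ω => U N ω + V N ω) r := by
  intro ε hε
  obtain ⟨M₁, hM₁, h₁⟩ := hU (ε / 2) (by positivity)
  obtain ⟨M₂, hM₂, h₂⟩ := hV (ε / 2) (by positivity)
  refine ⟨M₁ + M₂, by positivity, ?_⟩
  filter_upwards [hr, h₁, h₂] with N hN h1 h2
  calc _ ≤ P N ({ω | ENNReal.ofReal (M₁ * r N) < ‖U N ω‖ₑ} ∪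
        {ω | ENNReal.ofReal (M₂ * r N) < ‖V N ω‖ₑ}) := by
        refine measure_mono fun ω hω => ?_
        by_contra hcon
        simp only [Set.mem_union, Set.mem_ofPred_eq, not_or] at hcon hω
        rw [ofReal_lt_enorm_iff (by positivity)] at hω
        rw [ofReal_lt_enorm_iff (by positivity), ofReal_lt_enorm_iff (by positivity)] at hcon
        have := norm_add_le (U N ω) (V N ω)
        linarith [hcon.1, hcon.2]
    _ ≤ _ := measure_union_le _ _
    _ ≤ ENNReal.ofReal (ε / 2) + ENNReal.ofReal (ε / 2) := add_le_add h1 h2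
    _ = _ := by rw [← ENNReal.ofReal_add (by positivity) (by positivity), add_halves]

theorem IsBigOp.zero (hr : ∀ᶠ N in atTop, 0 ≤ r N) :
    IsBigOp P (fun N (_ : Ω N) => (0 : E)) r := by
  refine fun ε _ => ⟨1, one_pos, ?_⟩
  filter_upwards [hr] with N hN
  simp

theorem IsLittleOp.zero : IsLittleOp P (fun N (_ : Ω N) => (0 : E)) r := by
  intro δ hδ
  simp

theorem IsLittleOp.sum {ι : Type*} {U : ι → ∀ N, Ω N → E} (t : Finset ι)
    (hU : ∀ i, IsLittleOp P (U i) r) (hr : ∀ᶠ N in atTop, 0 ≤ r N) :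
    IsLittleOp P (fun N ω => ∑ i ∈ t, U i N ω) r := by
  classical
  induction t using Finset.induction_on with
  | empty => simpa using IsLittleOp.zero
  | insert a t ha ih =>
    simp only [Finset.sum_insert ha]
    exact (hU a).add ih hr

theorem IsBigOp.sum {ι : Type*} {U : ι → ∀ N, Ω N → E} (t : Finset ι)
    (hU : ∀ i, IsBigOp P (U i) r) (hr : ∀ᶠ N in atTop, 0 ≤ r N) :
    IsBigOp P (fun N ω => ∑ i ∈ t, U i N ω) r := by
  classical
  induction t using Finset.induction_on with
  | empty => simpa using IsBigOp.zero hr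
  | insert a t ha ih =>
    simp only [Finset.sum_insert ha]
    exact (hU a).add ih hr

theorem IsLittleOp.norm {U : ∀ N, Ω N → E} (hU : IsLittleOp P U r) :
    IsLittleOp P (fun N ω => ‖U N ω‖) r :=
  hU.of_norm_le IsNegl.empty (by simp)

theorem IsBigOp.norm {U : ∀ N, Ω N → E} (hU : IsBigOp P U r) :
    IsBigOp P (fun N ω => ‖U N ω‖) r :=
  hU.of_norm_le IsNegl.empty (by simp)

theorem IsBigOp.abs {U : ∀ N, Ω N → ℝ} (hU : IsBigOp P U r) :
    IsBigOp P (fun N ω => |U N ω|) r := hU.norm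

theorem IsBigOp.mul {U V : ∀ N, Ω N → ℝ} (hU : IsBigOp P U r) (hV : IsBigOp P V s)
    (hr : ∀ᶠ N in atTop, 0 ≤ r N) (hs : ∀ᶠ N in atTop, 0 ≤ s N) :
    IsBigOp P (fun N ω => U N ω * V N ω) (fun N => r N * s N) := by
  intro ε hε
  obtain ⟨M₁, hM₁, h₁⟩ := hU (ε / 2) (by positivity)
  obtain ⟨M₂, hM₂, h₂⟩ := hV (ε / 2) (by positivity)
  refine ⟨M₁ * M₂, by positivity, ?_⟩
  filter_upwards [hr, hs, h₁, h₂] with N hN hN' h1 h2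
  calc _ ≤ P N ({ω | ENNReal.ofReal (M₁ * r N) < ‖U N ω‖ₑ} ∪
        {ω | ENNReal.ofReal (M₂ * s N) < ‖V N ω‖ₑ}) := by
        refine measure_mono fun ω hω => ?_
        by_contra hcon
        simp only [Set.mem_union, Set.mem_ofPred_eq, not_or] at hcon hω
        rw [ofReal_lt_enorm_iff (by positivity), norm_mul] at hω
        rw [ofReal_lt_enorm_iff (by positivity), ofReal_lt_enorm_iff (by positivity), not_lt,
          not_lt] at hcon
        have := mul_le_mul hcon.1 hcon.2 (norm_nonneg _) (by positivity)
        linarith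
    _ ≤ _ := measure_union_le _ _
    _ ≤ ENNReal.ofReal (ε / 2) + ENNReal.ofReal (ε / 2) := add_le_add h1 h2
    _ = _ := by rw [← ENNReal.ofReal_add (by positivity) (by positivity), add_halves]

theorem IsBigOp.mul_isLittleOp {U V : ∀ N, Ω N → ℝ} (hU : IsBigOp P U r) (hV : IsLittleOp P V s)
    (hr : ∀ᶠ N in atTop, 0 ≤ r N) (hs : ∀ᶠ N in atTop, 0 ≤ s N) :
    IsLittleOp P (fun N ω => U N ω * V N ω) (fun N => r N * s N) := by
  intro δ hδ
  refine isNegl_iff.2 fun ε hε => ?_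
  obtain ⟨M₁, hM₁, h₁⟩ := hU (ε / 2) (by positivity)
  -- The level δ/M₁ makes the product of the two thresholds equal to δ r s.
  have h₂ := isNegl_iff.1 (hV (δ / M₁) (by positivity)) (ε / 2) (by positivity)
  filter_upwards [hr, hs, h₁, h₂] with N hN hN' h1 h2
  calc _ ≤ P N ({ω | ENNReal.ofReal (M₁ * r N) < ‖U N ω‖ₑ} ∪
        {ω | ENNReal.ofReal (δ / M₁ * s N) < ‖V N ω‖ₑ}) := by
        refine measure_mono fun ω hω => ?_
        by_contra hcon
        simp only [Set.mem_union, Set.mem_ofPred_eq, not_or] at hcon hω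
        rw [ofReal_lt_enorm_iff (by positivity), norm_mul] at hω
        rw [ofReal_lt_enorm_iff (by positivity), ofReal_lt_enorm_iff (by positivity), not_lt,
          not_lt] at hcon
        have := mul_le_mul hcon.1 hcon.2 (norm_nonneg _) (by positivity)
        have e : M₁ * r N * (δ / M₁ * s N) = δ * (r N * s N) := by field_simp
        linarith
    _ ≤ _ := measure_union_le _ _
    _ ≤ ENNReal.ofReal (ε / 2) + ENNReal.ofReal (ε / 2) := add_le_add h1 h2
    _ = _ := by rw [← ENNReal.ofReal_add (by positivity) (by positivity), add_halves]

/-- A bounded deterministic sequence is `O_p(1)`. -/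
theorem isBigOp_const (x : E) : IsBigOp P (fun N (_ : Ω N) => x) (fun _ => 1) := by
  refine fun ε _ => ⟨‖x‖ + 1, by positivity, Eventually.of_forall fun N => ?_⟩
  have : {ω : Ω N | ENNReal.ofReal ((‖x‖ + 1) * 1) < ‖x‖ₑ} = ∅ := by
    ext ω
    rw [Set.mem_ofPred_eq, ofReal_lt_enorm_iff (by positivity)]
    simp
  rw [this]; simp

theorem IsBigOp.const_mul {U : ∀ N, Ω N → ℝ} (hU : IsBigOp P U r) (c : ℝ)
    (hr : ∀ᶠ N in atTop, 0 ≤ r N) : IsBigOp P (fun N ω => c * U N ω) r := by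
  simpa using (isBigOp_const (P := P) c).mul hU (by simp) hr

theorem IsLittleOp.const_mul {U : ∀ N, Ω N → ℝ} (hU : IsLittleOp P U r) (c : ℝ)
    (hr : ∀ᶠ N in atTop, 0 ≤ r N) : IsLittleOp P (fun N ω => c * U N ω) r := by
  simpa using (isBigOp_const (P := P) c).mul_isLittleOp hU (by simp) hr

end StochasticOrderNormed

/-! ### Moment bounds under product measures and random folds -/

section ProductMoments

variable {α : Type*} [MeasurableSpace α] {ι : Type*} [Fintype ι]

theorem memLp_two_of_lintegral_lt_top {μ : Measure α} {f : α → ℝ} (hf : Measurable f)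
    (h : ∫⁻ x, ‖f x‖ₑ ^ 2 ∂μ < ∞) : MemLp f 2 μ := by
  refine ⟨hf.aestronglyMeasurable, ?_⟩
  rw [eLpNorm_lt_top_iff_lintegral_rpow_enorm_lt_top (by simp) (by simp)]
  simpa using h

theorem lintegral_lt_top_of_memLp_two {μ : Measure α} {f : α → ℝ} (h : MemLp f 2 μ) :
    ∫⁻ x, ‖f x‖ₑ ^ 2 ∂μ < ∞ := by
  have := h.2
  rw [eLpNorm_lt_top_iff_lintegral_rpow_enorm_lt_top (by simp) (by simp)] at this
  simpa using this

/-- The second moment of a sum of independent centred variables. -/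
theorem lintegral_pi_sum_sq_le (Q : Measure α) [IsProbabilityMeasure Q] {f : α → ℝ}
    (hf : MemLp f 2 Q) (hmean : ∫ x, f x ∂Q = 0) (T : Finset ι) :
    ∫⁻ z, ‖∑ i ∈ T, f (z i)‖ₑ ^ 2 ∂(Measure.pi fun _ : ι => Q)
      ≤ T.card * ∫⁻ x, ‖f x‖ₑ ^ 2 ∂Q := by
  classical
  -- Replacing f by zero off T lets the variance formula over all coordinates apply to a partial
  -- sum.
  set X : ι → α → ℝ := fun i => if i ∈ T then f else 0
  have hX : ∀ i, MemLp (X i) 2 Q := by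
    intro i
    by_cases h : i ∈ T <;> simp [X, h, hf]
  have hsum : (fun z : ι → α => ∑ i ∈ T, f (z i)) = ∑ i, fun z : ι → α => X i (z i) := by
    ext z
    rw [Finset.sum_apply, ← Finset.sum_filter_add_sum_filter_not Finset.univ (· ∈ T)]
    simp only [Finset.filter_mem_eq_inter, Finset.univ_inter]
    rw [Finset.sum_eq_zero (s := Finset.univ.filter (· ∉ T)), add_zero]
    · exact Finset.sum_congr rfl fun i hi => by simp [X, hi]
    · intro i hi
      simp at hi
      simp [X, hi]
  have hcomp : ∀ i, MemLp (fun z : ι → α => X i (z i)) 2 (Measure.pi fun _ => Q) := fun i =>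
    (hX i).comp_measurePreserving (measurePreserving_eval (fun _ : ι => Q) i)
  have hL2 : MemLp (fun z : ι → α => ∑ i ∈ T, f (z i)) 2 (Measure.pi fun _ => Q) := by
    rw [hsum]
    exact memLp_finsetSum' _ fun i _ => hcomp i
  have hmean' : ∫ z, (∑ i ∈ T, f (z i)) ∂(Measure.pi fun _ : ι => Q) = 0 := by
    rw [integral_finsetSum]
    · refine Finset.sum_eq_zero fun i _ => ?_
      rw [← hmean]
      exact integral_comp_eval (μ := fun _ : ι => Q) (i := i) hf.aestronglyMeasurable
    · intro i _
      exact (hf.comp_measurePreserving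
        (measurePreserving_eval (fun _ : ι => Q) i)).integrable (by norm_num)
  have hvar := variance_sum_pi (μ := fun _ : ι => Q) (X := X) hX
  rw [← hsum] at hvar
  have h1 := hL2.ofReal_variance_eq
  have h2 := hf.ofReal_variance_eq
  rw [evariance, hmean'] at h1
  rw [evariance, hmean] at h2
  simp only [sub_zero] at h1 h2
  rw [← h1, ← h2, hvar]
  have hv : ∀ i, Var[X i; Q] = if i ∈ T then Var[f; Q] else 0 := by
    intro i
    by_cases h : i ∈ T <;> simp [X, h]
  simp only [hv, Finset.sum_ite_mem, Finset.univ_inter, Finset.sum_const, nsmul_eq_mul]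
  rw [ENNReal.ofReal_mul (by positivity)]
  simp

theorem lintegral_pi_sum_abs (Q : Measure α) [IsProbabilityMeasure Q] {f : α → ℝ≥0∞}
    (hf : Measurable f) (T : Finset ι) :
    ∫⁻ z, ∑ i ∈ T, f (z i) ∂(Measure.pi fun _ : ι => Q) = T.card * ∫⁻ x, f x ∂Q := by
  rw [lintegral_finsetSum _ (fun i _ => by fun_prop)]
  simp only [(measurePreserving_eval (fun _ : ι => Q) _).lintegral_comp hf, Finset.sum_const,
    nsmul_eq_mul]

/-- Overwrite `z` by `z'` outside `T`. -/
def glue (T : Finset ι) [DecidableEq ι] (z z' : ι → α) : ι → α := fun i => if i ∈ T then z i else z' i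

/-- Resampling the coordinates outside `T` does not change a product law. -/
theorem lintegral_pi_eq_glue [DecidableEq ι] (Q : Measure α) [IsProbabilityMeasure Q]
    (T : Finset ι) {F : (ι → α) → ℝ≥0∞} (hF : Measurable F) :
    ∫⁻ z, F z ∂(Measure.pi fun _ : ι => Q) =
      ∫⁻ z, ∫⁻ z', F (glue T z z') ∂(Measure.pi fun _ : ι => Q)
        ∂(Measure.pi fun _ : ι => Q) := by
  have hmeas : Measurable fun q : (ι → α) × (ι → α) => glue T q.1 q.2 := by
    refine measurable_pi_lambda _ fun i => ?_
    by_cases h : i ∈ T <;> simp only [glue, h, if_true, if_false] <;> fun_prop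
  have hmap : ((Measure.pi fun _ : ι => Q).prod (Measure.pi fun _ : ι => Q)).map
      (fun q : (ι → α) × (ι → α) => glue T q.1 q.2) = Measure.pi fun _ : ι => Q := by
    symm
    refine Measure.pi_eq fun s hs => ?_
    rw [Measure.map_apply hmeas (MeasurableSet.univ_pi hs)]
    -- The preimage of a box is a product of two boxes; at each coordinate one of the two sides is
    -- the whole space, so the masses multiply back to that of the original box.
    have : (fun q : (ι → α) × (ι → α) => glue T q.1 q.2) ⁻¹' (Set.univ.pi s) =
        (Set.univ.pi fun i => if i ∈ T then s i else Set.univ) ×ˢ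
          (Set.univ.pi fun i => if i ∈ T then Set.univ else s i) := by
      ext ⟨z, z'⟩
      simp only [Set.mem_preimage, Set.mem_pi, Set.mem_univ, true_imp_iff, Set.mem_prod, glue,
        ← forall_and]
      refine forall_congr' fun i => ?_
      by_cases h : i ∈ T <;> simp [h]
    rw [this, Measure.prod_prod, Measure.pi_pi, Measure.pi_pi, ← Finset.prod_mul_distrib]
    refine Finset.prod_congr rfl fun i _ => ?_
    by_cases h : i ∈ T <;> simp [h]
  conv_lhs => rw [← hmap]
  rw [lintegral_map hF hmeas]
  exact lintegral_prod _ (hF.comp hmeas).aemeasurable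

end ProductMoments

/-! ### The law of the sample, and probability bounds that hold for random folds. -/

section Sample

variable {p K N : ℕ} {Ω : Type*} [MeasurableSpace Ω] {P : Measure Ω}
  {Q : Measure (Pt p)} {Z : Fin N → Ω → Pt p} {fold : Ω → Fin N → Fin K}

theorem IsSample.map_eq (hs : IsSample P Q Z fold) :
    P.map (fun ω i => Z i ω) = Measure.pi fun _ => Q := by
  have := hs.indep.map_fun_eq_pi_map (fun i => (hs.measurable i).aemeasurable)
  rw [this]
  simp only [hs.law]

theorem IsSample.measurable_data (hs : IsSample P Q Z fold) :
    Measurable (fun ω i => Z i ω) := measurable_pi_lambda _ hs.measurable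

/-- Markov's inequality for functionals of the folds and the data. -/
theorem IsSample.markov [IsProbabilityMeasure P] [IsProbabilityMeasure Q] (hs : IsSample P Q Z fold)
    {X : (Fin N → Fin K) → (Fin N → Pt p) → ℝ≥0∞} (hX : ∀ f, Measurable (X f)) {c : ℝ≥0∞}
    (hc : ∀ f, ∫⁻ z, X f z ∂(Measure.pi fun _ => Q) ≤ c) {t : ℝ≥0∞} (ht : t ≠ 0) (ht' : t ≠ ∞) :
    P {ω | t ≤ X (fold ω) (fun i => Z i ω)} ≤ c / t := by
  have hsub : {ω | t ≤ X (fold ω) (fun i => Z i ω)} ⊆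
      ⋃ f : Fin N → Fin K, (fold ⁻¹' {f}) ∩ ((fun ω i => Z i ω) ⁻¹' {z | t ≤ X f z}) := by
    intro ω hω
    simp only [Set.mem_iUnion]
    exact ⟨fold ω, rfl, hω⟩
  have hmeas : ∀ f, MeasurableSet {z | t ≤ X f z} := fun f =>
    measurableSet_le measurable_const (hX f)
  calc P {ω | t ≤ X (fold ω) (fun i => Z i ω)}
      ≤ ∑ f, P ((fold ⁻¹' {f}) ∩ ((fun ω i => Z i ω) ⁻¹' {z | t ≤ X f z})) :=
        (measure_mono hsub).trans (measure_iUnion_fintype_le _ _)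
    -- There are finitely many partitions. For each one, independence separates the fold event from
    -- the data event, so a bound uniform over fixed partitions averages to the same bound.
    _ ≤ ∑ f, P (fold ⁻¹' {f}) * (c / t) := by
        refine Finset.sum_le_sum fun f _ => ?_
        rw [hs.indep_fold.measure_inter_preimage_eq_mul _ _ (measurableSet_singleton f) (hmeas f)]
        gcongr
        rw [← Measure.map_apply hs.measurable_data (hmeas f), hs.map_eq]
        refine (meas_ge_le_lintegral_div (hX f).aemeasurable ht ht').trans ?_
        gcongr
        exact hc f
    _ = c / t := by
        rw [← Finset.sum_mul, sum_measure_preimage_singleton]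
        · simp
        · intro f _
          exact hs.measurable_fold (measurableSet_singleton f)

theorem IsSample.ae (hs : IsSample P Q Z fold) {q : Pt p → Prop} (hq : ∀ᵐ z ∂Q, q z) :
    ∀ᵐ ω ∂P, ∀ i, q (Z i ω) := by
  rw [ae_all_iff]
  intro i
  rw [← hs.law i] at hq
  exact ae_of_ae_map (hs.measurable i).aemeasurable hq

end Sample

theorem isNegl_of_ae {p K : ℕ} {Ω : ℕ → Type*} [∀ N, MeasurableSpace (Ω N)]
    {P : ∀ N, Measure (Ω N)} {Q : ℕ → Measure (Pt p)} {Z : ∀ N, Fin N → Ω N → Pt p}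
    {fold : ∀ N, Ω N → Fin N → Fin K} (hs : ∀ N, IsSample (P N) (Q N) (Z N) (fold N))
    {q : ℕ → Pt p → Prop} (hq : ∀ N, ∀ᵐ z ∂(Q N), q N z) :
    IsNegl P (fun N => {ω | ¬ ∀ i, q N (Z N i ω)}) := by
  have : ∀ N, P N {ω | ¬ ∀ i, q N (Z N i ω)} = 0 := fun N => (hs N).ae (hq N)
  simp only [IsNegl, this, tendsto_const_nhds]

/-! ### From moment bounds with a fixed partition to stochastic orders with random folds. -/

section SampleAsymptotics

variable {p K : ℕ} {Ω : ℕ → Type*} [∀ N, MeasurableSpace (Ω N)] {P : ∀ N, Measure (Ω N)}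
  [∀ N, IsProbabilityMeasure (P N)] {Q : ℕ → Measure (Pt p)} [∀ N, IsProbabilityMeasure (Q N)]
  {Z : ∀ N, Fin N → Ω N → Pt p} {fold : ∀ N, Ω N → Fin N → Fin K}

/-- Markov's inequality for the k-th moment, taken with the partition fixed and uniformly over
partitions. The power is 2 for centred averages and 1 for absolute ones. -/
theorem isBigOp_of_lintegral_pow (hs : ∀ N, IsSample (P N) (Q N) (Z N) (fold N))
    {U : ∀ N, (Fin N → Fin K) → (Fin N → Pt p) → ℝ} (hU : ∀ N f, Measurable (U N f))
    {r : ℕ → ℝ} (hr : ∀ᶠ N in atTop, 0 < r N) {c : ℝ} (k : ℕ) (hk : k ≠ 0)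
    (h : ∀ᶠ N in atTop, ∀ f,
      ∫⁻ z, ‖U N f z‖ₑ ^ k ∂(Measure.pi fun _ => Q N) ≤ ENNReal.ofReal (c * r N ^ k)) :
    IsBigOp P (fun N ω => U N (fold N ω) (fun i => Z N i ω)) r := by
  intro ε hε
  set c' := max c 1
  have hc' : 0 < c' := by positivity
  -- A constant of at least one is below its own k-th power, so M^k ≥ c'/ε without extracting a
  -- root. Passing from c to c' only secures positivity.
  have hM : 1 ≤ max 1 (c' / ε) := le_max_left _ _
  refine ⟨max 1 (c' / ε), by positivity, ?_⟩
  filter_upwards [h, hr] with N hN hrN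
  have key := (hs N).markov (X := fun f z => ‖U N f z‖ₑ ^ k) (fun f => (hU N f).enorm.pow_const _)
    hN (t := ENNReal.ofReal ((max 1 (c' / ε) * r N) ^ k)) (by simp; positivity) (by simp)
  refine (measure_mono fun ω hω => ?_).trans (key.trans ?_)
  · simp only [Set.mem_ofPred_eq] at hω ⊢
    rw [ENNReal.ofReal_pow (by positivity)]
    gcongr
  · rw [← ENNReal.ofReal_div_of_pos (by positivity)]
    refine ENNReal.ofReal_le_ofReal ?_
    rw [div_le_iff₀ (by positivity), mul_pow]
    have h1 : c ≤ c' := le_max_left _ _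
    have h2 : c' / ε ≤ max 1 (c' / ε) ^ k :=
      (le_max_right _ _).trans (le_self_pow₀ hM hk)
    calc c * r N ^ k ≤ c' * r N ^ k := by gcongr
      _ = ε * (c' / ε * r N ^ k) := by field_simp
      _ ≤ _ := by gcongr

/-- A truncation criterion for `o_p`. -/
theorem isLittleOp_of_trunc (hs : ∀ N, IsSample (P N) (Q N) (Z N) (fold N))
    {U : ∀ N, (Fin N → Fin K) → (Fin N → Pt p) → ℝ}
    {r : ℕ → ℝ} (hr : ∀ᶠ N in atTop, 0 < r N) {c : ℝ} (k : ℕ)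
    (h : ∀ η : ℝ, 0 < η → ∃ V : ∀ N, (Fin N → Fin K) → (Fin N → Pt p) → ℝ,
      (∀ N f, Measurable (V N f)) ∧
      IsNegl P (fun N => {ω | U N (fold N ω) (fun i => Z N i ω) ≠
        V N (fold N ω) (fun i => Z N i ω)}) ∧
      ∀ᶠ N in atTop, ∀ f,
        ∫⁻ z, ‖V N f z‖ₑ ^ k ∂(Measure.pi fun _ => Q N) ≤ ENNReal.ofReal (c * η * r N ^ k)) :
    IsLittleOp P (fun N ω => U N (fold N ω) (fun i => Z N i ω)) r := by
  intro δ hδ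
  refine isNegl_iff.2 fun ε hε => ?_
  set c' := max c 1
  have hc' : 0 < c' := by positivity
  -- This value makes the Markov bound c η r^k / (δ r)^k at most ε/2; the other half of ε pays for
  -- the event where the truncation acts.
  obtain ⟨V, hV, hneg, hint⟩ := h (ε / 2 * δ ^ k / c') (by positivity)
  filter_upwards [hint, hr, isNegl_iff.1 hneg (ε / 2) (by positivity)] with N hN hrN hBN
  have key := (hs N).markov (X := fun f z => ‖V N f z‖ₑ ^ k) (fun f => (hV N f).enorm.pow_const _)
    hN (t := ENNReal.ofReal ((δ * r N) ^ k)) (by simp; positivity) (by simp)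
  calc _ ≤ P N ({ω | ENNReal.ofReal ((δ * r N) ^ k) ≤
          ‖V N (fold N ω) (fun i => Z N i ω)‖ₑ ^ k} ∪
        {ω | U N (fold N ω) (fun i => Z N i ω) ≠ V N (fold N ω) (fun i => Z N i ω)}) := by
        refine measure_mono fun ω hω => ?_
        by_cases hb : U N (fold N ω) (fun i => Z N i ω) = V N (fold N ω) (fun i => Z N i ω)
        · left
          simp only [Set.mem_ofPred_eq] at hω ⊢
          rw [hb] at hω
          rw [ENNReal.ofReal_pow (by positivity)]
          gcongr
        · exact Or.inr hb
    _ ≤ _ := measure_union_le _ _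
    _ ≤ ENNReal.ofReal (ε / 2) + ENNReal.ofReal (ε / 2) := by
        refine add_le_add (key.trans ?_) hBN
        rw [← ENNReal.ofReal_div_of_pos (by positivity)]
        refine ENNReal.ofReal_le_ofReal ?_
        rw [div_le_iff₀ (by positivity)]
        have h1 : c ≤ c' := le_max_left _ _
        calc c * (ε / 2 * δ ^ k / c') * r N ^ k ≤ c' * (ε / 2 * δ ^ k / c') * r N ^ k := by gcongr
          _ = _ := by rw [mul_pow]; field_simp
    _ = _ := by rw [← ENNReal.ofReal_add (by positivity) (by positivity), add_halves]

/-- Centred partial averages over a random index set have the rate given by the second moment. -/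
theorem isBigOp_average (hs : ∀ N, IsSample (P N) (Q N) (Z N) (fold N)) {a : ℕ → ℝ}
    (ha : ∀ᶠ N in atTop, 0 < a N) {F : ∀ _ : ℕ, Pt p → ℝ} (hF : ∀ N, Measurable (F N)) {c : ℝ}
    (h : ∀ᶠ N in atTop, ∫⁻ z, ‖F N z‖ₑ ^ 2 ∂(Q N) ≤ ENNReal.ofReal (c / a N))
    (τ : ∀ N, (Fin N → Fin K) → Finset (Fin N)) :
    IsBigOp P (fun N ω => (N : ℝ)⁻¹ * ∑ i ∈ τ N (fold N ω), (F N (Z N i ω) - ∫ z, F N z ∂(Q N)))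
      (fun N => (Real.sqrt (N * a N))⁻¹) := by
  refine isBigOp_of_lintegral_pow hs
    (U := fun N f z => (N : ℝ)⁻¹ * ∑ i ∈ τ N f, (F N (z i) - ∫ z, F N z ∂(Q N)))
    (fun N f => by have := hF N; fun_prop) ?_ (c := c) 2 two_ne_zero ?_
  · filter_upwards [ha, eventually_gt_atTop 0] with N h1 h2
    positivity
  · filter_upwards [ha, eventually_gt_atTop 0, h] with N h1 h2 h3 f
    have hL2 : MemLp (F N) 2 (Q N) :=
      memLp_two_of_lintegral_lt_top (hF N) (h3.trans_lt ENNReal.ofReal_lt_top)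
    set e := ∫ z, F N z ∂(Q N) with he
    have hL2' : MemLp (fun z => F N z - e) 2 (Q N) := hL2.sub (memLp_const e)
    have hmean : ∫ z, (F N z - e) ∂(Q N) = 0 := by
      rw [integral_sub (hL2.integrable (by norm_num)) (integrable_const e)]
      simp [he]
    -- Centring does not increase the second moment.
    have hvar : ∫⁻ z, ‖F N z - e‖ₑ ^ 2 ∂(Q N) ≤ ∫⁻ z, ‖F N z‖ₑ ^ 2 ∂(Q N) := by
      have h4 := hL2.ofReal_variance_eq
      rw [evariance] at h4
      rw [← h4]
      have h5 := variance_le_expectation_sq (μ := Q N) hL2.aestronglyMeasurable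
      refine (ENNReal.ofReal_le_ofReal h5).trans ?_
      simp only [Pi.pow_apply]
      rw [ofReal_integral_eq_lintegral_ofReal hL2.integrable_sq
        (Eventually.of_forall fun _ => by positivity)]
      refine lintegral_mono fun z => ?_
      rw [← enorm_pow, Real.enorm_of_nonneg (by positivity)]
    simp only [enorm_mul, mul_pow]
    rw [lintegral_const_mul' _ _ (by simp [ENNReal.pow_eq_top_iff])]
    have h6 := lintegral_pi_sum_sq_le (Q N) hL2' hmean (τ N f)
    have hcard : ((τ N f).card : ℝ≥0∞) ≤ N := by
      exact_mod_cast (Finset.card_le_univ _).trans (by simp)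
    have hN : (0 : ℝ) < N := by exact_mod_cast h2
    calc _ ≤ ‖(N : ℝ)⁻¹‖ₑ ^ 2 * (N * ENNReal.ofReal (c / a N)) := by
          gcongr
          exact h6.trans (mul_le_mul' hcard (hvar.trans h3))
      _ = ENNReal.ofReal ((N : ℝ)⁻¹ ^ 2) * (ENNReal.ofReal N * ENNReal.ofReal (c / a N)) := by
          rw [Real.enorm_of_nonneg (by positivity), ENNReal.ofReal_pow (by positivity)]
          simp
      _ = ENNReal.ofReal (c * (Real.sqrt (N * a N))⁻¹ ^ 2) := by
          rw [← ENNReal.ofReal_mul (by positivity), ← ENNReal.ofReal_mul (by positivity),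
            inv_pow (Real.sqrt _), Real.sq_sqrt (by positivity)]
          congr 1
          field_simp

/-- Without centring a first moment suffices and gives boundedness in probability; this is what the
coefficients of the quadratic remainders need. -/
theorem isBigOp_average_abs (hs : ∀ N, IsSample (P N) (Q N) (Z N) (fold N))
    {F : ∀ _ : ℕ, Pt p → ℝ} (hF : ∀ N, Measurable (F N)) {c : ℝ}
    (h : ∀ᶠ N in atTop, ∫⁻ z, ‖F N z‖ₑ ∂(Q N) ≤ ENNReal.ofReal c)
    (τ : ∀ N, (Fin N → Fin K) → Finset (Fin N)) :
    IsBigOp P (fun N ω => (N : ℝ)⁻¹ * ∑ i ∈ τ N (fold N ω), |F N (Z N i ω)|) (fun _ => 1) := by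
  refine isBigOp_of_lintegral_pow hs
    (U := fun N f z => (N : ℝ)⁻¹ * ∑ i ∈ τ N f, |F N (z i)|)
    (fun N f => by
      have := hF N
      refine Measurable.const_mul (Finset.measurable_sum _ fun i _ => ?_) _
      exact (this.comp (measurable_pi_apply i)).abs) (by simp) (c := c) 1 one_ne_zero ?_
  filter_upwards [eventually_gt_atTop 0, h] with N h2 h3 f
  have hN : (0 : ℝ) < N := by exact_mod_cast h2
  have hcard : ((τ N f).card : ℝ≥0∞) ≤ N := by
    exact_mod_cast (Finset.card_le_univ _).trans (by simp)
  have h4 : ∀ z : Fin N → Pt p, ‖(N : ℝ)⁻¹ * ∑ i ∈ τ N f, |F N (z i)|‖ₑ =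
      ENNReal.ofReal (N : ℝ)⁻¹ * ∑ i ∈ τ N f, ‖F N (z i)‖ₑ := by
    intro z
    rw [Real.enorm_of_nonneg (by positivity), ENNReal.ofReal_mul (by positivity),
      ENNReal.ofReal_sum_of_nonneg (fun _ _ => abs_nonneg _)]
    simp [Real.enorm_eq_ofReal_abs]
  simp only [pow_one, h4]
  rw [lintegral_const_mul' _ _ (by simp), lintegral_pi_sum_abs _ (hF N).enorm]
  calc _ ≤ ENNReal.ofReal (N : ℝ)⁻¹ * (N * ENNReal.ofReal c) := by gcongr
    _ = ENNReal.ofReal (N : ℝ)⁻¹ * (ENNReal.ofReal N * ENNReal.ofReal c) := by simp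
    _ = _ := by
      rw [← ENNReal.ofReal_mul (by positivity), ← ENNReal.ofReal_mul (by positivity)]
      congr 1
      field_simp

end SampleAsymptotics

/-! ### Consequences of the offset model -/

section Population

variable {p : ℕ}

theorem continuous_aug : Continuous (aug : Cov p → Par p) := by
  refine (PiLp.continuous_toLp 2 _).comp (continuous_pi fun i => ?_)
  refine Fin.cases ?_ (fun j => ?_) i
  · simpa using continuous_const
  · simp only [Fin.cons_succ]
    fun_prop

@[fun_prop]
theorem measurable_aug : Measurable (aug : Cov p → Par p) := continuous_aug.measurable

@[fun_prop]
theorem measurable_offsetPS (a : ℝ) (γ : Par p) : Measurable (offsetPS a γ) := by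
  unfold offsetPS
  fun_prop

@[fun_prop]
theorem measurable_truePS (Q : Measure (Pt p)) (γ : Par p) : Measurable (truePS Q γ) :=
  measurable_offsetPS _ _

variable {ν : Measure (ℝ × Cov p)} {Q : Measure (Pt p)} {γ : Par p}

theorem labelProb_nonneg : 0 ≤ labelProb Q := measureReal_nonneg

theorem truePS_nonneg (x : Cov p) : 0 ≤ truePS Q γ x := by
  have := labelProb_nonneg (Q := Q)
  unfold truePS offsetPS
  positivity

theorem truePS_le_one (x : Cov p) : truePS Q γ x ≤ 1 := by
  have := labelProb_nonneg (Q := Q)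
  unfold truePS offsetPS
  rw [div_le_one (by positivity)]
  linarith

variable [IsProbabilityMeasure Q]

theorem labelProb_le_one : labelProb Q ≤ 1 := measureReal_le_one

/-- The only use of conditional independence and the form of the propensity score: on the labelled
units the law of (Y, X) has density π(x) with respect to ν. Both measures are finite, so rectangles
suffice, and there P(R = 1, Y ∈ B | X) factors. Every later integral of R φ(Y, X) reduces to this.
-/
theorem IsOffsetModel.map_restrict (h : IsOffsetModel ν Q γ) :
    (Q.restrict {z | z.1 = 1}).map Prod.snd =
      ν.withDensity fun w => ENNReal.ofReal (truePS Q γ w.2) := by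
  have hX : Measurable fun z : Pt p => z.2.2 := by fun_prop
  have hR : MeasurableSet {z : Pt p | z.1 = 1} := measurable_fst (measurableSet_singleton 1)
  have hν : IsProbabilityMeasure ν := by
    rw [← h.marginal]; exact Measure.isProbabilityMeasure_map (by fun_prop)
  have : IsFiniteMeasure (ν.withDensity fun w => ENNReal.ofReal (truePS Q γ w.2)) := by
    refine isFiniteMeasure_withDensity (ne_top_of_le_ne_top (b := 1) (by simp) ?_)
    calc _ ≤ ∫⁻ _w, 1 ∂ν := lintegral_mono fun w => by
            simpa using truePS_le_one (Q := Q) (γ := γ) w.2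
      _ = 1 := by simp
  refine Measure.ext_prod fun {B A} hB hA => ?_
  have hBA : MeasurableSet (B ×ˢ A) := hB.prod hA
  rw [Measure.map_apply measurable_snd hBA, Measure.restrict_apply (measurable_snd hBA),
    withDensity_apply _ hBA, ← h.marginal, setLIntegral_map hBA (by fun_prop) measurable_snd]
  have hAX : MeasurableSet[sigmaX p] ((fun z : Pt p => z.2.2) ⁻¹' A) := ⟨A, hA, rfl⟩
  have hYB : MeasurableSet ((fun z : Pt p => z.2.1) ⁻¹' B) := by
    exact (measurable_fst.comp measurable_snd) hB
  have hind : (fun z : Pt p => z.1) =ᵐ[Q]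
      ((fun z : Pt p => z.1) ⁻¹' {1}).indicator (fun _ => (1 : ℝ)) := by
    filter_upwards [h.binary] with z hz
    rcases hz with hz | hz <;> simp [Set.indicator, hz]
  have h1 : Q⟦(fun z : Pt p => z.1) ⁻¹' {1} | sigmaX p⟧ =ᵐ[Q] fun z => truePS Q γ z.2.2 :=
    (condExp_congr_ae hind.symm).trans h.propensity
  have h2 := (condIndepFun_iff_condExp_inter_preimage_eq_mul (by fun_prop) (by fun_prop)).1 h.mar
    {1} B (measurableSet_singleton 1) hB
  have hπm : StronglyMeasurable[sigmaX p] fun z : Pt p => truePS Q γ z.2.2 := by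
    refine Measurable.stronglyMeasurable ?_
    exact (measurable_truePS Q γ).comp (comap_measurable _)
  have hint : Integrable (fun z : Pt p => truePS Q γ z.2.2 *
      ((fun z : Pt p => z.2.1) ⁻¹' B).indicator (fun _ => (1 : ℝ)) z) Q := by
    refine Integrable.bdd_mul (c := 1) ((integrable_const 1).indicator hYB)
      ((measurable_truePS Q γ).comp hX).aestronglyMeasurable (Eventually.of_forall fun z => ?_)
    rw [Real.norm_of_nonneg (truePS_nonneg _)]
    exact truePS_le_one _
  have h3 := condExp_mul_of_stronglyMeasurable_left (μ := Q) (m := sigmaX p) hπm hint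
    ((integrable_const 1).indicator hYB)
  have hRB : MeasurableSet ((fun z : Pt p => z.1) ⁻¹' {1} ∩ (fun z : Pt p => z.2.1) ⁻¹' B) :=
    MeasurableSet.inter (measurable_fst (measurableSet_singleton 1)) hYB
  -- Both integrands may be replaced by their conditional expectations given X, as the domain is an
  -- X-event; these agree by conditional independence and by pulling π(X) out.
  have key : ∫ z in (fun z : Pt p => z.2.2) ⁻¹' A, ((fun z : Pt p => z.1) ⁻¹' {1} ∩
        (fun z : Pt p => z.2.1) ⁻¹' B).indicator (fun _ => (1 : ℝ)) z ∂Q =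
      ∫ z in (fun z : Pt p => z.2.2) ⁻¹' A, truePS Q γ z.2.2 *
        ((fun z : Pt p => z.2.1) ⁻¹' B).indicator (fun _ => (1 : ℝ)) z ∂Q := by
    rw [← setIntegral_condExp (sigmaX_le p) ((integrable_const (1 : ℝ)).indicator hRB) hAX,
      ← setIntegral_condExp (sigmaX_le p) hint hAX]
    refine integral_congr_ae (ae_restrict_of_ae ?_)
    filter_upwards [h1, h2, h3] with z e1 e2 e3
    rw [e2, e1]
    exact e3.symm
  rw [setIntegral_indicator hRB, setIntegral_const, smul_eq_mul, mul_one] at key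
  have key2 : ∀ z : Pt p, truePS Q γ z.2.2 *
      ((fun z : Pt p => z.2.1) ⁻¹' B).indicator (fun _ => (1 : ℝ)) z =
      ((fun z : Pt p => z.2.1) ⁻¹' B).indicator (fun z => truePS Q γ z.2.2) z := by
    intro z
    by_cases hz : z ∈ (fun z : Pt p => z.2.1) ⁻¹' B <;> simp [hz]
  simp only [key2] at key
  rw [setIntegral_indicator hYB] at key
  have hset1 : Prod.snd ⁻¹' B ×ˢ A ∩ {z : Pt p | z.1 = 1} = (fun z : Pt p => z.2.2) ⁻¹' A ∩
      ((fun z : Pt p => z.1) ⁻¹' {1} ∩ (fun z : Pt p => z.2.1) ⁻¹' B) := by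
    ext z; simp; tauto
  have hset2 : Prod.snd ⁻¹' B ×ˢ A = (fun z : Pt p => z.2.2) ⁻¹' A ∩
      (fun z : Pt p => z.2.1) ⁻¹' B := by
    ext z; simp; tauto
  rw [hset1, hset2, ← ofReal_integral_eq_lintegral_ofReal _
    (Eventually.of_forall fun z => truePS_nonneg _), ← key, ofReal_measureReal]
  refine Integrable.integrableOn ?_
  refine Integrable.of_bound ((measurable_truePS Q γ).comp hX).aestronglyMeasurable 1
    (Eventually.of_forall fun z => ?_)
  rw [Real.norm_of_nonneg (truePS_nonneg _)]
  exact truePS_le_one _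

theorem IsOffsetModel.ae_eq_indicator (h : IsOffsetModel ν Q γ) (φ : Pt p → ℝ) :
    (fun z : Pt p => z.1 * φ z) =ᵐ[Q] {z : Pt p | z.1 = 1}.indicator φ := by
  filter_upwards [h.binary] with z hz
  rcases hz with hz | hz <;> simp [Set.indicator, hz]

/-- Averages over the labelled units, by the tower property. -/
theorem IsOffsetModel.lintegral_label (h : IsOffsetModel ν Q γ) {φ : ℝ × Cov p → ℝ≥0∞}
    (hφ : Measurable φ) :
    ∫⁻ z, ‖z.1‖ₑ * φ z.2 ∂Q = ∫⁻ w, ENNReal.ofReal (truePS Q γ w.2) * φ w ∂ν := by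
  have hR : MeasurableSet {z : Pt p | z.1 = 1} := measurable_fst (measurableSet_singleton 1)
  have h1 : ∫⁻ z, ‖z.1‖ₑ * φ z.2 ∂Q = ∫⁻ z in {z : Pt p | z.1 = 1}, φ z.2 ∂Q := by
    rw [← lintegral_indicator hR]
    refine lintegral_congr_ae ?_
    filter_upwards [h.binary] with z hz
    rcases hz with hz | hz <;> simp [Set.indicator, hz]
  rw [h1, ← lintegral_map hφ measurable_snd, h.map_restrict,
    lintegral_withDensity_eq_lintegral_mul _ (by fun_prop) hφ]
  rfl

theorem IsOffsetModel.integral_label (h : IsOffsetModel ν Q γ) {φ : ℝ × Cov p → ℝ}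
    (hφ : Measurable φ) :
    ∫ z, z.1 * φ z.2 ∂Q = ∫ w, truePS Q γ w.2 * φ w ∂ν := by
  have hR : MeasurableSet {z : Pt p | z.1 = 1} := measurable_fst (measurableSet_singleton 1)
  rw [integral_congr_ae (h.ae_eq_indicator fun z => φ z.2), integral_indicator hR,
    ← integral_map (φ := Prod.snd) (f := φ) measurable_snd.aemeasurable hφ.aestronglyMeasurable,
    h.map_restrict, integral_withDensity_eq_integral_toReal_smul (by fun_prop) (by simp)]
  refine integral_congr_ae (Eventually.of_forall fun w => ?_)
  simp [ENNReal.toReal_ofReal (truePS_nonneg _)]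

theorem IsOffsetModel.lintegral_snd (h : IsOffsetModel ν Q γ) {φ : ℝ × Cov p → ℝ≥0∞}
    (hφ : Measurable φ) : ∫⁻ z, φ z.2 ∂Q = ∫⁻ w, φ w ∂ν := by
  rw [← h.marginal, lintegral_map hφ measurable_snd]

theorem IsOffsetModel.integral_snd (h : IsOffsetModel ν Q γ) {φ : ℝ × Cov p → ℝ}
    (hφ : Measurable φ) : ∫ z, φ z.2 ∂Q = ∫ w, φ w ∂ν := by
  rw [← h.marginal, integral_map measurable_snd.aemeasurable hφ.aestronglyMeasurable]

end Population

/-! ### The logistic function -/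

section Logistic

theorem logistic_pos (u : ℝ) : 0 < logistic u := by unfold logistic; positivity

theorem one_sub_logistic (u : ℝ) : 1 - logistic u = 1 / (1 + Real.exp u) := by
  unfold logistic
  have : 1 + Real.exp u ≠ 0 := by positivity
  field_simp
  ring

theorem logistic_lt_one (u : ℝ) : logistic u < 1 := by
  have h : 0 < 1 - logistic u := by rw [one_sub_logistic]; positivity
  linarith

theorem logisticDeriv_eq (u : ℝ) : logisticDeriv u = Real.exp u / (1 + Real.exp u) ^ 2 := by
  rw [logisticDeriv, one_sub_logistic, logistic]
  field_simp

theorem logisticDeriv_pos (u : ℝ) : 0 < logisticDeriv u := by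
  rw [logisticDeriv_eq]; positivity

theorem logisticDeriv_le_logistic (u : ℝ) : logisticDeriv u ≤ logistic u := by
  have h1 := logistic_pos u
  unfold logisticDeriv
  nlinarith

theorem logisticDeriv_le_one (u : ℝ) : logisticDeriv u ≤ 1 :=
  (logisticDeriv_le_logistic u).trans (logistic_lt_one u).le

theorem continuous_logistic : Continuous logistic := by
  unfold logistic
  refine Continuous.div (by fun_prop) (by fun_prop) fun u => by positivity

theorem continuous_logisticDeriv : Continuous logisticDeriv := by
  unfold logisticDeriv
  exact continuous_logistic.mul (continuous_const.sub continuous_logistic)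

@[fun_prop]
theorem measurable_logisticDeriv : Measurable logisticDeriv := continuous_logisticDeriv.measurable

theorem hasDerivAt_logistic (u : ℝ) : HasDerivAt logistic (logisticDeriv u) u := by
  have h := (Real.hasDerivAt_exp u).div ((Real.hasDerivAt_exp u).const_add 1)
    (by positivity : 1 + Real.exp u ≠ 0)
  rw [logisticDeriv_eq]
  refine h.congr_deriv ?_
  congr 1
  ring

theorem hasDerivAt_log_one_add_exp (u : ℝ) :
    HasDerivAt (fun u => Real.log (1 + Real.exp u)) (logistic u) u := by
  simpa [logistic] using ((Real.hasDerivAt_exp u).const_add 1).log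
    (by positivity : 1 + Real.exp u ≠ 0)

/-- The logarithm of g' has derivative 1 - 2g, which lies in [-1, 1]. The bound is multiplicative,
so it stays sharp when g'(u) is itself of order π_N; an additive Lipschitz bound would lose this
factor. -/
theorem logisticDeriv_add_le (u s : ℝ) :
    logisticDeriv (u + s) ≤ logisticDeriv u * Real.exp |s| := by
  rw [logisticDeriv_eq, logisticDeriv_eq, Real.exp_add]
  have h0 := Real.exp_pos u
  have h1 := Real.exp_pos s
  rw [div_mul_eq_mul_div, div_le_div_iff₀ (by positivity) (by positivity)]
  rcases le_total 0 s with hs | hs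
  · rw [abs_of_nonneg hs]
    have : 1 ≤ Real.exp s := Real.one_le_exp hs
    gcongr
    nlinarith
  · rw [abs_of_nonpos hs]
    have h2 : Real.exp s ≤ 1 := Real.exp_le_one_iff.2 hs
    have h3 : Real.exp s * Real.exp (-s) = 1 := by rw [← Real.exp_add]; simp
    have h4 : Real.exp s * (1 + Real.exp u) ≤ 1 + Real.exp u * Real.exp s := by nlinarith
    have h5 : (Real.exp s * (1 + Real.exp u)) ^ 2 ≤ (1 + Real.exp u * Real.exp s) ^ 2 := by
      gcongr
    calc Real.exp u * Real.exp s * (1 + Real.exp u) ^ 2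
        = Real.exp u * Real.exp (-s) * (Real.exp s * (1 + Real.exp u)) ^ 2 *
          (Real.exp s * Real.exp (-s)) ^ 0 := by
          rw [mul_pow]
          linear_combination (-Real.exp u * Real.exp s * (1 + Real.exp u) ^ 2) * h3
      _ ≤ _ := by rw [pow_zero, mul_one]; gcongr

theorem le_logisticDeriv_add (u s : ℝ) :
    logisticDeriv u * Real.exp (-|s|) ≤ logisticDeriv (u + s) := by
  have h := logisticDeriv_add_le (u + s) (-s)
  rw [add_neg_cancel_right, abs_neg] at h
  calc logisticDeriv u * Real.exp (-|s|)
      ≤ logisticDeriv (u + s) * Real.exp |s| * Real.exp (-|s|) := by gcongr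
    _ = _ := by rw [mul_assoc, ← Real.exp_add]; simp

theorem exp_abs_sub_one_le (s : ℝ) : Real.exp |s| - 1 ≤ |s| * Real.exp |s| := by
  have h := Real.add_one_le_exp (-|s|)
  have h1 := Real.exp_pos |s|
  have h2 : Real.exp (-|s|) * Real.exp |s| = 1 := by rw [← Real.exp_add]; simp
  nlinarith

theorem abs_logisticDeriv_add_sub_le (u s : ℝ) :
    |logisticDeriv (u + s) - logisticDeriv u| ≤ logisticDeriv u * (|s| * Real.exp |s|) := by
  have h0 := logisticDeriv_pos u
  rw [abs_le]
  constructor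
  · have h1 := le_logisticDeriv_add u s
    have h2 := Real.add_one_le_exp (-|s|)
    have h3 : |s| * 1 ≤ |s| * Real.exp |s| := by
      gcongr; exact Real.one_le_exp (abs_nonneg _)
    nlinarith
  · have h1 := logisticDeriv_add_le u s
    have h2 := exp_abs_sub_one_le s
    nlinarith

/-- A function vanishing at `0` whose derivative is bounded by `K` between `0` and `t` is bounded
by `K |t|` at `t`. -/
theorem abs_le_of_abs_deriv_le {φ φ' : ℝ → ℝ} (h : ∀ s, HasDerivAt φ (φ' s) s) (h0 : φ 0 = 0)
    {t K : ℝ} (hb : ∀ s, |s| ≤ |t| → |φ' s| ≤ K) : |φ t| ≤ K * |t| := by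
  have := (convex_Icc (-|t|) |t|).norm_image_sub_le_of_norm_hasDerivWithin_le (f := φ) (f' := φ')
    (C := K) (fun s _ => (h s).hasDerivWithinAt) (fun s hs => hb s (abs_le.2 hs))
    (show (0 : ℝ) ∈ Set.Icc (-|t|) |t| by simp) (abs_le.1 (le_refl |t|))
  simpa [h0] using this

/-- The remainder is relative to g'(u), so it stays bounded after division by π_N. It is obtained by
bounding the derivative of the remainder between 0 and t. -/
theorem abs_logistic_taylor (u t : ℝ) :
    |logistic (u + t) - logistic u - logisticDeriv u * t| ≤
      logisticDeriv u * (t ^ 2 * Real.exp |t|) := by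
  have h := abs_le_of_abs_deriv_le
    (φ := fun s => logistic (u + s) - logistic u - logisticDeriv u * s)
    (φ' := fun s => logisticDeriv (u + s) - logisticDeriv u) (t := t)
    (K := logisticDeriv u * (|t| * Real.exp |t|)) ?_ (by simp) ?_
  · calc _ ≤ _ := h
      _ = _ := by rw [← sq_abs t]; ring
  · intro s
    have h1 : HasDerivAt (fun s => logistic (u + s)) (logisticDeriv (u + s)) s :=
      HasDerivAt.comp_const_add u s (hasDerivAt_logistic (u + s))
    have h2 := (h1.sub_const (logistic u)).sub ((hasDerivAt_id s).const_mul (logisticDeriv u))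
    exact h2.congr_deriv (by simp)
  · intro s hs
    have := logisticDeriv_pos u
    refine (abs_logisticDeriv_add_sub_le u s).trans ?_
    gcongr

theorem abs_log_one_add_exp_taylor (u t : ℝ) :
    |Real.log (1 + Real.exp (u + t)) - Real.log (1 + Real.exp u) - logistic u * t
      - logisticDeriv u * t ^ 2 / 2| ≤ logisticDeriv u * (|t| ^ 3 * Real.exp |t|) := by
  have h := abs_le_of_abs_deriv_le
    (φ := fun s => Real.log (1 + Real.exp (u + s)) - Real.log (1 + Real.exp u) - logistic u * s
      - logisticDeriv u * s ^ 2 / 2)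
    (φ' := fun s => logistic (u + s) - logistic u - logisticDeriv u * s) (t := t)
    (K := logisticDeriv u * (t ^ 2 * Real.exp |t|)) ?_ (by simp) ?_
  · calc _ ≤ _ := h
      _ = _ := by rw [← sq_abs t]; ring
  · intro s
    have h1 : HasDerivAt (fun s => Real.log (1 + Real.exp (u + s))) (logistic (u + s)) s :=
      HasDerivAt.comp_const_add u s (hasDerivAt_log_one_add_exp (u + s))
    have h2 := ((h1.sub_const (Real.log (1 + Real.exp u))).sub
      ((hasDerivAt_id s).const_mul (logistic u))).sub
      ((((hasDerivAt_id s).pow 2).const_mul (logisticDeriv u)).div_const 2)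
    refine h2.congr_deriv ?_
    simp
    ring
  · intro s hs
    have := logisticDeriv_pos u
    refine (abs_logistic_taylor u s).trans ?_
    have : s ^ 2 ≤ t ^ 2 := sq_le_sq.2 hs
    gcongr

theorem abs_exp_sub_one_le (t : ℝ) : |1 - Real.exp (-t)| ≤ |t| * Real.exp |t| := by
  rw [abs_le]
  have h0 := exp_abs_sub_one_le t
  have h1 : Real.exp (-t) ≤ Real.exp |t| := Real.exp_le_exp.2 (neg_le_abs t)
  have h2 := Real.add_one_le_exp (-t)
  have h3 : |t| * 1 ≤ |t| * Real.exp |t| := by gcongr; exact Real.one_le_exp (abs_nonneg _)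
  constructor <;> linarith [le_abs_self t]

theorem abs_exp_taylor (t : ℝ) : |1 - Real.exp (-t) - t| ≤ t ^ 2 * Real.exp |t| := by
  have h := abs_le_of_abs_deriv_le (φ := fun s => 1 - Real.exp (-s) - s)
    (φ' := fun s => Real.exp (-s) - 1) (t := t) (K := |t| * Real.exp |t|) ?_ (by simp) ?_
  · calc _ ≤ _ := h
      _ = _ := by rw [← sq_abs t]; ring
  · intro s
    have h1 := (((hasDerivAt_id s).neg.exp).const_sub 1).sub (hasDerivAt_id s)
    refine h1.congr_deriv ?_
    simp
  · intro s hs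
    rw [abs_sub_comm]
    refine (abs_exp_sub_one_le s).trans ?_
    gcongr

/-- Applied to the ratio π̂/π_N, it replaces the logarithm in the intercept shift by the linear term
of the influence function. -/
theorem abs_log_sub_sub_one_le {x : ℝ} (hx : |x - 1| ≤ 1 / 2) :
    |Real.log x - (x - 1)| ≤ 2 * (x - 1) ^ 2 := by
  have hx0 := abs_le.1 hx
  have h1 := Real.log_le_sub_one_of_pos (show 0 < x by linarith)
  have h2 := Real.one_sub_inv_le_log_of_pos (show 0 < x by linarith)
  have h3 : (x - 1) - (1 - x⁻¹) ≤ 2 * (x - 1) ^ 2 := by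
    have : (x - 1) - (1 - x⁻¹) = (x - 1) ^ 2 * x⁻¹ := by
      have : x ≠ 0 := by linarith
      field_simp
    rw [this]
    have : x⁻¹ ≤ 2 := by
      rw [inv_le_comm₀ (by linarith) (by norm_num)]; linarith
    nlinarith [sq_nonneg (x - 1)]
  rw [abs_le]
  constructor <;> linarith [sq_nonneg (x - 1)]

end Logistic

/-! ### Logistic regression: a deterministic perturbation bound -/

section Convex

variable {E : Type*} [NormedAddCommGroup E] [NormedSpace ℝ E]

/-- A minimizer of a convex function whose values on a sphere exceed the value at the centre lies
in the ball. -/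
theorem norm_sub_lt_of_isMinOn {L : E → ℝ} (hconv : ConvexOn ℝ Set.univ L) {β₀ : E} {ρ : ℝ}
    (hρ : 0 < ρ) (h : ∀ δ : E, ‖δ‖ = ρ → L β₀ < L (β₀ + δ)) {β : E} (hβ : L β ≤ L β₀) :
    ‖β - β₀‖ < ρ := by
  by_contra! hcon
  have hpos : 0 < ‖β - β₀‖ := hρ.trans_le hcon
  -- The segment from β₀ to β meets the sphere at this parameter; convexity bounds the value there
  -- by that at β₀, against the hypothesis.
  set t := ρ / ‖β - β₀‖
  have ht0 : 0 ≤ t := by positivity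
  have ht1 : t ≤ 1 := (div_le_one hpos).2 hcon
  have h1 := h (t • (β - β₀)) (by
    rw [norm_smul, Real.norm_of_nonneg ht0, div_mul_cancel₀ _ hpos.ne'])
  have h2 := hconv.2 (Set.mem_univ β₀) (Set.mem_univ β) (sub_nonneg.2 ht1) ht0 (by ring)
  have h3 : (1 - t) • β₀ + t • β = β₀ + t • (β - β₀) := by module
  rw [h3, smul_eq_mul, smul_eq_mul] at h2
  nlinarith

/-- Compactness gives a minimizer over the closed ball. A point with a value at most that of the
centre lies in the ball by the previous lemma, so this minimizer is global. -/
theorem exists_isMinOn_of_sphere [FiniteDimensional ℝ E] {L : E → ℝ}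
    (hconv : ConvexOn ℝ Set.univ L) (hcont : Continuous L) {β₀ : E} {ρ : ℝ}
    (hρ : 0 < ρ) (h : ∀ δ : E, ‖δ‖ = ρ → L β₀ < L (β₀ + δ)) :
    ∃ β, IsMinOn L Set.univ β := by
  have := FiniteDimensional.proper_real E
  obtain ⟨β, hβ, hmin⟩ := (isCompact_closedBall β₀ ρ).exists_isMinOn
    ⟨β₀, Metric.mem_closedBall_self hρ.le⟩ hcont.continuousOn
  refine ⟨β, isMinOn_univ_iff.2 fun β' => ?_⟩
  have h0 : L β ≤ L β₀ := hmin (Metric.mem_closedBall_self hρ.le)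
  rcases le_total (L β') (L β₀) with h1 | h1
  · refine hmin ?_
    rw [Metric.mem_closedBall, dist_eq_norm]
    exact (norm_sub_lt_of_isMinOn hconv hρ h h1).le
  · exact h0.trans h1

end Convex

/-! ### Expansion of the empirical logistic risk and its minimizers. -/

section LogisticRisk

variable {ι E : Type*} [NormedAddCommGroup E] [InnerProductSpace ℝ E]

/-- The empirical logistic risk. -/
def logisticRisk (T : Finset ι) (x : ι → E) (r : ι → ℝ) (β : E) : ℝ :=
  (T.card : ℝ)⁻¹ * ∑ i ∈ T, (Real.log (1 + Real.exp (inner ℝ (x i) β)) - r i * inner ℝ (x i) β)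

/-- The score, minus the gradient of the risk. -/
def logisticScore (T : Finset ι) (x : ι → E) (r : ι → ℝ) (β : E) : E :=
  (T.card : ℝ)⁻¹ • ∑ i ∈ T, (r i - logistic (inner ℝ (x i) β)) • x i

/-- The Hessian of the risk, as a bilinear form. -/
def logisticHess (T : Finset ι) (x : ι → E) (β v w : E) : ℝ :=
  (T.card : ℝ)⁻¹ * ∑ i ∈ T, logisticDeriv (inner ℝ (x i) β) * (inner ℝ (x i) v * inner ℝ (x i) w)

/-- The bound for the third-order remainders. -/
def logisticThird (T : Finset ι) (x : ι → E) (β : E) : ℝ :=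
  (T.card : ℝ)⁻¹ * ∑ i ∈ T, logisticDeriv (inner ℝ (x i) β) * (‖x i‖ ^ 3 * Real.exp ‖x i‖)

variable (T : Finset ι) (x : ι → E) (r : ι → ℝ)

theorem convexOn_log_one_add_exp :
    ConvexOn ℝ Set.univ fun u : ℝ => Real.log (1 + Real.exp u) := by
  have hd : deriv (fun u : ℝ => Real.log (1 + Real.exp u)) = logistic :=
    funext fun u => (hasDerivAt_log_one_add_exp u).deriv
  refine Monotone.convexOn_univ_of_deriv
    (fun u => (hasDerivAt_log_one_add_exp u).differentiableAt) ?_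
  rw [hd]
  refine monotone_of_deriv_nonneg (fun u => (hasDerivAt_logistic u).differentiableAt) fun u => ?_
  rw [(hasDerivAt_logistic u).deriv]
  exact (logisticDeriv_pos u).le

theorem continuous_logisticRisk : Continuous (logisticRisk T x r) := by
  unfold logisticRisk
  refine Continuous.mul continuous_const (continuous_finsetSum _ fun i _ => ?_)
  refine Continuous.sub (Continuous.log (by fun_prop) fun β => by positivity) (by fun_prop)

theorem convexOn_logisticRisk : ConvexOn ℝ Set.univ (logisticRisk T x r) := by
  refine ⟨convex_univ, fun β _ β' _ s t hs ht hst => ?_⟩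
  simp only [logisticRisk, smul_eq_mul]
  rw [mul_left_comm s, mul_left_comm t, ← mul_add]
  refine mul_le_mul_of_nonneg_left ?_ (by positivity)
  rw [Finset.mul_sum, Finset.mul_sum, ← Finset.sum_add_distrib]
  refine Finset.sum_le_sum fun i _ => ?_
  have h := convexOn_log_one_add_exp.2 (Set.mem_univ (inner ℝ (x i) β))
    (Set.mem_univ (inner ℝ (x i) β')) hs ht hst
  simp only [smul_eq_mul] at h
  rw [inner_add_right, real_inner_smul_right, real_inner_smul_right]
  linarith

/-- The derivative along each line through the minimizer vanishes, which avoids any multivariate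
calculus. -/
theorem logisticScore_eq_zero {β : E} (hβ : IsMinOn (logisticRisk T x r) Set.univ β) :
    logisticScore T x r β = 0 := by
  refine ext_inner_right ℝ fun v => ?_
  have hd : HasDerivAt (fun t : ℝ => logisticRisk T x r (β + t • v))
      ((T.card : ℝ)⁻¹ * ∑ i ∈ T, (logistic (inner ℝ (x i) β) * inner ℝ (x i) v
        - r i * inner ℝ (x i) v)) 0 := by
    unfold logisticRisk
    refine HasDerivAt.const_mul _ (HasDerivAt.fun_sum fun i _ => ?_)
    have hi : HasDerivAt (fun t : ℝ => inner ℝ (x i) (β + t • v)) (inner ℝ (x i) v) 0 := by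
      simp only [inner_add_right, real_inner_smul_right]
      simpa using ((hasDerivAt_id (0 : ℝ)).mul_const (inner ℝ (x i) v)).const_add
        (inner ℝ (x i) β)
    have hl := hasDerivAt_log_one_add_exp (inner ℝ (x i) (β + (0 : ℝ) • v))
    have hc := HasDerivAt.comp (0 : ℝ) hl hi
    rw [zero_smul, add_zero] at hc
    exact hc.sub (hi.const_mul (r i))
  have hmin : IsLocalMin (fun t : ℝ => logisticRisk T x r (β + t • v)) 0 := by
    refine Eventually.of_forall fun t => ?_
    simpa using isMinOn_univ_iff.1 hβ (β + t • v)
  have h0 := hmin.hasDerivAt_eq_zero hd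
  rw [logisticScore, real_inner_smul_left, sum_inner, inner_zero_left]
  simp only [real_inner_smul_left]
  rw [← neg_eq_zero, ← h0, ← mul_neg, ← Finset.sum_neg_distrib]
  congr 1
  exact Finset.sum_congr rfl fun i _ => by ring

variable {T x r}

theorem abs_inner_le_of_norm_le_one {y δ : E} (hδ : ‖δ‖ ≤ 1) : |inner ℝ y δ| ≤ ‖y‖ :=
  (abs_real_inner_le_norm y δ).trans (by nlinarith [norm_nonneg y])

/-- A cubic lower bound for the increments of the risk. -/
theorem logisticRisk_lower {β₀ δ : E} (hδ : ‖δ‖ ≤ 1) :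
    -inner ℝ (logisticScore T x r β₀) δ + logisticHess T x β₀ δ δ / 2
      - logisticThird T x β₀ * ‖δ‖ ^ 3 ≤
    logisticRisk T x r (β₀ + δ) - logisticRisk T x r β₀ := by
  rw [logisticScore, logisticHess, logisticThird, logisticRisk, logisticRisk,
    real_inner_smul_left, sum_inner, ← mul_neg, ← Finset.sum_neg_distrib, mul_div_assoc,
    Finset.sum_div, ← mul_add, ← Finset.sum_add_distrib, mul_assoc, Finset.sum_mul, ← mul_sub,
    ← mul_sub, ← Finset.sum_sub_distrib, ← Finset.sum_sub_distrib]
  refine mul_le_mul_of_nonneg_left (Finset.sum_le_sum fun i _ => ?_) (by positivity)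
  have h := (abs_le.1 (abs_log_one_add_exp_taylor (inner ℝ (x i) β₀) (inner ℝ (x i) δ))).1
  have h1 := abs_inner_le_of_norm_le_one (y := x i) hδ
  have h2 := abs_real_inner_le_norm (x i) δ
  have h3 := logisticDeriv_pos (inner ℝ (x i) β₀)
  have h4 : |inner ℝ (x i) δ| ^ 3 * Real.exp |inner ℝ (x i) δ| ≤
      (‖x i‖ * ‖δ‖) ^ 3 * Real.exp ‖x i‖ := by gcongr
  have h5 := mul_le_mul_of_nonneg_left h4 h3.le
  rw [inner_add_right, real_inner_smul_left]
  rw [mul_pow] at h5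
  nlinarith

/-- The score vanishes at the minimizer, so the score at β₀ is a difference of two scores, which a
first-order Taylor expansion turns into the Hessian applied to δ. -/
theorem norm_score_sub_le {β₀ δ : E} (hδ : ‖δ‖ ≤ 1)
    (hmin : IsMinOn (logisticRisk T x r) Set.univ (β₀ + δ)) (v : E) :
    |inner ℝ (logisticScore T x r β₀) v - logisticHess T x β₀ δ v| ≤
      logisticThird T x β₀ * ‖δ‖ ^ 2 * ‖v‖ := by
  have h0 : inner ℝ (logisticScore T x r (β₀ + δ)) v = 0 := by
    rw [logisticScore_eq_zero T x r hmin, inner_zero_left]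
  rw [← sub_zero (inner ℝ (logisticScore T x r β₀) v), ← h0]
  rw [logisticScore, logisticScore, logisticHess, logisticThird,
    real_inner_smul_left, sum_inner, real_inner_smul_left, sum_inner, ← mul_sub, ← mul_sub,
    ← Finset.sum_sub_distrib, ← Finset.sum_sub_distrib, abs_mul, mul_assoc, mul_assoc,
    Finset.sum_mul, abs_of_nonneg (by positivity : (0 : ℝ) ≤ (T.card : ℝ)⁻¹)]
  refine mul_le_mul_of_nonneg_left ((Finset.abs_sum_le_sum_abs _ _).trans
    (Finset.sum_le_sum fun i _ => ?_)) (by positivity)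
  have h := abs_logistic_taylor (inner ℝ (x i) β₀) (inner ℝ (x i) δ)
  have h1 := abs_inner_le_of_norm_le_one (y := x i) hδ
  have h2 := abs_real_inner_le_norm (x i) δ
  have h3 := logisticDeriv_pos (inner ℝ (x i) β₀)
  have h4 : inner ℝ (x i) δ ^ 2 * Real.exp |inner ℝ (x i) δ| ≤
      (‖x i‖ * ‖δ‖) ^ 2 * Real.exp ‖x i‖ := by
    rw [← sq_abs (inner ℝ (x i) δ)]
    gcongr
  have e : (inner ℝ ((r i - logistic (inner ℝ (x i) β₀)) • x i) v
      - inner ℝ ((r i - logistic (inner ℝ (x i) (β₀ + δ))) • x i) v)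
      - logisticDeriv (inner ℝ (x i) β₀) * (inner ℝ (x i) δ * inner ℝ (x i) v) =
      (logistic (inner ℝ (x i) β₀ + inner ℝ (x i) δ) - logistic (inner ℝ (x i) β₀)
        - logisticDeriv (inner ℝ (x i) β₀) * inner ℝ (x i) δ) * inner ℝ (x i) v := by
    rw [inner_add_right, real_inner_smul_left, real_inner_smul_left]
    ring
  rw [e, abs_mul]
  calc _ ≤ (logisticDeriv (inner ℝ (x i) β₀) * ((‖x i‖ * ‖δ‖) ^ 2 * Real.exp ‖x i‖)) *
        (‖x i‖ * ‖v‖) := by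
        refine mul_le_mul (h.trans ?_) (abs_real_inner_le_norm _ _) (abs_nonneg _) (by positivity)
        gcongr
    _ = _ := by ring

theorem logisticThird_nonneg (β₀ : E) : 0 ≤ logisticThird T x β₀ := by
  unfold logisticThird
  refine mul_nonneg (by positivity) (Finset.sum_nonneg fun i _ => ?_)
  have := logisticDeriv_pos (inner ℝ (x i) β₀)
  positivity

/-- Existence, location and linearization of the minimizers of the logistic risk. -/
theorem logisticRisk_minimizers [FiniteDimensional ℝ E] {β₀ : E} {J : E → E} {l e ρ : ℝ}
    (hl : 0 < l) (he0 : 0 ≤ e) (hρ : 0 < ρ) (hρ1 : ρ ≤ 1)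
    (hJ : ∀ v, l * ‖v‖ ^ 2 ≤ inner ℝ (J v) v)
    (he : ∀ v w, |logisticHess T x β₀ v w - inner ℝ (J v) w| ≤ e * ‖v‖ * ‖w‖)
    (he' : e ≤ l / 2) (hb : logisticThird T x β₀ * ρ ≤ l / 8)
    (hS : ‖logisticScore T x r β₀‖ < l * ρ / 8) :
    (∃ β, IsMinOn (logisticRisk T x r) Set.univ β) ∧
    ∀ β, IsMinOn (logisticRisk T x r) Set.univ β →
      ‖β - β₀‖ ≤ 8 / l * ‖logisticScore T x r β₀‖ ∧ ‖β - β₀‖ ≤ 1 ∧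
      ‖logisticScore T x r β₀ - J (β - β₀)‖ ≤
        (e + logisticThird T x β₀ * ‖β - β₀‖) * ‖β - β₀‖ := by
  set S := logisticScore T x r β₀
  set b := logisticThird T x β₀ with hbdef
  have hb0 : 0 ≤ b := logisticThird_nonneg β₀
  -- Coercivity gives l/2 for the coefficient of ‖δ‖². The Hessian error costs at most l/4 and the
  -- cubic term at most l/8 inside the ball, which leaves l/8.
  have lower : ∀ δ : E, ‖δ‖ ≤ ρ →
      ‖δ‖ * (l / 8 * ‖δ‖ - ‖S‖) ≤ logisticRisk T x r (β₀ + δ) - logisticRisk T x r β₀ := by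
    intro δ hδ
    have h1 := logisticRisk_lower (T := T) (x := x) (r := r) (β₀ := β₀) (hδ.trans hρ1)
    have h2 : inner ℝ S δ ≤ ‖S‖ * ‖δ‖ := real_inner_le_norm S δ
    have h3 := (abs_le.1 (he δ δ)).1
    have h4 := hJ δ
    have h5 : b * ‖δ‖ ≤ l / 8 := (mul_le_mul_of_nonneg_left hδ hb0).trans hb
    have h6 : b * ‖δ‖ ^ 3 ≤ l / 8 * ‖δ‖ ^ 2 := by
      calc b * ‖δ‖ ^ 3 = b * ‖δ‖ * ‖δ‖ ^ 2 := by ring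
        _ ≤ _ := by gcongr
    have h7 : e * ‖δ‖ * ‖δ‖ ≤ l / 2 * ‖δ‖ * ‖δ‖ := by gcongr
    refine le_trans ?_ h1
    nlinarith
  have hsphere : ∀ δ : E, ‖δ‖ = ρ →
      logisticRisk T x r β₀ < logisticRisk T x r (β₀ + δ) := by
    intro δ hδ
    have := lower δ hδ.le
    rw [hδ] at this
    nlinarith
  refine ⟨exists_isMinOn_of_sphere (convexOn_logisticRisk T x r) (continuous_logisticRisk T x r)
    hρ hsphere, fun β hβ => ?_⟩
  have hβ0 := isMinOn_univ_iff.1 hβ β₀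
  have hball := norm_sub_lt_of_isMinOn (convexOn_logisticRisk T x r) hρ hsphere hβ0
  set δ := β - β₀ with hδ
  have hβδ : β = β₀ + δ := by simp [hδ]
  refine ⟨?_, hball.le.trans hρ1, ?_⟩
  · have h1 := lower δ hball.le
    rw [← hβδ] at h1
    rw [div_mul_eq_mul_div, le_div_iff₀ hl]
    rcases (norm_nonneg δ).eq_or_lt with h0 | h0
    · rw [← h0]; simp
    · have h2 : ‖δ‖ * (l / 8 * ‖δ‖ - ‖S‖) ≤ 0 := by linarith
      have h3 : l / 8 * ‖δ‖ - ‖S‖ ≤ 0 := by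
        by_contra! hc
        nlinarith
      linarith
  · have key : ∀ v, inner ℝ (S - J δ) v ≤ (e + b * ‖δ‖) * ‖δ‖ * ‖v‖ := by
      intro v
      rw [hβδ] at hβ
      have h1 := (abs_le.1 (norm_score_sub_le (hball.le.trans hρ1) hβ v)).2
      have h2 := (abs_le.1 (he δ v)).2
      rw [inner_sub_left]
      nlinarith
    -- Testing against the residual itself turns the bound on the linear form into a bound on the
    -- norm.
    have h1 := key (S - J δ)
    rw [real_inner_self_eq_norm_sq] at h1
    rcases (norm_nonneg (S - J δ)).eq_or_lt with h0 | h0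
    · rw [← h0]
      positivity
    · nlinarith

end LogisticRisk

/-! ### The exponential envelope and the information matrix -/

section Envelope

variable {p : ℕ}

/-- The envelope `exp (t (1 + ‖x‖))`. -/
def env (t : ℝ) (x : Cov p) : ℝ := Real.exp (t * (1 + ‖x‖))

theorem env_pos (t : ℝ) (x : Cov p) : 0 < env t x := Real.exp_pos _

@[fun_prop]
theorem measurable_env (t : ℝ) : Measurable (env t : Cov p → ℝ) := by
  unfold env
  fun_prop

theorem env_mul (s t : ℝ) (x : Cov p) : env s x * env t x = env (s + t) x := by
  rw [env, env, env, ← Real.exp_add]; ring_nf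

theorem env_mono {s t : ℝ} (h : s ≤ t) (x : Cov p) : env s x ≤ env t x := by
  unfold env
  gcongr

theorem one_le_env {t : ℝ} (ht : 0 ≤ t) (x : Cov p) : 1 ≤ env t x :=
  Real.one_le_exp (by positivity)

theorem env_inv (t : ℝ) (x : Cov p) : (env t x)⁻¹ = env (-t) x := by
  rw [env, env, ← Real.exp_neg]; ring_nf

theorem env_pow (t : ℝ) (x : Cov p) (k : ℕ) : env t x ^ k = env (k * t) x := by
  rw [env, env, ← Real.exp_nat_mul]; ring_nf

theorem two_le_env (x : Cov p) : 2 ≤ env 1 x := by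
  unfold env
  have := Real.add_one_le_exp (1 * (1 + ‖x‖))
  linarith [norm_nonneg x]

theorem norm_aug_le (x : Cov p) : ‖aug x‖ ≤ 1 + ‖x‖ := by
  rw [← abs_of_nonneg (norm_nonneg (aug x)), ← abs_of_nonneg (by positivity : 0 ≤ 1 + ‖x‖),
    ← sq_le_sq, EuclideanSpace.norm_sq_eq, Fin.sum_univ_succ]
  have h := EuclideanSpace.norm_sq_eq x
  simp only [aug, Fin.cons_zero, Fin.cons_succ] at h ⊢
  rw [← h]
  simp
  nlinarith [norm_nonneg x]

theorem norm_aug_le_env (x : Cov p) : ‖aug x‖ ≤ env 1 x := by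
  refine (norm_aug_le x).trans ?_
  unfold env
  have := Real.add_one_le_exp (1 * (1 + ‖x‖))
  linarith

theorem exp_norm_aug_le_env (x : Cov p) : Real.exp ‖aug x‖ ≤ env 1 x := by
  unfold env
  rw [one_mul]
  gcongr
  exact norm_aug_le x

theorem abs_aug_apply_le_env (x : Cov p) (i : Fin (p + 1)) : |aug x i| ≤ env 1 x :=
  (PiLp.norm_apply_le (aug x) i).trans (norm_aug_le_env x)

@[fun_prop]
theorem measurable_aug_apply (i : Fin (p + 1)) : Measurable fun x : Cov p => aug x i :=
  (PiLp.continuous_ofLp 2 _ |>.measurable.comp measurable_aug |>.eval)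

theorem inner_aug_single (x : Cov p) (t : ℝ) :
    inner ℝ (aug x) (t • EuclideanSpace.single 0 (1 : ℝ)) = t := by
  rw [real_inner_smul_right, EuclideanSpace.inner_single_right]
  simp [aug]

variable {γ : Par p} {C : ℝ}

theorem abs_inner_aug_le (hγ : ‖γ‖ ≤ C) (x : Cov p) : |inner ℝ (aug x) γ| ≤ C * (1 + ‖x‖) := by
  calc _ ≤ ‖aug x‖ * ‖γ‖ := abs_real_inner_le_norm _ _
    _ ≤ (1 + ‖x‖) * C := by
        gcongr
        exact norm_aug_le x
    _ = _ := by ring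

theorem exp_inner_aug_le (hγ : ‖γ‖ ≤ C) (x : Cov p) : Real.exp (inner ℝ (aug x) γ) ≤ env C x := by
  unfold env
  gcongr
  exact (le_abs_self _).trans (abs_inner_aug_le hγ x)

theorem le_exp_inner_aug (hγ : ‖γ‖ ≤ C) (x : Cov p) :
    env (-C) x ≤ Real.exp (inner ℝ (aug x) γ) := by
  unfold env
  gcongr
  rw [neg_mul]
  exact neg_le_of_abs_le (abs_inner_aug_le hγ x)

theorem inv_offsetPS {a : ℝ} (ha : 0 < a) (γ : Par p) (x : Cov p) :
    (offsetPS a γ x)⁻¹ = 1 + a⁻¹ * (Real.exp (inner ℝ (aug x) γ))⁻¹ := by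
  unfold offsetPS
  field_simp
  ring

theorem offsetPS_pos {a : ℝ} (ha : 0 < a) (γ : Par p) (x : Cov p) : 0 < offsetPS a γ x := by
  unfold offsetPS; positivity

theorem offsetPS_le_env {a : ℝ} (ha : 0 < a) (hγ : ‖γ‖ ≤ C) (x : Cov p) :
    offsetPS a γ x ≤ a * env C x := by
  have h := Real.exp_pos (inner ℝ (aug x) γ)
  calc offsetPS a γ x ≤ a * Real.exp (inner ℝ (aug x) γ) := by
        unfold offsetPS
        exact div_le_self (by positivity) (by nlinarith [mul_pos ha h])
    _ ≤ _ := by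
        gcongr
        exact exp_inner_aug_le hγ x

/-- As a ≤ 1, the constant 1 in 1/π is at most a⁻¹ times the envelope; the resulting factor 2 is
absorbed in `env 1`, whence the exponent C + 1. -/
theorem inv_offsetPS_le_env {a : ℝ} (ha : 0 < a) (ha1 : a ≤ 1) (hγ : ‖γ‖ ≤ C) (x : Cov p) :
    (offsetPS a γ x)⁻¹ ≤ a⁻¹ * env (C + 1) x := by
  have hC : 0 ≤ C := (norm_nonneg γ).trans hγ
  rw [inv_offsetPS ha]
  have h1 : (Real.exp (inner ℝ (aug x) γ))⁻¹ ≤ env C x := by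
    rw [inv_le_comm₀ (Real.exp_pos _) (env_pos _ _), env_inv]
    exact le_exp_inner_aug hγ x
  have h2 : 1 ≤ a⁻¹ := (one_le_inv₀ ha).2 ha1
  have h3 := one_le_env hC x
  calc 1 + a⁻¹ * (Real.exp (inner ℝ (aug x) γ))⁻¹ ≤ a⁻¹ * env C x + a⁻¹ * env C x := by
        gcongr
        nlinarith
    _ = a⁻¹ * (env C x * 2) := by ring
    _ ≤ a⁻¹ * (env C x * env 1 x) := by
        have := env_pos C x
        gcongr
        exact two_le_env x
    _ = _ := by rw [env_mul]

theorem env_le_inv_offsetPS {a : ℝ} (ha : 0 < a) (hγ : ‖γ‖ ≤ C) (x : Cov p) :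
    a⁻¹ * env (-C) x < (offsetPS a γ x)⁻¹ := by
  rw [inv_offsetPS ha]
  have h1 : env (-C) x ≤ (Real.exp (inner ℝ (aug x) γ))⁻¹ := by
    rw [← env_inv]
    exact inv_anti₀ (Real.exp_pos _) (exp_inner_aug_le hγ x)
  have h2 : a⁻¹ * env (-C) x ≤ a⁻¹ * (Real.exp (inner ℝ (aug x) γ))⁻¹ := by gcongr
  linarith

/-- Every real t is allowed, so products and powers of envelopes, which are again envelopes, may be
formed at will. -/
theorem integrable_env {ν : Measure (ℝ × Cov p)} [IsProbabilityMeasure ν]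
    (hX : ∀ t : ℝ, 0 < t → Integrable (fun x : Cov p => Real.exp (t * ‖x‖)) ν.snd) (t : ℝ) :
    Integrable (env t : Cov p → ℝ) ν.snd := by
  have h := (hX (max t 1) (by positivity)).const_mul (Real.exp t)
  refine h.mono' (by fun_prop) (Eventually.of_forall fun x => ?_)
  rw [Real.norm_of_nonneg (env_pos t x).le, env, ← Real.exp_add]
  gcongr
  nlinarith [le_max_left t 1, norm_nonneg x]

end Envelope

/-! ### Coercivity of the information matrix. -/

section Information

variable {p : ℕ} {ν : Measure (ℝ × Cov p)} [IsProbabilityMeasure ν]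

/-- The quadratic form of the information matrix. -/
theorem inner_infoMatrix
    (hX : ∀ t : ℝ, 0 < t → Integrable (fun x : Cov p => Real.exp (t * ‖x‖)) ν.snd)
    (γ : Par p) (a : ℝ) (v w : Par p) :
    inner ℝ (Matrix.toEuclideanCLM (𝕜 := ℝ) (infoMatrix ν γ a) v) w =
      ∫ x, inner ℝ (aug x) v * inner ℝ (aug x) w *
        logisticDeriv (inner ℝ (aug x) γ + Real.log a) ∂ν.snd := by
  obtain ⟨D, hD⟩ : ∃ D : Cov p → ℝ,
    ∀ x, logisticDeriv (inner ℝ (aug x) γ + Real.log a) = D x := ⟨_, fun _ => rfl⟩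
  have hDm : Measurable D := by
    rw [← funext hD]
    fun_prop
  have hint : ∀ i j, Integrable (fun x : Cov p => aug x i * aug x j * D x) ν.snd := by
    intro i j
    refine (integrable_env hX 2).mono' (Measurable.aestronglyMeasurable
      (((measurable_aug_apply i).mul (measurable_aug_apply j)).mul hDm))
      (Eventually.of_forall fun x => ?_)
    rw [← hD, norm_mul, norm_mul, Real.norm_of_nonneg (logisticDeriv_pos _).le]
    calc _ ≤ env 1 x * env 1 x * 1 := by
          have := env_pos 1 x
          have := logisticDeriv_pos (inner ℝ (aug x) γ + Real.log a)
          gcongr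
          · exact abs_aug_apply_le_env x i
          · exact abs_aug_apply_le_env x j
          · exact logisticDeriv_le_one _
      _ = _ := by rw [mul_one, env_mul]; norm_num
  have hsum : ∀ x : Cov p, inner ℝ (aug x) v * inner ℝ (aug x) w * D x =
      ∑ i, ∑ j, w i * v j * (aug x i * aug x j * D x) := by
    intro x
    simp only [PiLp.inner_apply, RCLike.inner_apply, conj_trivial]
    rw [mul_comm (∑ i, v i * aug x i), Finset.sum_mul_sum, Finset.sum_mul]
    refine Finset.sum_congr rfl fun i _ => ?_
    rw [Finset.sum_mul]
    refine Finset.sum_congr rfl fun j _ => ?_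
    ring
  simp only [hD, hsum]
  rw [integral_finsetSum _ fun i _ => integrable_finsetSum _ fun j _ => (hint i j).const_mul _]
  simp only [PiLp.inner_apply, RCLike.inner_apply, conj_trivial]
  refine Finset.sum_congr rfl fun i _ => ?_
  rw [integral_finsetSum _ fun j _ => (hint i j).const_mul _]
  simp only [integral_const_mul, Matrix.ofLp_toEuclideanCLM, Matrix.mulVec, dotProduct, infoMatrix,
    Matrix.of_apply, Finset.mul_sum, hD]
  exact Finset.sum_congr rfl fun j _ => by ring

/-- Lowering the offset to log a multiplies the numerator of g' by a and can only decrease its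
denominator. This carries nondegeneracy from offset zero to offset log a at the price of a factor a,
which is the true order. -/
theorem mul_logisticDeriv_le {a : ℝ} (ha : 0 < a) (ha1 : a ≤ 1) (u : ℝ) :
    a * logisticDeriv u ≤ logisticDeriv (u + Real.log a) := by
  rw [logisticDeriv_eq, logisticDeriv_eq, Real.exp_add, Real.exp_log ha, mul_div_assoc',
    mul_comm a]
  have := Real.exp_pos u
  gcongr
  nlinarith

theorem integrable_infoForm
    (hX : ∀ t : ℝ, 0 < t → Integrable (fun x : Cov p => Real.exp (t * ‖x‖)) ν.snd)
    (γ : Par p) (a : ℝ) (v : Par p) :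
    Integrable (fun x => inner ℝ (aug x) v * inner ℝ (aug x) v *
        logisticDeriv (inner ℝ (aug x) γ + Real.log a)) ν.snd := by
  refine ((integrable_env hX 2).const_mul (‖v‖ ^ 2)).mono'
    (Measurable.aestronglyMeasurable (by fun_prop))
    (Eventually.of_forall fun x => ?_)
  rw [norm_mul, norm_mul, Real.norm_of_nonneg (logisticDeriv_pos _).le]
  calc _ ≤ (env 1 x * ‖v‖) * (env 1 x * ‖v‖) * 1 := by
        have h : ‖inner ℝ (aug x) v‖ ≤ env 1 x * ‖v‖ :=
          (norm_inner_le_norm _ _).trans (by gcongr; exact norm_aug_le_env x)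
        have := env_pos 1 x
        have := logisticDeriv_pos (inner ℝ (aug x) γ + Real.log a)
        gcongr
        exact logisticDeriv_le_one _
    _ = ‖v‖ ^ 2 * (env 1 x * env 1 x) := by ring
    _ = _ := by rw [env_mul]; norm_num

variable {γ : Par p} {C : ℝ}

theorem toEuclideanCLM_mul_inv {n : ℕ} {A : Matrix (Fin n) (Fin n) ℝ} (hA : IsUnit A)
    (v : EuclideanSpace ℝ (Fin n)) :
    Matrix.toEuclideanCLM (𝕜 := ℝ) A (Matrix.toEuclideanCLM (𝕜 := ℝ) A⁻¹ v) = v := by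
  have h : A * A⁻¹ = 1 := Matrix.mul_nonsing_inv A ((Matrix.isUnit_iff_isUnit_det A).1 hA)
  have h2 := congrArg (Matrix.toEuclideanCLM (𝕜 := ℝ)) h
  rw [map_mul, map_one] at h2
  exact congrArg (fun L => L v) h2

/-- A bound on the inverse becomes a lower bound on the form by positivity alone, with no spectral
theory. -/
theorem infoMatrix_one_coercive
    (hX : ∀ t : ℝ, 0 < t → Integrable (fun x : Cov p => Real.exp (t * ‖x‖)) ν.snd)
    (hpos : (infoMatrix ν γ 1).PosDef) (hC : 0 < C)
    (hinv : ‖Matrix.toEuclideanCLM (𝕜 := ℝ) (infoMatrix ν γ 1)⁻¹‖ ≤ C) (v : Par p) :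
    C⁻¹ * ‖v‖ ^ 2 ≤ inner ℝ (Matrix.toEuclideanCLM (𝕜 := ℝ) (infoMatrix ν γ 1) v) v := by
  set J := Matrix.toEuclideanCLM (𝕜 := ℝ) (infoMatrix ν γ 1) with hJ
  set y := Matrix.toEuclideanCLM (𝕜 := ℝ) (infoMatrix ν γ 1)⁻¹ v with hy
  have hJy : J y = v := toEuclideanCLM_mul_inv hpos.isUnit v
  have hsymm : inner ℝ (J v) y = inner ℝ (J y) v := by
    rw [hJ, inner_infoMatrix hX, inner_infoMatrix hX]
    simp only [mul_comm (inner ℝ (aug _) v)]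
  have hnn : ∀ u, 0 ≤ inner ℝ (J u) u := by
    intro u
    rw [hJ, inner_infoMatrix hX]
    refine integral_nonneg fun x => mul_nonneg (mul_self_nonneg _) (logisticDeriv_pos _).le
  -- With y = J⁻¹v, expanding gives ⟨Jv, v⟩ ≥ 2C⁻¹‖v‖² - C⁻²⟨v, y⟩, and the last term is at most
  -- C⁻¹‖v‖². The choice of C⁻¹ as the multiple of y balances the two.
  have h1 := hnn (v - C⁻¹ • y)
  rw [map_sub, map_smul, hJy] at h1
  simp only [inner_sub_left, inner_sub_right, real_inner_smul_left, real_inner_smul_right,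
    hsymm, hJy, real_inner_self_eq_norm_sq] at h1
  have h2 : inner ℝ v y ≤ C * ‖v‖ ^ 2 := by
    calc inner ℝ v y ≤ ‖v‖ * ‖y‖ := real_inner_le_norm _ _
      _ ≤ ‖v‖ * (C * ‖v‖) := by
          gcongr
          exact ((Matrix.toEuclideanCLM (𝕜 := ℝ) (infoMatrix ν γ 1)⁻¹).le_opNorm v).trans
            (by gcongr)
      _ = _ := by ring
  have h3 : C⁻¹ * (C⁻¹ * inner ℝ v y) ≤ C⁻¹ * (C⁻¹ * (C * ‖v‖ ^ 2)) := by gcongr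
  have h4 : C⁻¹ * (C⁻¹ * (C * ‖v‖ ^ 2)) = C⁻¹ * ‖v‖ ^ 2 := by field_simp
  linarith

theorem infoMatrix_coercive
    (hX : ∀ t : ℝ, 0 < t → Integrable (fun x : Cov p => Real.exp (t * ‖x‖)) ν.snd)
    (hpos : (infoMatrix ν γ 1).PosDef) (hC : 0 < C)
    (hinv : ‖Matrix.toEuclideanCLM (𝕜 := ℝ) (infoMatrix ν γ 1)⁻¹‖ ≤ C)
    {a : ℝ} (ha : 0 < a) (ha1 : a ≤ 1) (v : Par p) :
    a / C * ‖v‖ ^ 2 ≤ inner ℝ (Matrix.toEuclideanCLM (𝕜 := ℝ) (infoMatrix ν γ a) v) v := by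
  have h1 := infoMatrix_one_coercive hX hpos hC hinv v
  have h2 : a * inner ℝ (Matrix.toEuclideanCLM (𝕜 := ℝ) (infoMatrix ν γ 1) v) v ≤
      inner ℝ (Matrix.toEuclideanCLM (𝕜 := ℝ) (infoMatrix ν γ a) v) v := by
    rw [inner_infoMatrix hX, inner_infoMatrix hX, ← integral_const_mul]
    refine integral_mono ((integrable_infoForm hX γ 1 v).const_mul a)
      (integrable_infoForm hX γ a v) fun x => ?_
    have := mul_logisticDeriv_le ha ha1 (inner ℝ (aug x) γ)
    simp only [Real.log_one, add_zero]
    nlinarith [mul_self_nonneg (inner ℝ (aug x) v)]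
  calc a / C * ‖v‖ ^ 2 = a * (C⁻¹ * ‖v‖ ^ 2) := by ring
    _ ≤ _ := (mul_le_mul_of_nonneg_left h1 ha.le).trans h2

theorem isUnit_of_coercive {n : ℕ} {A : Matrix (Fin n) (Fin n) ℝ} {l : ℝ} (hl : 0 < l)
    (h : ∀ v, l * ‖v‖ ^ 2 ≤ inner ℝ (Matrix.toEuclideanCLM (𝕜 := ℝ) A v) v) : IsUnit A := by
  rw [← Matrix.mulVec_injective_iff_isUnit]
  intro u w huw
  have h0 : Matrix.toEuclideanCLM (𝕜 := ℝ) A (WithLp.toLp 2 (u - w)) = 0 := by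
    rw [Matrix.toEuclideanCLM_toLp, Matrix.mulVec_sub]
    rw [show A.mulVec u = A.mulVec w from huw, sub_self]
    rfl
  have h1 := h (WithLp.toLp 2 (u - w))
  rw [h0, inner_zero_left] at h1
  have h2 : ‖WithLp.toLp 2 (u - w)‖ ^ 2 ≤ 0 := by
    by_contra! hc
    nlinarith
  have h3 : WithLp.toLp 2 (u - w) = 0 := by
    rw [← norm_eq_zero]
    nlinarith [norm_nonneg (WithLp.toLp 2 (u - w))]
  have h4 : u - w = 0 := (WithLp.toLp_eq_zero 2).1 h3
  exact sub_eq_zero.1 h4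

theorem norm_inv_apply_le_of_coercive {n : ℕ} {A : Matrix (Fin n) (Fin n) ℝ} {l : ℝ} (hl : 0 < l)
    (h : ∀ v, l * ‖v‖ ^ 2 ≤ inner ℝ (Matrix.toEuclideanCLM (𝕜 := ℝ) A v) v)
    (w : EuclideanSpace ℝ (Fin n)) :
    ‖Matrix.toEuclideanCLM (𝕜 := ℝ) A⁻¹ w‖ ≤ l⁻¹ * ‖w‖ := by
  set y := Matrix.toEuclideanCLM (𝕜 := ℝ) A⁻¹ w
  have h1 := h y
  rw [toEuclideanCLM_mul_inv (isUnit_of_coercive hl h) w] at h1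
  have h2 := real_inner_le_norm w y
  rw [inv_mul_eq_div, le_div_iff₀ hl]
  rcases (norm_nonneg y).eq_or_lt with h0 | h0
  · rw [← h0]; simp
  · nlinarith

end Information

/-! ### The asymptotic regime -/

section Regime

variable {p K : ℕ}

/-- The standing assumptions on the population, the sequence of models and the samples. -/
structure Regime (ν : Measure (ℝ × Cov p)) (Q : ℕ → Measure (Pt p))
    [∀ N, IsProbabilityMeasure (Q N)] (γ₀ : ℕ → Par p) (C : ℝ) {Ω : ℕ → Type*}
    [∀ N, MeasurableSpace (Ω N)] (P : ∀ N, Measure (Ω N)) (Z : ∀ N, Fin N → Ω N → Pt p)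
    (fold : ∀ N, Ω N → Fin N → Fin K) : Prop where
  two_le : 2 ≤ K
  exp_moments : ∀ t : ℝ, 0 < t → Integrable (fun x : Cov p => Real.exp (t * ‖x‖)) ν.snd
  model : ∀ N, IsOffsetModel ν (Q N) (γ₀ N)
  tendsto_size : Tendsto (fun N : ℕ => (N : ℝ) * labelProb (Q N)) atTop atTop
  norm_le : ∀ N, ‖γ₀ N‖ ≤ C
  const_pos : 0 < C
  posDef : ∀ N, (infoMatrix ν (γ₀ N) 1).PosDef
  inv_le : ∀ N, ‖Matrix.toEuclideanCLM (𝕜 := ℝ) (infoMatrix ν (γ₀ N) 1)⁻¹‖ ≤ C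
  sample : ∀ N, IsSample (P N) (Q N) (Z N) (fold N)
  folds : ∀ k : Fin K, IsLittleOp P
      (fun N ω => ((Finset.univ.filter fun i => fold N ω i = k).card : ℝ) / N - 1 / K)
      (fun _ => 1)

variable {ν : Measure (ℝ × Cov p)} [IsProbabilityMeasure ν] {Q : ℕ → Measure (Pt p)}
  [∀ N, IsProbabilityMeasure (Q N)] {γ₀ : ℕ → Par p} {C : ℝ} {Ω : ℕ → Type*}
  [∀ N, MeasurableSpace (Ω N)] {P : ∀ N, Measure (Ω N)} [∀ N, IsProbabilityMeasure (P N)]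
  {Z : ∀ N, Fin N → Ω N → Pt p} {fold : ∀ N, Ω N → Fin N → Fin K}

/-- The rate `(N π_N)^(-1/2)`. -/
def rate (Q : ℕ → Measure (Pt p)) (N : ℕ) : ℝ := (Real.sqrt (N * labelProb (Q N)))⁻¹

theorem Regime.labelProb_pos (h : Regime ν Q γ₀ C P Z fold) :
    ∀ᶠ N in atTop, 0 < labelProb (Q N) := by
  filter_upwards [h.tendsto_size.eventually_gt_atTop 0] with N hN
  exact pos_of_mul_pos_right hN (Nat.cast_nonneg N)

theorem Regime.tendsto_rate (h : Regime ν Q γ₀ C P Z fold) :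
    Tendsto (rate Q) atTop (𝓝 0) :=
  (Real.tendsto_sqrt_atTop.comp h.tendsto_size).inv_tendsto_atTop

theorem Regime.rate_pos (h : Regime ν Q γ₀ C P Z fold) : ∀ᶠ N in atTop, 0 < rate Q N := by
  filter_upwards [h.tendsto_size.eventually_gt_atTop 0] with N hN
  unfold rate
  positivity

theorem rate_nonneg (N : ℕ) : 0 ≤ rate Q N := by
  unfold rate; positivity

theorem eventually_rate_nonneg : ∀ᶠ N in atTop, 0 ≤ rate Q N :=
  Eventually.of_forall rate_nonneg

/-! #### Moments under the model -/

theorem integral_env_pos (h : Regime ν Q γ₀ C P Z fold) (t : ℝ) :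
    0 < ∫ x, env t x ∂ν.snd := by
  rw [integral_pos_iff_support_of_nonneg (fun x => (env_pos t x).le)
    (integrable_env h.exp_moments t)]
  have : Function.support (env t : Cov p → ℝ) = Set.univ := by
    ext x; simp [(env_pos t x).ne']
  rw [this]
  simp

theorem lintegral_env (h : Regime ν Q γ₀ C P Z fold) (t : ℝ) :
    ∫⁻ x, ENNReal.ofReal (env t x) ∂ν.snd = ENNReal.ofReal (∫ x, env t x ∂ν.snd) :=
  (ofReal_integral_eq_lintegral_ofReal (integrable_env h.exp_moments t)
    (Eventually.of_forall fun x => (env_pos t x).le)).symm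

theorem Regime.lintegral_cov (h : Regime ν Q γ₀ C P Z fold) (N : ℕ) {φ : Cov p → ℝ≥0∞}
    (hφ : Measurable φ) : ∫⁻ z, φ z.2.2 ∂(Q N) = ∫⁻ x, φ x ∂ν.snd := by
  rw [Measure.snd, lintegral_map hφ measurable_snd]
  exact (h.model N).lintegral_snd (φ := fun w => φ w.2) (by fun_prop)

theorem Regime.integral_cov (h : Regime ν Q γ₀ C P Z fold) (N : ℕ) {φ : Cov p → ℝ}
    (hφ : Measurable φ) : ∫ z, φ z.2.2 ∂(Q N) = ∫ x, φ x ∂ν.snd := by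
  rw [Measure.snd, integral_map measurable_snd.aemeasurable hφ.aestronglyMeasurable]
  exact (h.model N).integral_snd (φ := fun w => φ w.2) (by fun_prop)

theorem Regime.integrable_cov (h : Regime ν Q γ₀ C P Z fold) (N : ℕ) {φ : Cov p → ℝ}
    (hφ : Integrable φ ν.snd) : Integrable (fun z : Pt p => φ z.2.2) (Q N) := by
  have h1 : (Q N).map (fun z : Pt p => z.2.2) = ν.snd := by
    rw [Measure.snd, ← (h.model N).marginal, Measure.map_map measurable_snd measurable_snd]
    rfl
  rw [← h1] at hφ
  exact hφ.comp_measurable (by fun_prop)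

theorem Regime.ae_abs_le_one (h : Regime ν Q γ₀ C P Z fold) (N : ℕ) :
    ∀ᵐ z ∂(Q N), ‖z.1‖ ≤ 1 := by
  filter_upwards [(h.model N).binary] with z hz
  rcases hz with hz | hz <;> simp [hz]

theorem Regime.integral_label_cov (h : Regime ν Q γ₀ C P Z fold) (N : ℕ) {φ : Cov p → ℝ}
    (hφ : Measurable φ) :
    ∫ z, z.1 * φ z.2.2 ∂(Q N) = ∫ x, truePS (Q N) (γ₀ N) x * φ x ∂ν.snd := by
  rw [Measure.snd, integral_map measurable_snd.aemeasurable
    (Measurable.aestronglyMeasurable (by fun_prop))]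
  exact (h.model N).integral_label (φ := fun w => φ w.2) (by fun_prop)

/-- The residual `R - π(X)` is uncorrelated with functions of `X`. -/
theorem Regime.integral_residual (h : Regime ν Q γ₀ C P Z fold) (N : ℕ) {φ : Cov p → ℝ}
    (hφ : Measurable φ) (hint : Integrable φ ν.snd) :
    ∫ z, (z.1 - truePS (Q N) (γ₀ N) z.2.2) * φ z.2.2 ∂(Q N) = 0 := by
  have h1 : Integrable (fun z : Pt p => z.1 * φ z.2.2) (Q N) :=
    (h.integrable_cov N hint).bdd_mul measurable_fst.aestronglyMeasurable (h.ae_abs_le_one N)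
  have h2 : Integrable (fun z : Pt p => truePS (Q N) (γ₀ N) z.2.2 * φ z.2.2) (Q N) :=
    (h.integrable_cov N hint).bdd_mul (c := 1) (Measurable.aestronglyMeasurable (by fun_prop))
      (Eventually.of_forall fun z => by
        rw [Real.norm_of_nonneg (truePS_nonneg _)]; exact truePS_le_one _)
  simp only [sub_mul]
  rw [integral_sub h1 h2, h.integral_label_cov N hφ,
    h.integral_cov N (φ := fun x => truePS (Q N) (γ₀ N) x * φ x) (by fun_prop), sub_self]

theorem Regime.integral_label_one (h : Regime ν Q γ₀ C P Z fold) (N : ℕ) :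
    ∫ z, z.1 ∂(Q N) = labelProb (Q N) := by
  have h1 := integral_congr_ae ((h.model N).ae_eq_indicator fun _ => 1)
  simp only [mul_one] at h1
  rw [h1, integral_indicator (show MeasurableSet {z : Pt p | z.1 = 1} from
    measurable_fst (measurableSet_singleton 1))]
  simp [labelProb]

theorem truePS_le_env (h : Regime ν Q γ₀ C P Z fold) {N : ℕ} (hN : 0 < labelProb (Q N))
    (x : Cov p) : truePS (Q N) (γ₀ N) x ≤ labelProb (Q N) * env C x :=
  offsetPS_le_env hN (h.norm_le N) x

/-- A second moment bound for functions dominated by `(R / π_N + 1)` times the envelope. -/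
theorem Regime.lintegral_sq_le (h : Regime ν Q γ₀ C P Z fold) {N : ℕ}
    (hN : 0 < labelProb (Q N)) {t : ℝ} {F : Pt p → ℝ}
    (hF : ∀ z, |F z| ≤ (labelProb (Q N))⁻¹ * |z.1| * env t z.2.2 + env t z.2.2) :
    ∫⁻ z, ‖F z‖ₑ ^ 2 ∂(Q N) ≤
      ENNReal.ofReal (4 * (∫ x, env (2 * t + C) x ∂ν.snd) / labelProb (Q N)) := by
  set a := labelProb (Q N)
  have ha1 : a ≤ 1 := labelProb_le_one
  have hb : ∀ᵐ z ∂(Q N), ‖F z‖ₑ ^ 2 ≤ ‖z.1‖ₑ * ENNReal.ofReal (2 * a⁻¹ ^ 2 * env (2 * t) z.2.2) +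
      ENNReal.ofReal (2 * env (2 * t) z.2.2) := by
    filter_upwards [(h.model N).binary] with z hz
    have h1 : F z ^ 2 ≤ |z.1| * (2 * a⁻¹ ^ 2 * env (2 * t) z.2.2) + 2 * env (2 * t) z.2.2 := by
      have h2 : F z ^ 2 ≤ (a⁻¹ * |z.1| * env t z.2.2 + env t z.2.2) ^ 2 := by
        rw [← sq_abs]
        gcongr
        exact hF z
      have h3 : env (2 * t) z.2.2 = env t z.2.2 ^ 2 := by rw [env_pow]; norm_num
      have h4 : |z.1| ^ 2 = |z.1| := by rcases hz with hz | hz <;> simp [hz]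
      rw [h3]
      refine h2.trans ((add_sq_le (a := a⁻¹ * |z.1| * env t z.2.2)).trans (le_of_eq ?_))
      rw [mul_pow, mul_pow, h4]
      ring
    have h5 := env_pos (2 * t) z.2.2
    rw [← enorm_pow, Real.enorm_of_nonneg (by positivity), Real.enorm_eq_ofReal_abs,
      ← ENNReal.ofReal_mul (by positivity), ← ENNReal.ofReal_add (by positivity) (by positivity)]
    exact ENNReal.ofReal_le_ofReal h1
  have hC := h.const_pos
  calc _ ≤ ∫⁻ z, (‖z.1‖ₑ * ENNReal.ofReal (2 * a⁻¹ ^ 2 * env (2 * t) z.2.2) +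
      ENNReal.ofReal (2 * env (2 * t) z.2.2)) ∂(Q N) := lintegral_mono_ae hb
    _ = ∫⁻ x, ENNReal.ofReal (truePS (Q N) (γ₀ N) x) *
          ENNReal.ofReal (2 * a⁻¹ ^ 2 * env (2 * t) x) ∂ν.snd +
        ∫⁻ x, ENNReal.ofReal (2 * env (2 * t) x) ∂ν.snd := by
        rw [lintegral_add_right _ (by fun_prop)]
        congr 1
        · rw [Measure.snd, lintegral_map (by fun_prop) measurable_snd]
          exact (h.model N).lintegral_label
            (φ := fun w => ENNReal.ofReal (2 * a⁻¹ ^ 2 * env (2 * t) w.2)) (by fun_prop)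
        · exact h.lintegral_cov N (φ := fun x => ENNReal.ofReal (2 * env (2 * t) x)) (by fun_prop)
    _ ≤ ∫⁻ x, ENNReal.ofReal (2 * a⁻¹) * ENNReal.ofReal (env (2 * t + C) x) ∂ν.snd +
        ∫⁻ x, ENNReal.ofReal (2 * a⁻¹) * ENNReal.ofReal (env (2 * t + C) x) ∂ν.snd := by
        have h6 : 1 ≤ a⁻¹ := (one_le_inv₀ hN).2 ha1
        refine add_le_add (lintegral_mono fun x => ?_) (lintegral_mono fun x => ?_)
        · have := env_pos (2 * t) x
          rw [← ENNReal.ofReal_mul (truePS_nonneg _), ← ENNReal.ofReal_mul (by positivity)]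
          refine ENNReal.ofReal_le_ofReal ?_
          -- The square of R/π_N contributes a⁻², but R integrates to π(x), of order a; this leaves
          -- a single a⁻¹ and hence the rate (N π_N)^(-1/2).
          calc _ ≤ (a * env C x) * (2 * a⁻¹ ^ 2 * env (2 * t) x) := by
                gcongr
                exact truePS_le_env h hN x
            _ = 2 * a⁻¹ * (env (2 * t) x * env C x) := by
                field_simp
            _ = _ := by rw [env_mul]
        · rw [← ENNReal.ofReal_mul (by positivity)]
          refine ENNReal.ofReal_le_ofReal ?_
          have h7 : env (2 * t) x ≤ env (2 * t + C) x := env_mono (by linarith) x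
          have h8 := env_pos (2 * t + C) x
          nlinarith
    _ = _ := by
        rw [lintegral_const_mul _ (by fun_prop), lintegral_env h,
          ← ENNReal.ofReal_mul (by positivity), ← ENNReal.ofReal_add (by
            have := integral_env_pos h (2 * t + C)
            positivity) (by
            have := integral_env_pos h (2 * t + C)
            positivity)]
        congr 1
        ring

/-! #### Averages over the training samples -/

/-- With K ≥ 2 the held-out share is close to 1/K ≤ 1/2, so it is at most 3/4 with high probability.
Dividing by the size of the training sample then costs at most a factor 4 against dividing by N. -/
theorem Regime.train_card (h : Regime ν Q γ₀ C P Z fold) (o : Option (Fin K)) :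
    IsNegl P (fun N => {ω | ¬ (0 < (N : ℝ) ∧
      (N : ℝ) / 4 ≤ ((trainSet (fold N ω) o).card : ℝ))}) := by
  cases o with
  | none =>
    refine IsNegl.empty.mono' ?_
    filter_upwards [eventually_gt_atTop 0] with N hN ω hω
    have hN' : (0 : ℝ) < N := by exact_mod_cast hN
    refine hω ⟨hN', ?_⟩
    simp [trainSet]
    linarith
  | some k =>
    refine ((h.folds k).isNegl (δ := 1 / 4) (by norm_num)).mono' ?_
    filter_upwards [eventually_gt_atTop 0] with N hN ω hω
    have hN' : (0 : ℝ) < N := by exact_mod_cast hN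
    rw [Set.mem_ofPred_eq, ofReal_lt_enorm_iff (by norm_num)]
    by_contra hcon
    refine hω ⟨hN', ?_⟩
    rw [not_lt, Real.norm_eq_abs] at hcon
    have h1 := (abs_le.1 hcon).2
    have h2 : (Finset.univ.filter fun i => fold N ω i = k).card +
        (trainSet (fold N ω) (some k)).card = N := by
      have := Finset.card_filter_add_card_filter_not (s := (Finset.univ : Finset (Fin N)))
        (fun i => fold N ω i = k)
      simpa [trainSet] using this
    have h3 : ((Finset.univ.filter fun i => fold N ω i = k).card : ℝ) +
        ((trainSet (fold N ω) (some k)).card : ℝ) = N := by exact_mod_cast h2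
    have hK : (2 : ℝ) ≤ K := by exact_mod_cast h.two_le
    have h4 : (1 : ℝ) / K ≤ 1 / 2 := one_div_le_one_div_of_le (by norm_num) hK
    have h5 : ((Finset.univ.filter fun i => fold N ω i = k).card : ℝ) / N ≤ 3 / 4 := by linarith
    rw [div_le_iff₀ hN'] at h5
    linarith

theorem Regime.train_average (h : Regime ν Q γ₀ C P Z fold) (o : Option (Fin K))
    {F : ∀ _ : ℕ, Pt p → ℝ} (hF : ∀ N, Measurable (F N)) {c : ℝ}
    (hc : ∀ᶠ N in atTop, ∫⁻ z, ‖F N z‖ₑ ^ 2 ∂(Q N) ≤ ENNReal.ofReal (c / labelProb (Q N))) :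
    IsBigOp P (fun N ω => ((trainSet (fold N ω) o).card : ℝ)⁻¹ *
      ∑ i ∈ trainSet (fold N ω) o, F N (Z N i ω) - ∫ z, F N z ∂(Q N)) (rate Q) := by
  have h1 := (isBigOp_average h.sample h.labelProb_pos hF hc (fun N f => trainSet f o)).const_mul 4
    eventually_rate_nonneg
  refine h1.of_norm_le (h.train_card o) (Eventually.of_forall fun N ω hω => ?_)
  simp only [Set.mem_ofPred_eq, not_not] at hω
  obtain ⟨hN, hT⟩ := hω
  set T := trainSet (fold N ω) o
  have hT0 : (0 : ℝ) < T.card := by linarith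
  have e : (T.card : ℝ)⁻¹ * ∑ i ∈ T, F N (Z N i ω) - ∫ z, F N z ∂(Q N) =
      (N / T.card : ℝ) * ((N : ℝ)⁻¹ * ∑ i ∈ T, (F N (Z N i ω) - ∫ z, F N z ∂(Q N))) := by
    rw [Finset.sum_sub_distrib, Finset.sum_const, nsmul_eq_mul]
    field_simp
  rw [e, norm_mul, norm_mul (4 : ℝ)]
  gcongr
  rw [Real.norm_of_nonneg (by positivity), Real.norm_of_nonneg (by norm_num),
    div_le_iff₀ hT0]
  linarith

theorem Regime.train_average_abs (h : Regime ν Q γ₀ C P Z fold) (o : Option (Fin K))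
    {F : ∀ _ : ℕ, Pt p → ℝ} (hF : ∀ N, Measurable (F N)) {c : ℝ}
    (hc : ∀ᶠ N in atTop, ∫⁻ z, ‖F N z‖ₑ ∂(Q N) ≤ ENNReal.ofReal c) :
    IsBigOp P (fun N ω => ((trainSet (fold N ω) o).card : ℝ)⁻¹ *
      ∑ i ∈ trainSet (fold N ω) o, |F N (Z N i ω)|) (fun _ => 1) := by
  have h1 := (isBigOp_average_abs h.sample hF hc (fun N f => trainSet f o)).const_mul 4
    (by simp)
  refine h1.of_norm_le (h.train_card o) (Eventually.of_forall fun N ω hω => ?_)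
  simp only [Set.mem_ofPred_eq, not_not] at hω
  obtain ⟨hN, hT⟩ := hω
  set T := trainSet (fold N ω) o
  have hT0 : (0 : ℝ) < T.card := by linarith
  have e : (T.card : ℝ)⁻¹ * ∑ i ∈ T, |F N (Z N i ω)| =
      (N / T.card : ℝ) * ((N : ℝ)⁻¹ * ∑ i ∈ T, |F N (Z N i ω)|) := by
    field_simp
  rw [e, norm_mul, norm_mul (4 : ℝ)]
  gcongr
  rw [Real.norm_of_nonneg (by positivity), Real.norm_of_nonneg (by norm_num),
    div_le_iff₀ hT0]
  linarith

end Regime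

/-! ### The offset logistic MLE -/

section MLE

variable {p K : ℕ}

/-- The true parameter with the offset absorbed in the intercept. -/
def shifted (a : ℝ) (γ : Par p) : Par p := γ + Real.log a • EuclideanSpace.single 0 (1 : ℝ)

theorem inner_aug_shifted (a : ℝ) (γ : Par p) (x : Cov p) :
    inner ℝ (aug x) (shifted a γ) = inner ℝ (aug x) γ + Real.log a := by
  rw [shifted, inner_add_right, inner_aug_single]

theorem offsetPS_eq_shifted {a : ℝ} (ha : 0 < a) (γ : Par p) (x : Cov p) :
    offsetPS a γ x = logistic (inner ℝ (aug x) (shifted a γ)) := by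
  rw [offsetPS_eq_logistic ha, inner_aug_shifted]

theorem negLogLik_eq {N : ℕ} (T : Finset (Fin N)) (z : Fin N → Pt p) {a : ℝ} (ha : 0 < a)
    (γ : Par p) :
    negLogLik T z a γ = logisticRisk T (fun i => aug (z i).2.2) (fun i => (z i).1) (shifted a γ)
      + Real.log a * labelFrac T z := by
  simp only [negLogLik, logisticRisk, labelFrac, inner_aug_shifted, Real.exp_add, Real.exp_log ha]
  rw [← mul_neg, ← Finset.sum_neg_distrib, mul_left_comm (Real.log a), ← mul_add]
  congr 1
  rw [Finset.mul_sum, ← Finset.sum_add_distrib]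
  refine Finset.sum_congr rfl fun i _ => ?_
  rw [mul_comm a]
  ring

/-- For a > 0 the map γ ↦ `shifted a γ` is a bijection, and the two objectives differ by a term free
of γ. The estimated offset is thus a mere reparametrization, and the fit is compared with the truth
in shifted coordinates. -/
theorem isMinOn_negLogLik_iff {N : ℕ} (T : Finset (Fin N)) (z : Fin N → Pt p) {a : ℝ}
    (ha : 0 < a) (γ : Par p) :
    IsMinOn (negLogLik T z a) Set.univ γ ↔
      IsMinOn (logisticRisk T (fun i => aug (z i).2.2) (fun i => (z i).1)) Set.univ
        (shifted a γ) := by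
  simp only [isMinOn_univ_iff, negLogLik_eq T z ha, add_le_add_iff_right]
  constructor
  · intro h β
    have := h (β - Real.log a • EuclideanSpace.single 0 (1 : ℝ))
    simpa [shifted] using this
  · intro h γ'
    exact h _

variable {ν : Measure (ℝ × Cov p)} [IsProbabilityMeasure ν] {Q : ℕ → Measure (Pt p)}
  [∀ N, IsProbabilityMeasure (Q N)] {γ₀ : ℕ → Par p} {C : ℝ} {Ω : ℕ → Type*}
  [∀ N, MeasurableSpace (Ω N)] {P : ∀ N, Measure (Ω N)} [∀ N, IsProbabilityMeasure (P N)]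
  {Z : ∀ N, Fin N → Ω N → Pt p} {fold : ∀ N, Ω N → Fin N → Fin K}

theorem truePS_eq_shifted {N : ℕ} (hN : 0 < labelProb (Q N)) (x : Cov p) :
    truePS (Q N) (γ₀ N) x =
      logistic (inner ℝ (aug x) (shifted (labelProb (Q N)) (γ₀ N))) :=
  offsetPS_eq_shifted hN _ _

/-- The score of the training sample at the truth. -/
def trainScore (Q : ℕ → Measure (Pt p)) (γ₀ : ℕ → Par p) {N : ℕ} (T : Finset (Fin N))
    (z : Fin N → Pt p) : Par p :=
  logisticScore T (fun i => aug (z i).2.2) (fun i => (z i).1) (shifted (labelProb (Q N)) (γ₀ N))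

theorem isBigOp_labelFrac (h : Regime ν Q γ₀ C P Z fold) (o : Option (Fin K)) :
    IsBigOp P (fun N ω => labelFrac (trainSet (fold N ω) o) (obs (Z N) ω) / labelProb (Q N) - 1)
      (rate Q) := by
  -- Here R/π_N is dominated with envelope exponent t = 0, which explains the constant 2 * 0 + C.
  have h1 := h.train_average o (F := fun N z => (labelProb (Q N))⁻¹ * z.1) (by fun_prop)
    (c := 4 * (∫ x, env (2 * 0 + C) x ∂ν.snd)) ?_
  · refine h1.of_norm_le IsNegl.empty ?_
    filter_upwards [h.labelProb_pos] with N hN ω _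
    rw [integral_const_mul, h.integral_label_one, inv_mul_cancel₀ hN.ne', ← Finset.mul_sum]
    refine le_of_eq (congrArg _ ?_)
    rw [labelFrac]
    simp only [obs, observe]
    ring
  · filter_upwards [h.labelProb_pos] with N hN
    refine h.lintegral_sq_le hN fun z => ?_
    simp [env, abs_mul, abs_of_pos hN]

theorem norm_le_sum_abs {n : ℕ} (v : EuclideanSpace ℝ (Fin n)) : ‖v‖ ≤ ∑ j, |v j| := by
  rw [EuclideanSpace.norm_eq]
  refine Real.sqrt_le_iff.2 ⟨Finset.sum_nonneg fun j _ => abs_nonneg _, ?_⟩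
  exact Finset.sum_sq_le_sq_sum_of_nonneg fun j _ => norm_nonneg _

/-- Each coordinate is an average of (R - π(X)) X_j / π_N, which is centred with second moment of
order 1/π_N. The factor 1/π_N matches the inverse of the information matrix. -/
theorem isBigOp_trainScore (h : Regime ν Q γ₀ C P Z fold) (o : Option (Fin K)) :
    IsBigOp P (fun N ω => (labelProb (Q N))⁻¹ *
      ‖trainScore Q γ₀ (trainSet (fold N ω) o) (fun i => Z N i ω)‖) (rate Q) := by
  have hC := h.const_pos
  have h1 : ∀ j : Fin (p + 1), IsBigOp P (fun N ω => (labelProb (Q N))⁻¹ *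
      trainScore Q γ₀ (trainSet (fold N ω) o) (fun i => Z N i ω) j) (rate Q) := by
    intro j
    have h2 := h.train_average o
      (F := fun N z => (z.1 - truePS (Q N) (γ₀ N) z.2.2) * ((labelProb (Q N))⁻¹ * aug z.2.2 j))
      (by fun_prop) (c := 4 * (∫ x, env (2 * (C + 1) + C) x ∂ν.snd)) ?_
    · refine h2.of_norm_le IsNegl.empty ?_
      filter_upwards [h.labelProb_pos] with N hN ω _
      rw [h.integral_residual N (φ := fun x => (labelProb (Q N))⁻¹ * aug x j) (by fun_prop),
        sub_zero]
      · refine le_of_eq (congrArg _ ?_)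
        rw [trainScore, logisticScore]
        simp only [PiLp.smul_apply, smul_eq_mul, WithLp.ofLp_sum, Finset.sum_apply]
        rw [mul_left_comm, Finset.mul_sum]
        congr 1
        refine Finset.sum_congr rfl fun i _ => ?_
        rw [truePS_eq_shifted hN]
        ring
      · refine Integrable.const_mul ?_ _
        exact (integrable_env h.exp_moments 1).mono'
          (measurable_aug_apply j).aestronglyMeasurable
          (Eventually.of_forall fun x => abs_aug_apply_le_env x j)
    · filter_upwards [h.labelProb_pos] with N hN
      refine h.lintegral_sq_le hN fun z => ?_
      set a := labelProb (Q N)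
      have h3 := truePS_le_env h hN z.2.2
      have h4 := truePS_nonneg (Q := Q N) (γ := γ₀ N) z.2.2
      have h5 := env_pos 1 z.2.2
      have h6 := env_mul C 1 z.2.2
      have h8 := env_pos C z.2.2
      have h7 : env 1 z.2.2 ≤ env (C + 1) z.2.2 := env_mono (by linarith) _
      rw [abs_mul, abs_mul, abs_of_pos (inv_pos.2 hN)]
      calc _ ≤ (|z.1| + a * env C z.2.2) * (a⁻¹ * env 1 z.2.2) := by
            gcongr
            · refine (abs_sub _ _).trans ?_
              rw [abs_of_nonneg h4]
              gcongr
            · exact abs_aug_apply_le_env _ _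
        _ = a⁻¹ * |z.1| * env 1 z.2.2 + env C z.2.2 * env 1 z.2.2 := by
            field_simp
        _ ≤ _ := by rw [h6]; gcongr
  have h2 := IsBigOp.sum Finset.univ (fun j => (h1 j).abs) eventually_rate_nonneg
  refine h2.of_norm_le IsNegl.empty ?_
  filter_upwards [h.labelProb_pos] with N hN ω _
  rw [Real.norm_of_nonneg (by positivity), Real.norm_of_nonneg
    (Finset.sum_nonneg fun _ _ => abs_nonneg _)]
  simp only [abs_mul, abs_of_pos (inv_pos.2 hN), ← Finset.mul_sum]
  gcongr
  exact norm_le_sum_abs _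

/-- The entrywise deviation of the empirical Hessian. -/
def hessDev (ν : Measure (ℝ × Cov p)) (Q : ℕ → Measure (Pt p)) (γ₀ : ℕ → Par p) {N : ℕ}
    (T : Finset (Fin N)) (z : Fin N → Pt p) : ℝ :=
  ∑ j, ∑ k, |(T.card : ℝ)⁻¹ * ∑ i ∈ T, aug (z i).2.2 j * aug (z i).2.2 k *
      logisticDeriv (inner ℝ (aug (z i).2.2) (shifted (labelProb (Q N)) (γ₀ N)))
    - infoMatrix ν (γ₀ N) (labelProb (Q N)) j k|

theorem logisticDeriv_le_env (h : Regime ν Q γ₀ C P Z fold) {N : ℕ} (hN : 0 < labelProb (Q N))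
    (x : Cov p) : logisticDeriv (inner ℝ (aug x) (shifted (labelProb (Q N)) (γ₀ N))) ≤
      labelProb (Q N) * env C x := by
  refine (logisticDeriv_le_logistic _).trans ?_
  rw [← truePS_eq_shifted hN]
  exact truePS_le_env h hN x

/-- The summands carry g' ≤ π_N `env C`, so after division by π_N they have bounded second moments,
more than the rate requires. -/
theorem isBigOp_hessDev (h : Regime ν Q γ₀ C P Z fold) (o : Option (Fin K)) :
    IsBigOp P (fun N ω => (labelProb (Q N))⁻¹ *
      hessDev ν Q γ₀ (trainSet (fold N ω) o) (fun i => Z N i ω)) (rate Q) := by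
  have hjk : ∀ j k : Fin (p + 1), IsBigOp P (fun N ω => (labelProb (Q N))⁻¹ *
      (((trainSet (fold N ω) o).card : ℝ)⁻¹ * ∑ i ∈ trainSet (fold N ω) o,
        aug (Z N i ω).2.2 j * aug (Z N i ω).2.2 k *
        logisticDeriv (inner ℝ (aug (Z N i ω).2.2) (shifted (labelProb (Q N)) (γ₀ N)))
        - infoMatrix ν (γ₀ N) (labelProb (Q N)) j k)) (rate Q) := by
    intro j k
    have h2 := h.train_average o
      (F := fun N z => (labelProb (Q N))⁻¹ * (aug z.2.2 j * aug z.2.2 k *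
        logisticDeriv (inner ℝ (aug z.2.2) (shifted (labelProb (Q N)) (γ₀ N)))))
      (fun N => Measurable.const_mul ((Measurable.mul (by fun_prop) (by fun_prop)).mul
        (measurable_logisticDeriv.comp (by fun_prop))) _)
      (c := 4 * (∫ x, env (2 * (C + 2) + C) x ∂ν.snd)) ?_
    · refine h2.of_norm_le IsNegl.empty ?_
      filter_upwards [h.labelProb_pos] with N hN ω _
      rw [integral_const_mul, h.integral_cov N (φ := fun x => aug x j * aug x k *
        logisticDeriv (inner ℝ (aug x) (shifted (labelProb (Q N)) (γ₀ N)))) (by fun_prop)]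
      refine le_of_eq (congrArg _ ?_)
      rw [mul_sub, ← Finset.mul_sum, mul_left_comm]
      simp only [infoMatrix, Matrix.of_apply, inner_aug_shifted]
    · filter_upwards [h.labelProb_pos] with N hN
      refine h.lintegral_sq_le hN fun z => ?_
      set a := labelProb (Q N)
      have h3 := logisticDeriv_le_env h hN z.2.2
      have h4 := logisticDeriv_pos (inner ℝ (aug z.2.2) (shifted (labelProb (Q N)) (γ₀ N)))
      have h5 := env_pos 1 z.2.2
      have h6 := env_pos (C + 2) z.2.2
      rw [abs_mul, abs_mul, abs_mul, abs_of_pos (inv_pos.2 hN), abs_of_pos h4]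
      calc _ ≤ a⁻¹ * (env 1 z.2.2 * env 1 z.2.2 * (a * env C z.2.2)) := by
            gcongr
            · exact abs_aug_apply_le_env _ _
            · exact abs_aug_apply_le_env _ _
        _ = env 1 z.2.2 * env 1 z.2.2 * env C z.2.2 := by field_simp
        _ = env (C + 2) z.2.2 := by rw [env_mul, env_mul]; congr 1; ring
        _ ≤ _ := le_add_of_nonneg_left (by positivity)
  have h2 := IsBigOp.sum Finset.univ (fun j => IsBigOp.sum Finset.univ (fun k => (hjk j k).abs)
    eventually_rate_nonneg) eventually_rate_nonneg
  refine h2.of_norm_le IsNegl.empty ?_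
  filter_upwards [h.labelProb_pos] with N hN ω _
  refine le_of_eq (congrArg _ ?_)
  simp only [abs_mul, abs_of_pos (inv_pos.2 hN), ← Finset.mul_sum]
  rfl

/-- The third-order remainder coefficient of the training sample. -/
def trainThird (Q : ℕ → Measure (Pt p)) (γ₀ : ℕ → Par p) {N : ℕ} (T : Finset (Fin N))
    (z : Fin N → Pt p) : ℝ :=
  logisticThird T (fun i => aug (z i).2.2) (shifted (labelProb (Q N)) (γ₀ N))

theorem Regime.lintegral_abs_le_env (h : Regime ν Q γ₀ C P Z fold) (N : ℕ) {F : Pt p → ℝ}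
    {t : ℝ} (hF : ∀ z, |F z| ≤ env t z.2.2) :
    ∫⁻ z, ‖F z‖ₑ ∂(Q N) ≤ ENNReal.ofReal (∫ x, env t x ∂ν.snd) := by
  rw [← lintegral_env h, ← h.lintegral_cov N (φ := fun x => ENNReal.ofReal (env t x))
    (by fun_prop)]
  refine lintegral_mono fun z => ?_
  rw [Real.enorm_eq_ofReal_abs]
  exact ENNReal.ofReal_le_ofReal (hF z)

/-- The factor g' again cancels 1/π_N. The exponent C + 4 collects `env C` from g', three factors
from the cubed norm and one from its exponential. -/
theorem isBigOp_trainThird (h : Regime ν Q γ₀ C P Z fold) (o : Option (Fin K)) :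
    IsBigOp P (fun N ω => (labelProb (Q N))⁻¹ *
      trainThird Q γ₀ (trainSet (fold N ω) o) (fun i => Z N i ω)) (fun _ => 1) := by
  have h2 := h.train_average_abs o
    (F := fun N z => (labelProb (Q N))⁻¹ *
        (logisticDeriv (inner ℝ (aug z.2.2) (shifted (labelProb (Q N)) (γ₀ N))) *
          (‖aug z.2.2‖ ^ 3 * Real.exp ‖aug z.2.2‖)))
    (fun N => Measurable.const_mul (Measurable.mul
      (measurable_logisticDeriv.comp (by fun_prop)) (by fun_prop)) _)
    (c := ∫ x, env (C + 4) x ∂ν.snd) ?_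
  · refine h2.of_norm_le IsNegl.empty ?_
    filter_upwards [h.labelProb_pos] with N hN ω _
    refine le_of_eq (congrArg _ ?_)
    simp only [trainThird, logisticThird]
    rw [mul_left_comm, Finset.mul_sum]
    congr 1
    refine Finset.sum_congr rfl fun i _ => (abs_of_nonneg ?_).symm
    have := logisticDeriv_pos (inner ℝ (aug (Z N i ω).2.2) (shifted (labelProb (Q N)) (γ₀ N)))
    positivity
  · filter_upwards [h.labelProb_pos] with N hN
    refine h.lintegral_abs_le_env N fun z => ?_
    set a := labelProb (Q N)
    have h3 := logisticDeriv_le_env h hN z.2.2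
    have h4 := logisticDeriv_pos (inner ℝ (aug z.2.2) (shifted (labelProb (Q N)) (γ₀ N)))
    have h5 := env_pos 1 z.2.2
    have h6 := env_pos C z.2.2
    rw [abs_of_nonneg (by positivity)]
    calc _ ≤ a⁻¹ * ((a * env C z.2.2) * (env 1 z.2.2 ^ 3 * env 1 z.2.2)) := by
          gcongr
          · exact norm_aug_le_env _
          · exact exp_norm_aug_le_env _
      _ = env C z.2.2 * (env 1 z.2.2 ^ 3 * env 1 z.2.2) := by field_simp
      _ = _ := by rw [env_pow, env_mul, env_mul]; congr 1; norm_num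

theorem abs_hess_sub_le {N : ℕ} (T : Finset (Fin N))
    (z : Fin N → Pt p) (v w : Par p) :
    |logisticHess T (fun i => aug (z i).2.2) (shifted (labelProb (Q N)) (γ₀ N)) v w -
      inner ℝ (Matrix.toEuclideanCLM (𝕜 := ℝ) (infoMatrix ν (γ₀ N) (labelProb (Q N))) v) w| ≤
    hessDev ν Q γ₀ T z * ‖v‖ * ‖w‖ := by
  set D := fun x : Cov p => logisticDeriv (inner ℝ (aug x) (shifted (labelProb (Q N)) (γ₀ N)))
    with hD
  set J := infoMatrix ν (γ₀ N) (labelProb (Q N)) with hJ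
  have e : logisticHess T (fun i => aug (z i).2.2) (shifted (labelProb (Q N)) (γ₀ N)) v w -
      inner ℝ (Matrix.toEuclideanCLM (𝕜 := ℝ) J v) w =
      ∑ j, ∑ k, ((T.card : ℝ)⁻¹ * ∑ i ∈ T, aug (z i).2.2 j * aug (z i).2.2 k * D (z i).2.2
        - J j k) * (v k * w j) := by
    have e1 : ∀ i, D (z i).2.2 * (inner ℝ (aug (z i).2.2) v * inner ℝ (aug (z i).2.2) w) =
        ∑ j, ∑ k, aug (z i).2.2 j * aug (z i).2.2 k * D (z i).2.2 * (v k * w j) := by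
      intro i
      generalize D (z i).2.2 = d
      simp only [PiLp.inner_apply, RCLike.inner_apply, conj_trivial]
      rw [mul_comm (∑ i, v i * _), Finset.sum_mul_sum, Finset.mul_sum]
      refine Finset.sum_congr rfl fun j _ => ?_
      rw [Finset.mul_sum]
      exact Finset.sum_congr rfl fun k _ => by ring
    have e2 : inner ℝ (Matrix.toEuclideanCLM (𝕜 := ℝ) J v) w =
        ∑ j, ∑ k, J j k * (v k * w j) := by
      simp only [PiLp.inner_apply, RCLike.inner_apply, conj_trivial,
        Matrix.ofLp_toEuclideanCLM, Matrix.mulVec, dotProduct, Finset.mul_sum]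
      exact Finset.sum_congr rfl fun j _ => Finset.sum_congr rfl fun k _ => by ring
    rw [e2, logisticHess, Finset.sum_congr rfl fun i _ => e1 i, Finset.sum_comm, Finset.mul_sum,
      ← Finset.sum_sub_distrib]
    refine Finset.sum_congr rfl fun j _ => ?_
    rw [Finset.sum_comm, Finset.mul_sum, ← Finset.sum_sub_distrib]
    refine Finset.sum_congr rfl fun k _ => ?_
    rw [← Finset.sum_mul]
    ring
  rw [e, hessDev, mul_assoc, Finset.sum_mul]
  refine (Finset.abs_sum_le_sum_abs _ _).trans (Finset.sum_le_sum fun j _ => ?_)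
  rw [Finset.sum_mul]
  refine (Finset.abs_sum_le_sum_abs _ _).trans (Finset.sum_le_sum fun k _ => ?_)
  rw [abs_mul, abs_mul]
  have h1 : |v k| ≤ ‖v‖ := PiLp.norm_apply_le v k
  have h2 : |w j| ≤ ‖w‖ := PiLp.norm_apply_le w j
  gcongr

end MLE

/-! ### Asymptotic linearity of the MLE -/

section MLEAsymptotics

variable {p K : ℕ} {ν : Measure (ℝ × Cov p)} [IsProbabilityMeasure ν] {Q : ℕ → Measure (Pt p)}
  [∀ N, IsProbabilityMeasure (Q N)] {γ₀ : ℕ → Par p} {C : ℝ} {Ω : ℕ → Type*}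
  [∀ N, MeasurableSpace (Ω N)] {P : ∀ N, Measure (Ω N)} [∀ N, IsProbabilityMeasure (P N)]
  {Z : ∀ N, Fin N → Ω N → Pt p} {fold : ∀ N, Ω N → Fin N → Fin K}

/-- The error of the MLE after the offset is absorbed in the intercept. -/
def mleError (Q : ℕ → Measure (Pt p)) (γ₀ : ℕ → Par p) {N : ℕ}
    (ghat : Finset (Fin N) → (Fin N → Pt p) → Par p) (T : Finset (Fin N)) (z : Fin N → Pt p) :
    Par p :=
  shifted (labelFrac T z) (ghat T z) - shifted (labelProb (Q N)) (γ₀ N)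

/-- The inverse information matrix at the truth, as an operator. -/
def infoInv (ν : Measure (ℝ × Cov p)) (Q : ℕ → Measure (Pt p)) (γ₀ : ℕ → Par p) (N : ℕ) :
    Par p →L[ℝ] Par p :=
  Matrix.toEuclideanCLM (𝕜 := ℝ) (infoMatrix ν (γ₀ N) (labelProb (Q N)))⁻¹

theorem norm_infoInv_le (h : Regime ν Q γ₀ C P Z fold) {N : ℕ} (hN : 0 < labelProb (Q N))
    (w : Par p) : ‖infoInv ν Q γ₀ N w‖ ≤ C * ((labelProb (Q N))⁻¹ * ‖w‖) := by
  have := norm_inv_apply_le_of_coercive (div_pos hN h.const_pos)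
    (infoMatrix_coercive h.exp_moments (h.posDef N) h.const_pos (h.inv_le N) hN
      labelProb_le_one) w
  refine this.trans (le_of_eq ?_)
  rw [inv_div]
  ring

theorem isNegl_labelFrac (h : Regime ν Q γ₀ C P Z fold) (o : Option (Fin K)) :
    IsNegl P (fun N => {ω | ¬ (0 < labelProb (Q N) ∧
      |labelFrac (trainSet (fold N ω) o) (obs (Z N) ω) / labelProb (Q N) - 1| ≤ 1 / 2)}) := by
  have h1 := (isBigOp_labelFrac h o).isLittleOp (s := fun _ => 1) fun η hη => by
    simpa using h.tendsto_rate.eventually_le_const hη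
  refine (h1.isNegl (show (0 : ℝ) < 1 / 2 by norm_num)).mono' ?_
  filter_upwards [h.labelProb_pos] with N hN ω hω
  rw [Set.mem_ofPred_eq, ofReal_lt_enorm_iff (by norm_num)]
  by_contra hcon
  exact hω ⟨hN, by simpa using hcon⟩

theorem tendsto_sqrt_rate (h : Regime ν Q γ₀ C P Z fold) :
    Tendsto (fun N => Real.sqrt (rate Q N)) atTop (𝓝 0) := by
  simpa using h.tendsto_rate.sqrt

/-- With probability tending to one the MLE is well defined and its error is controlled by the
score, the Hessian and the third-order remainder. -/
theorem isNegl_mle (h : Regime ν Q γ₀ C P Z fold)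
    {ghat : ∀ N, Finset (Fin N) → (Fin N → Pt p) → Par p} (hghat : ∀ N, IsOffsetMLE (ghat N))
    (o : Option (Fin K)) :
    IsNegl P (fun N => {ω | ¬ (
      ‖mleError Q γ₀ (ghat N) (trainSet (fold N ω) o) (obs (Z N) ω)‖ ≤ 8 * C *
        ((labelProb (Q N))⁻¹ * ‖trainScore Q γ₀ (trainSet (fold N ω) o) (fun i => Z N i ω)‖) ∧
      ‖mleError Q γ₀ (ghat N) (trainSet (fold N ω) o) (obs (Z N) ω)‖ ≤ 1 ∧
      ‖mleError Q γ₀ (ghat N) (trainSet (fold N ω) o) (obs (Z N) ω) -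
        infoInv ν Q γ₀ N (trainScore Q γ₀ (trainSet (fold N ω) o) (fun i => Z N i ω))‖ ≤
        C * (((labelProb (Q N))⁻¹ *
            hessDev ν Q γ₀ (trainSet (fold N ω) o) (fun i => Z N i ω) +
          (labelProb (Q N))⁻¹ * trainThird Q γ₀ (trainSet (fold N ω) o) (fun i => Z N i ω) *
            ‖mleError Q γ₀ (ghat N) (trainSet (fold N ω) o) (obs (Z N) ω)‖) *
          ‖mleError Q γ₀ (ghat N) (trainSet (fold N ω) o) (obs (Z N) ω)‖))}) := by
  have hC := h.const_pos
  have e1 := (isBigOp_hessDev h o).isLittleOp (s := fun _ => 1) fun η hη => by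
    simpa using h.tendsto_rate.eventually_le_const hη
  -- The square root of the rate serves as the radius of localization: it dominates the normalized
  -- score, of order the rate, yet tends to zero, so its product with the bounded third-order
  -- coefficient is negligible.
  have e2 := (isBigOp_trainThird h o).isLittleOp (s := fun N => (Real.sqrt (rate Q N))⁻¹)
    fun η hη => by
      filter_upwards [(tendsto_sqrt_rate h).eventually_le_const hη, h.rate_pos] with N h1 h2
      rw [← div_eq_mul_inv, le_div_iff₀ (by positivity)]
      simpa using h1
  have e3 := (isBigOp_trainScore h o).isLittleOp (s := fun N => Real.sqrt (rate Q N))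
    fun η hη => by
      filter_upwards [(tendsto_sqrt_rate h).eventually_le_const hη, h.rate_pos] with N h1 h2
      calc rate Q N = Real.sqrt (rate Q N) * Real.sqrt (rate Q N) :=
            (Real.mul_self_sqrt h2.le).symm
        _ ≤ _ := by gcongr
  -- With l = π_N/C, the thresholds 1/(2C) and 1/(8C) are those required of the Hessian deviation
  -- and the third-order term; 1/(16C) is half of what is allowed for the score, to make that
  -- inequality strict.
  refine (((((isNegl_labelFrac h o).union (isNegl_of_ae h.sample fun N => (h.model N).binary)).union
    (e1.isNegl (show 0 < 1 / (2 * C) by positivity))).union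
    (e2.isNegl (show 0 < 1 / (8 * C) by positivity))).union
    (e3.isNegl (show 0 < 1 / (16 * C) by positivity))).mono' ?_
  filter_upwards [h.labelProb_pos, h.rate_pos,
    (tendsto_sqrt_rate h).eventually_le_const one_pos] with N hN hr hr1 ω hω
  by_contra hcon
  simp only [Set.mem_union, not_or] at hcon
  obtain ⟨⟨⟨⟨c1, c2⟩, c3⟩, c4⟩, c5⟩ := hcon
  refine hω ?_
  clear hω
  set a := labelProb (Q N) with ha
  set T := trainSet (fold N ω) o
  set z : Fin N → Pt p := fun i => Z N i ω with hz
  have hsr : 0 < Real.sqrt (rate Q N) := by positivity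
  rw [Set.mem_ofPred_eq, not_not] at c1 c2
  rw [Set.mem_ofPred_eq, ofReal_lt_enorm_iff (by positivity), not_lt, Real.norm_eq_abs,
    abs_le] at c3 c4 c5
  have d3 : hessDev ν Q γ₀ T z ≤ a / C / 2 := by
    have := c3.2
    rw [inv_mul_eq_div, div_le_iff₀ hN] at this
    refine this.trans (le_of_eq ?_)
    field_simp
  have d4 : trainThird Q γ₀ T z * Real.sqrt (rate Q N) ≤ a / C / 8 := by
    have := c4.2
    rw [inv_mul_eq_div, div_le_iff₀ hN] at this
    refine (mul_le_mul_of_nonneg_right this hsr.le).trans (le_of_eq ?_)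
    field_simp
  have d5 : ‖trainScore Q γ₀ T z‖ < a / C * Real.sqrt (rate Q N) / 8 := by
    have := c5.2
    rw [inv_mul_eq_div, div_le_iff₀ hN] at this
    refine this.trans_lt ?_
    have e : a / C * Real.sqrt (rate Q N) / 8 = 2 * (1 / (16 * C) * Real.sqrt (rate Q N) * a) := by
      field_simp
      ring
    rw [e]
    have : 0 < 1 / (16 * C) * Real.sqrt (rate Q N) * a := by positivity
    linarith
  have he0 : 0 ≤ hessDev ν Q γ₀ T z :=
    Finset.sum_nonneg fun _ _ => Finset.sum_nonneg fun _ _ => abs_nonneg _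
  have hco := infoMatrix_coercive h.exp_moments (h.posDef N) hC (h.inv_le N) hN labelProb_le_one
  obtain ⟨m1, m2⟩ := logisticRisk_minimizers (T := T) (x := fun i => aug (z i).2.2)
    (r := fun i => (z i).1) (β₀ := shifted a (γ₀ N))
    (J := Matrix.toEuclideanCLM (𝕜 := ℝ) (infoMatrix ν (γ₀ N) a)) (l := a / C)
    (e := hessDev ν Q γ₀ T z) (ρ := Real.sqrt (rate Q N)) (div_pos hN hC) he0 hsr hr1
    hco (abs_hess_sub_le T z) d3 d4 d5
  have hfrac : 0 < labelFrac T (obs (Z N) ω) := by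
    have h1 := (abs_le.1 c1.2).1
    have h2 : 1 / 2 ≤ labelFrac T (obs (Z N) ω) / a := by linarith
    rw [le_div_iff₀ hN] at h2
    linarith
  -- The estimator is only known to minimize when a minimizer exists; existence comes from the
  -- convexity argument, after translating the intercept back.
  have hmin : IsMinOn (logisticRisk T (fun i => aug (z i).2.2) (fun i => (z i).1)) Set.univ
      (shifted (labelFrac T (obs (Z N) ω)) (ghat N T (obs (Z N) ω))) := by
    have h1 := ((hghat N) T).2.2 (obs (Z N) ω) (fun i _ => c2 i) ?_
    · exact (isMinOn_negLogLik_iff T (obs (Z N) ω) hfrac _).1 h1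
    · obtain ⟨β, hβ⟩ := m1
      refine ⟨β - Real.log (labelFrac T (obs (Z N) ω)) • EuclideanSpace.single 0 (1 : ℝ), ?_⟩
      rw [isMinOn_negLogLik_iff T (obs (Z N) ω) hfrac]
      rw [shifted, sub_add_cancel]
      exact hβ
  obtain ⟨r1, r2, r3⟩ := m2 _ hmin
  refine ⟨r1.trans (le_of_eq ?_), r2, ?_⟩
  · rw [trainScore]
    field_simp
    rfl
  · set δ := mleError Q γ₀ (ghat N) T (obs (Z N) ω) with hδ
    -- Coercivity applied to δ - J⁻¹S turns the bound on Jδ - S into one on δ - J⁻¹S, at the cost of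
    -- a factor C/a.
    have h1 : Matrix.toEuclideanCLM (𝕜 := ℝ) (infoMatrix ν (γ₀ N) a)
        (δ - infoInv ν Q γ₀ N (trainScore Q γ₀ T z)) =
        Matrix.toEuclideanCLM (𝕜 := ℝ) (infoMatrix ν (γ₀ N) a) δ - trainScore Q γ₀ T z := by
      rw [map_sub, infoInv, toEuclideanCLM_mul_inv (isUnit_of_coercive (div_pos hN hC) hco)]
    have h2 := hco (δ - infoInv ν Q γ₀ N (trainScore Q γ₀ T z))
    rw [h1] at h2
    have h3 := real_inner_le_norm (Matrix.toEuclideanCLM (𝕜 := ℝ) (infoMatrix ν (γ₀ N) a) δ -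
      trainScore Q γ₀ T z) (δ - infoInv ν Q γ₀ N (trainScore Q γ₀ T z))
    rw [norm_sub_rev] at h3
    set y := ‖δ - infoInv ν Q γ₀ N (trainScore Q γ₀ T z)‖ with hy
    have h4 : a / C * y ≤ (hessDev ν Q γ₀ T z + trainThird Q γ₀ T z * ‖δ‖) * ‖δ‖ := by
      refine le_trans ?_ r3
      rcases eq_or_lt_of_le (show 0 ≤ y from norm_nonneg _) with h0 | h0
      · rw [← h0, mul_zero]; exact norm_nonneg _
      · have h5 : a / C * y * y ≤ ‖trainScore Q γ₀ T z -
            Matrix.toEuclideanCLM (𝕜 := ℝ) (infoMatrix ν (γ₀ N) a) δ‖ * y := by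
          calc _ = a / C * y ^ 2 := by ring
            _ ≤ _ := h2.trans h3
        exact le_of_mul_le_mul_right h5 h0
    rw [div_mul_eq_mul_div, div_le_iff₀ hC] at h4
    calc y = a⁻¹ * (a * y) := by field_simp
      _ ≤ a⁻¹ * ((hessDev ν Q γ₀ T z + trainThird Q γ₀ T z * ‖δ‖) * ‖δ‖ * C) := by gcongr
      _ = _ := by ring

/-- The error of the MLE is of the order of the rate. -/
theorem isBigOp_mleError (h : Regime ν Q γ₀ C P Z fold)
    {ghat : ∀ N, Finset (Fin N) → (Fin N → Pt p) → Par p} (hghat : ∀ N, IsOffsetMLE (ghat N))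
    (o : Option (Fin K)) :
    IsBigOp P (fun N ω => mleError Q γ₀ (ghat N) (trainSet (fold N ω) o) (obs (Z N) ω))
      (rate Q) := by
  refine ((isBigOp_trainScore h o).const_mul (8 * C) eventually_rate_nonneg).of_norm_le
    (isNegl_mle h hghat o) (Eventually.of_forall fun N ω hω => ?_)
  rw [Set.mem_ofPred_eq, not_not] at hω
  exact hω.1.trans (le_abs_self _)

theorem isNegl_mleError (h : Regime ν Q γ₀ C P Z fold)
    {ghat : ∀ N, Finset (Fin N) → (Fin N → Pt p) → Par p} (hghat : ∀ N, IsOffsetMLE (ghat N))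
    (o : Option (Fin K)) :
    IsNegl P (fun N => {ω | ¬
      ‖mleError Q γ₀ (ghat N) (trainSet (fold N ω) o) (obs (Z N) ω)‖ ≤ 1}) :=
  (isNegl_mle h hghat o).mono' (Eventually.of_forall fun _ _ hω hω' => hω hω'.2.1)

theorem rate_mul_rate_isLittle (h : Regime ν Q γ₀ C P Z fold) (η : ℝ) (hη : 0 < η) :
    ∀ᶠ N in atTop, rate Q N * rate Q N ≤ η * rate Q N := by
  filter_upwards [h.tendsto_rate.eventually_le_const hη] with N hN
  exact mul_le_mul_of_nonneg_right hN (rate_nonneg N)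

/-- The error of the MLE is asymptotically linear in the score. -/
theorem isLittleOp_mleError_sub (h : Regime ν Q γ₀ C P Z fold)
    {ghat : ∀ N, Finset (Fin N) → (Fin N → Pt p) → Par p} (hghat : ∀ N, IsOffsetMLE (ghat N))
    (o : Option (Fin K)) :
    IsLittleOp P (fun N ω =>
      mleError Q γ₀ (ghat N) (trainSet (fold N ω) o) (obs (Z N) ω) -
        infoInv ν Q γ₀ N (trainScore Q γ₀ (trainSet (fold N ω) o) (fun i => Z N i ω)))
      (rate Q) := by
  have hd := (isBigOp_mleError h hghat o).norm
  have h1 : ∀ᶠ N : ℕ in atTop, (0 : ℝ) ≤ 1 := by simp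
  have h2 : ∀ᶠ N in atTop, (0 : ℝ) ≤ rate Q N * rate Q N :=
    Eventually.of_forall fun N => mul_self_nonneg _
  have hs : IsBigOp P (fun N ω => (labelProb (Q N))⁻¹ *
      hessDev ν Q γ₀ (trainSet (fold N ω) o) (fun i => Z N i ω) +
        (labelProb (Q N))⁻¹ * trainThird Q γ₀ (trainSet (fold N ω) o) (fun i => Z N i ω) *
        ‖mleError Q γ₀ (ghat N) (trainSet (fold N ω) o) (obs (Z N) ω)‖) (rate Q) := by
    have := (isBigOp_trainThird h o).mul hd h1 eventually_rate_nonneg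
    simp only [one_mul] at this
    exact (isBigOp_hessDev h o).add this eventually_rate_nonneg
  have hp := (hs.mul hd eventually_rate_nonneg eventually_rate_nonneg).const_mul C h2
  refine (hp.isLittleOp (s := rate Q) (rate_mul_rate_isLittle h)).of_norm_le
    (isNegl_mle h hghat o) (Eventually.of_forall fun N ω hω => ?_)
  rw [Set.mem_ofPred_eq, not_not] at hω
  exact hω.2.2.trans (le_abs_self _)

/-- The average of the influence function of the MLE. -/
theorem average_ifGamma {N : ℕ} (hN : 0 < labelProb (Q N)) (T : Finset (Fin N))
    (hT : T.card ≠ 0) (z : Fin N → Pt p) :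
    (T.card : ℝ)⁻¹ • ∑ i ∈ T, ifGamma ν (Q N) (γ₀ N) (z i) =
      infoInv ν Q γ₀ N (trainScore Q γ₀ T z) -
        (labelFrac T (fun i => observe (z i)) / labelProb (Q N) - 1) •
          EuclideanSpace.single 0 (1 : ℝ) := by
  have hT' : (T.card : ℝ) ≠ 0 := by exact_mod_cast hT
  simp only [ifGamma, Finset.sum_sub_distrib, smul_sub, trainScore, logisticScore, map_smul,
    map_sum, infoInv, inner_aug_shifted]
  congr 1
  rw [← Finset.sum_smul, smul_smul]
  congr 1
  simp only [Finset.sum_sub_distrib, ← Finset.mul_sum, labelFrac, observe]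
  simp only [Finset.sum_const, nsmul_eq_mul]
  field_simp

/-- Undoing the shift gives γ̂ - γ₀ = δ - log(π̂/π_N) e₁. The logarithm is replaced by π̂/π_N - 1
with a quadratic error of order rate², and the linear parts add up to the average of `ifGamma`. -/
theorem mle_asymptotics (h : Regime ν Q γ₀ C P Z fold)
    {ghat : ∀ N, Finset (Fin N) → (Fin N → Pt p) → Par p} (hghat : ∀ N, IsOffsetMLE (ghat N))
    (o : Option (Fin K)) :
    IsLittleOp P (fun N ω =>
        ghat N (trainSet (fold N ω) o) (obs (Z N) ω) - γ₀ N
          - ((trainSet (fold N ω) o).card : ℝ)⁻¹ •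
            ∑ i ∈ trainSet (fold N ω) o, ifGamma ν (Q N) (γ₀ N) (Z N i ω)) (rate Q) ∧
    IsBigOp P (fun N ω => ghat N (trainSet (fold N ω) o) (obs (Z N) ω) - γ₀ N) (rate Q) := by
  have hq := isBigOp_labelFrac h o
  have h2 : ∀ᶠ N in atTop, (0 : ℝ) ≤ rate Q N * rate Q N :=
    Eventually.of_forall fun N => mul_self_nonneg _
  have hq2 := ((hq.mul hq eventually_rate_nonneg eventually_rate_nonneg).const_mul 2 h2).isLittleOp
    (s := rate Q) (rate_mul_rate_isLittle h)
  have key : ∀ N ω, 0 < labelProb (Q N) →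
      |labelFrac (trainSet (fold N ω) o) (obs (Z N) ω) / labelProb (Q N) - 1| ≤ 1 / 2 →
      ghat N (trainSet (fold N ω) o) (obs (Z N) ω) - γ₀ N =
        mleError Q γ₀ (ghat N) (trainSet (fold N ω) o) (obs (Z N) ω) -
        Real.log (labelFrac (trainSet (fold N ω) o) (obs (Z N) ω) / labelProb (Q N)) •
          EuclideanSpace.single 0 (1 : ℝ) := by
    intro N ω ha hf
    have hf0 : labelFrac (trainSet (fold N ω) o) (obs (Z N) ω) ≠ 0 := by
      intro h0
      rw [h0] at hf
      norm_num at hf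
    rw [Real.log_div hf0 ha.ne', mleError, shifted, shifted]
    module
  constructor
  · have hsum := ((isLittleOp_mleError_sub h hghat o).norm).add hq2.norm eventually_rate_nonneg
    refine hsum.of_norm_le ((isNegl_labelFrac h o).union (h.train_card o))
      (Eventually.of_forall fun N ω hω => ?_)
    simp only [Set.mem_union, Set.mem_ofPred_eq, not_or, not_not] at hω
    obtain ⟨⟨ha, hf⟩, hN, hT⟩ := hω
    have hT0 : (trainSet (fold N ω) o).card ≠ 0 := by
      intro h0
      rw [h0] at hT
      norm_num at hT
      linarith
    rw [key N ω ha hf, average_ifGamma ha _ hT0 (fun i => Z N i ω)]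
    have hl := abs_log_sub_sub_one_le hf
    change ‖mleError Q γ₀ (ghat N) (trainSet (fold N ω) o) (obs (Z N) ω) - _ -
      (_ - (labelFrac (trainSet (fold N ω) o) (obs (Z N) ω) / labelProb (Q N) - 1) • _)‖ ≤ _
    set δ := mleError Q γ₀ (ghat N) (trainSet (fold N ω) o) (obs (Z N) ω)
    set q := labelFrac (trainSet (fold N ω) o) (obs (Z N) ω) / labelProb (Q N)
    set s := infoInv ν Q γ₀ N (trainScore Q γ₀ (trainSet (fold N ω) o) fun i => Z N i ω)
    have e : δ - Real.log q • EuclideanSpace.single (0 : Fin (p + 1)) (1 : ℝ) -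
        (s - (q - 1) • EuclideanSpace.single 0 (1 : ℝ)) =
        (δ - s) - (Real.log q - (q - 1)) • EuclideanSpace.single 0 (1 : ℝ) := by module
    rw [e]
    refine (norm_sub_le _ _).trans ?_
    rw [norm_smul, PiLp.norm_single, norm_one, mul_one]
    refine le_trans ?_ (le_abs_self _)
    gcongr
    refine le_trans hl (le_trans (le_of_eq ?_) (le_abs_self _))
    ring
  · have hsum := ((isBigOp_mleError h hghat o).norm).add
      ((hq.abs).add (hq2.isBigOp.abs) eventually_rate_nonneg) eventually_rate_nonneg
    refine hsum.of_norm_le (isNegl_labelFrac h o) (Eventually.of_forall fun N ω hω => ?_)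
    simp only [Set.mem_ofPred_eq, not_not] at hω
    obtain ⟨ha, hf⟩ := hω
    rw [key N ω ha hf]
    have hl := abs_log_sub_sub_one_le hf
    set δ := mleError Q γ₀ (ghat N) (trainSet (fold N ω) o) (obs (Z N) ω)
    set q := labelFrac (trainSet (fold N ω) o) (obs (Z N) ω) / labelProb (Q N)
    refine (norm_sub_le _ _).trans ?_
    rw [norm_smul, PiLp.norm_single, norm_one, mul_one]
    refine le_trans ?_ (le_abs_self _)
    gcongr
    have h5 : |Real.log q| ≤ |q - 1| + |Real.log q - (q - 1)| := by
      have := abs_add_le (q - 1) (Real.log q - (q - 1))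
      rwa [add_sub_cancel] at this
    refine h5.trans (add_le_add le_rfl ?_)
    refine le_trans hl (le_trans (le_of_eq ?_) (le_abs_self _))
    ring

end MLEAsymptotics

/-! ### Rates for the propensity score and weighted norms -/

section PropensityRates

variable {p K : ℕ} {ν : Measure (ℝ × Cov p)} [IsProbabilityMeasure ν] {Q : ℕ → Measure (Pt p)}
  [∀ N, IsProbabilityMeasure (Q N)] {γ₀ : ℕ → Par p} {C : ℝ} {Ω : ℕ → Type*}
  [∀ N, MeasurableSpace (Ω N)] {P : ∀ N, Measure (Ω N)} [∀ N, IsProbabilityMeasure (P N)]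
  {Z : ∀ N, Fin N → Ω N → Pt p} {fold : ∀ N, Ω N → Fin N → Fin K}

theorem memLp_env (h : Regime ν Q γ₀ C P Z fold) (t : ℝ) {r : ℝ} (hr : 0 < r) :
    MemLp (env t : Cov p → ℝ) (ENNReal.ofReal r) ν.snd := by
  refine ⟨(measurable_env t).aestronglyMeasurable, ?_⟩
  rw [eLpNorm_lt_top_iff_lintegral_rpow_enorm_lt_top (by simpa using hr) (by simp),
    ENNReal.toReal_ofReal hr.le]
  have : ∀ x : Cov p, ‖env t x‖ₑ ^ r = ENNReal.ofReal (env (r * t) x) := by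
    intro x
    rw [Real.enorm_of_nonneg (env_pos t x).le, ENNReal.ofReal_rpow_of_pos (env_pos t x), env,
      ← Real.exp_mul, env]
    congr 2
    ring
  simp only [this, lintegral_env h]
  simp

theorem eLpNorm_env_pos (h : Regime ν Q γ₀ C P Z fold) (t : ℝ) {r : ℝ} (hr : 0 < r) :
    0 < (eLpNorm (env t : Cov p → ℝ) (ENNReal.ofReal r) ν.snd).toReal := by
  refine ENNReal.toReal_pos ?_ (memLp_env h t hr).2.ne
  rw [Ne, eLpNorm_eq_zero_iff (measurable_env t).aestronglyMeasurable (by simpa using hr)]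
  intro h0
  obtain ⟨x, hx⟩ := h0.exists
  exact (env_pos t x).ne' hx

theorem inv_truePS_le_env (h : Regime ν Q γ₀ C P Z fold) {N : ℕ} (hN : 0 < labelProb (Q N))
    (x : Cov p) : (truePS (Q N) (γ₀ N) x)⁻¹ ≤ (labelProb (Q N))⁻¹ * env (C + 1) x :=
  inv_offsetPS_le_env hN labelProb_le_one (h.norm_le N) x

theorem env_lt_inv_truePS (h : Regime ν Q γ₀ C P Z fold) {N : ℕ} (hN : 0 < labelProb (Q N))
    (x : Cov p) : (labelProb (Q N))⁻¹ * env (-C) x < (truePS (Q N) (γ₀ N) x)⁻¹ :=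
  env_le_inv_offsetPS hN (h.norm_le N) x

/-- Finiteness is needed because `toReal` sends an infinite norm to zero and is monotone only below
a finite bound. -/
theorem memLp_inv_truePS (h : Regime ν Q γ₀ C P Z fold) {N : ℕ} (hN : 0 < labelProb (Q N))
    {r : ℝ} (hr : 0 < r) :
    MemLp (fun x => (truePS (Q N) (γ₀ N) x)⁻¹) (ENNReal.ofReal r) ν.snd := by
  refine ((memLp_env h (C + 1) hr).const_mul (labelProb (Q N))⁻¹).mono
    (Measurable.aestronglyMeasurable (by fun_prop)) (Eventually.of_forall fun x => ?_)
  have := truePS_nonneg (Q := Q N) (γ := γ₀ N) x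
  have := env_pos (C + 1) x
  rw [Real.norm_of_nonneg (by positivity), Real.norm_of_nonneg (by positivity)]
  exact inv_truePS_le_env h hN x

theorem sameOrder_eLpNorm (h : Regime ν Q γ₀ C P Z fold) {r : ℝ} (hr : 0 < r) :
    SameOrder (fun N => (eLpNorm (fun x => (truePS (Q N) (γ₀ N) x)⁻¹)
      (ENNReal.ofReal r) ν.snd).toReal) (fun N => (labelProb (Q N))⁻¹) := by
  have l1 := eLpNorm_env_pos h (-C) hr
  have l2 := eLpNorm_env_pos h (C + 1) hr
  have hscale : ∀ (t b : ℝ), 0 ≤ b → (eLpNorm (fun x : Cov p => b * env t x) (ENNReal.ofReal r)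
      ν.snd).toReal = b * (eLpNorm (env t : Cov p → ℝ) (ENNReal.ofReal r) ν.snd).toReal := by
    intro t b hb
    have := eLpNorm_const_smul b (env t : Cov p → ℝ) (ENNReal.ofReal r) ν.snd
    change eLpNorm (b • env t) _ _ = _ at this
    rw [show (fun x : Cov p => b * env t x) = b • env t from rfl, this, ENNReal.toReal_mul,
      Real.enorm_of_nonneg hb, ENNReal.toReal_ofReal hb]
  -- The factors 1/2 and 2 turn the weak inequalities from the envelopes into the strict ones of
  -- `SameOrder`.
  refine ⟨(eLpNorm (env (-C) : Cov p → ℝ) (ENNReal.ofReal r) ν.snd).toReal / 2,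
    (eLpNorm (env (C + 1) : Cov p → ℝ) (ENNReal.ofReal r) ν.snd).toReal * 2,
    by positivity, by positivity, ?_⟩
  filter_upwards [h.labelProb_pos] with N hN
  have hi : 0 < (labelProb (Q N))⁻¹ := inv_pos.2 hN
  have hnn : ∀ x, 0 ≤ (truePS (Q N) (γ₀ N) x)⁻¹ := fun x => inv_nonneg.2 (truePS_nonneg x)
  constructor
  · have h1 : (labelProb (Q N))⁻¹ *
        (eLpNorm (env (-C) : Cov p → ℝ) (ENNReal.ofReal r) ν.snd).toReal ≤
        (eLpNorm (fun x => (truePS (Q N) (γ₀ N) x)⁻¹) (ENNReal.ofReal r) ν.snd).toReal := by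
      rw [← hscale _ _ hi.le]
      refine ENNReal.toReal_mono (memLp_inv_truePS h hN hr).2.ne (eLpNorm_mono fun x => ?_)
      have := env_pos (-C) x
      rw [Real.norm_of_nonneg (by positivity), Real.norm_of_nonneg (hnn x)]
      exact (env_lt_inv_truePS h hN x).le
    nlinarith
  · have h1 : (eLpNorm (fun x => (truePS (Q N) (γ₀ N) x)⁻¹) (ENNReal.ofReal r) ν.snd).toReal ≤
        (labelProb (Q N))⁻¹ *
        (eLpNorm (env (C + 1) : Cov p → ℝ) (ENNReal.ofReal r) ν.snd).toReal := by
      rw [← hscale _ _ hi.le]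
      refine ENNReal.toReal_mono ((memLp_env h (C + 1) hr).const_mul _).2.ne
        (eLpNorm_mono fun x => ?_)
      have := env_pos (C + 1) x
      rw [Real.norm_of_nonneg (hnn x), Real.norm_of_nonneg (by positivity)]
      exact inv_truePS_le_env h hN x
    nlinarith

theorem integral_inv_truePS_bounds (h : Regime ν Q γ₀ C P Z fold) {N : ℕ}
    (hN : 0 < labelProb (Q N)) :
    (labelProb (Q N))⁻¹ * ∫ x, env (-C) x ∂ν.snd ≤ ∫ x, (truePS (Q N) (γ₀ N) x)⁻¹ ∂ν.snd ∧
    ∫ x, (truePS (Q N) (γ₀ N) x)⁻¹ ∂ν.snd ≤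
      (labelProb (Q N))⁻¹ * ∫ x, env (C + 1) x ∂ν.snd := by
  have hint : Integrable (fun x => (truePS (Q N) (γ₀ N) x)⁻¹) ν.snd := by
    have := memLp_inv_truePS h hN one_pos
    rwa [ENNReal.ofReal_one, memLp_one_iff_integrable] at this
  rw [← integral_const_mul, ← integral_const_mul]
  exact ⟨integral_mono ((integrable_env h.exp_moments _).const_mul _) hint
      fun x => (env_lt_inv_truePS h hN x).le,
    integral_mono hint ((integrable_env h.exp_moments _).const_mul _)
      fun x => inv_truePS_le_env h hN x⟩

theorem invMeanInvPS_bounds (h : Regime ν Q γ₀ C P Z fold) {N : ℕ}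
    (hN : 0 < labelProb (Q N)) :
    labelProb (Q N) * (∫ x, env (C + 1) x ∂ν.snd)⁻¹ ≤ invMeanInvPS ν (Q N) (γ₀ N) ∧
    invMeanInvPS ν (Q N) (γ₀ N) ≤ labelProb (Q N) * (∫ x, env (-C) x ∂ν.snd)⁻¹ := by
  obtain ⟨h1, h2⟩ := integral_inv_truePS_bounds h hN
  have m1 := integral_env_pos h (-C)
  have m2 := integral_env_pos h (C + 1)
  have hi : 0 < (labelProb (Q N))⁻¹ := inv_pos.2 hN
  constructor
  · have := inv_anti₀ ((mul_pos hi m1).trans_le h1) h2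
    rwa [mul_inv, inv_inv] at this
  · have := inv_anti₀ (mul_pos hi m1) h1
    rwa [mul_inv, inv_inv] at this

theorem sameOrder_invMeanInvPS (h : Regime ν Q γ₀ C P Z fold) :
    SameOrder (fun N => invMeanInvPS ν (Q N) (γ₀ N)) (fun N => labelProb (Q N)) := by
  have m1 := integral_env_pos h (-C)
  have m2 := integral_env_pos h (C + 1)
  refine ⟨(∫ x, env (C + 1) x ∂ν.snd)⁻¹ / 2, (∫ x, env (-C) x ∂ν.snd)⁻¹ * 2,
    by positivity, by positivity, ?_⟩
  filter_upwards [h.labelProb_pos] with N hN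
  obtain ⟨h1, h2⟩ := invMeanInvPS_bounds h hN
  have n1 : 0 < labelProb (Q N) * (∫ x, env (C + 1) x ∂ν.snd)⁻¹ := by positivity
  have n2 : 0 < labelProb (Q N) * (∫ x, env (-C) x ∂ν.snd)⁻¹ := by positivity
  constructor <;> linarith

/-- The normalized weight `a_N / π_N(x)` is dominated by the envelope. -/
theorem weight_le_env (h : Regime ν Q γ₀ C P Z fold) {N : ℕ} (hN : 0 < labelProb (Q N))
    (x : Cov p) : invMeanInvPS ν (Q N) (γ₀ N) / truePS (Q N) (γ₀ N) x ≤
      (∫ x, env (-C) x ∂ν.snd)⁻¹ * env (C + 1) x := by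
  have m1 := integral_env_pos h (-C)
  have hπ := truePS_nonneg (Q := Q N) (γ := γ₀ N) x
  have := env_pos (C + 1) x
  calc invMeanInvPS ν (Q N) (γ₀ N) / truePS (Q N) (γ₀ N) x
      ≤ (labelProb (Q N) * (∫ x, env (-C) x ∂ν.snd)⁻¹) *
        ((labelProb (Q N))⁻¹ * env (C + 1) x) := by
        rw [div_eq_mul_inv]
        exact mul_le_mul (invMeanInvPS_bounds h hN).2 (inv_truePS_le_env h hN x)
          (by positivity) (by positivity)
    _ = _ := by field_simp

theorem fittedPS_eq {N : ℕ} {ghat : Finset (Fin N) → (Fin N → Pt p) → Par p}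
    {T : Finset (Fin N)} {z : Fin N → Pt p} (hz : 0 < labelFrac T z) (x : Cov p) :
    fittedPS ghat T z x = logistic (inner ℝ (aug x) (shifted (labelProb (Q N)) (γ₀ N)) +
      inner ℝ (aug x) (mleError Q γ₀ ghat T z)) := by
  rw [← inner_add_right, mleError, add_sub_cancel, fittedPS, offsetPS_eq_shifted hz]

theorem inv_logistic (u : ℝ) : (logistic u)⁻¹ = 1 + Real.exp (-u) := by
  rw [logistic, Real.exp_neg]
  field_simp
  ring

/-- It comes from 1/g(u) = 1 + e^(-u). The identity is exact, and its factor 1 - g(u) is the factor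
1 - π_N(X) in the bias vector. -/
theorem one_sub_logistic_div (u t : ℝ) :
    1 - logistic u / logistic (u + t) = (1 - logistic u) * (1 - Real.exp (-t)) := by
  rw [div_eq_mul_inv, inv_logistic, one_sub_logistic, logistic, neg_add, Real.exp_add,
    Real.exp_neg u]
  field_simp
  ring

/-- The relative error of the fitted propensity score. -/
theorem one_sub_truePS_div_fittedPS {N : ℕ} (hN : 0 < labelProb (Q N))
    {ghat : Finset (Fin N) → (Fin N → Pt p) → Par p}
    {T : Finset (Fin N)} {z : Fin N → Pt p} (hz : 0 < labelFrac T z) (x : Cov p) :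
    1 - truePS (Q N) (γ₀ N) x / fittedPS ghat T z x =
      (1 - truePS (Q N) (γ₀ N) x) *
        (1 - Real.exp (-inner ℝ (aug x) (mleError Q γ₀ ghat T z))) := by
  rw [fittedPS_eq (Q := Q) (γ₀ := γ₀) hz, truePS_eq_shifted hN, one_sub_logistic_div]

theorem abs_one_sub_exp_inner_le {δ : Par p} (hδ : ‖δ‖ ≤ 1) (x : Cov p) :
    |1 - Real.exp (-inner ℝ (aug x) δ)| ≤ ‖δ‖ * env 2 x := by
  have h1 := abs_inner_le_of_norm_le_one (y := aug x) hδ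
  calc _ ≤ |inner ℝ (aug x) δ| * Real.exp |inner ℝ (aug x) δ| := abs_exp_sub_one_le _
    _ ≤ (‖aug x‖ * ‖δ‖) * Real.exp ‖aug x‖ := by
        gcongr
        exact abs_real_inner_le_norm _ _
    _ ≤ (env 1 x * ‖δ‖) * env 1 x := by
        have := env_pos 1 x
        gcongr
        · exact norm_aug_le_env x
        · exact exp_norm_aug_le_env x
    _ = ‖δ‖ * (env 1 x * env 1 x) := by ring
    _ = _ := by rw [env_mul]; norm_num

theorem abs_one_sub_truePS_div_le {N : ℕ} (hN : 0 < labelProb (Q N))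
    {ghat : Finset (Fin N) → (Fin N → Pt p) → Par p}
    {T : Finset (Fin N)} {z : Fin N → Pt p} (hz : 0 < labelFrac T z)
    (hδ : ‖mleError Q γ₀ ghat T z‖ ≤ 1) (x : Cov p) :
    |1 - truePS (Q N) (γ₀ N) x / fittedPS ghat T z x| ≤ ‖mleError Q γ₀ ghat T z‖ * env 2 x := by
  rw [one_sub_truePS_div_fittedPS hN hz, abs_mul]
  have h1 := truePS_nonneg (Q := Q N) (γ := γ₀ N) x
  have h2 := truePS_le_one (Q := Q N) (γ := γ₀ N) x
  calc _ ≤ 1 * |1 - Real.exp (-inner ℝ (aug x) (mleError Q γ₀ ghat T z))| := by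
        gcongr
        rw [abs_le]
        constructor <;> linarith
    _ ≤ _ := by
        rw [one_mul]
        exact abs_one_sub_exp_inner_le hδ x

/-- With probability tending to one, the fitted propensity score is nondegenerate and close. -/
theorem isNegl_fit (h : Regime ν Q γ₀ C P Z fold)
    {ghat : ∀ N, Finset (Fin N) → (Fin N → Pt p) → Par p} (hghat : ∀ N, IsOffsetMLE (ghat N))
    (o : Option (Fin K)) :
    IsNegl P (fun N => {ω | ¬ (0 < labelProb (Q N) ∧
      0 < labelFrac (trainSet (fold N ω) o) (obs (Z N) ω) ∧
      ‖mleError Q γ₀ (ghat N) (trainSet (fold N ω) o) (obs (Z N) ω)‖ ≤ 1)}) := by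
  refine ((isNegl_labelFrac h o).union (isNegl_mleError h hghat o)).mono'
    (Eventually.of_forall fun N ω hω => ?_)
  by_contra hcon
  simp only [Set.mem_union, Set.mem_ofPred_eq, not_or, not_not] at hcon
  obtain ⟨⟨c1, c2⟩, c3⟩ := hcon
  refine hω ⟨c1, ?_, c3⟩
  have h1 := (abs_le.1 c2).1
  by_contra! hle
  have h2 := div_nonpos_of_nonpos_of_nonneg hle c1.le
  linarith

theorem isBigOp_eLpNorm_fit (h : Regime ν Q γ₀ C P Z fold)
    {ghat : ∀ N, Finset (Fin N) → (Fin N → Pt p) → Par p} (hghat : ∀ N, IsOffsetMLE (ghat N))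
    (o : Option (Fin K)) :
    IsBigOp P (fun N ω => eLpNorm (fun x => 1 - truePS (Q N) (γ₀ N) x /
      fittedPS (ghat N) (trainSet (fold N ω) o) (obs (Z N) ω) x) 2 ν.snd) (rate Q) := by
  set B := (eLpNorm (env 2 : Cov p → ℝ) 2 ν.snd).toReal
  have hB : eLpNorm (env 2 : Cov p → ℝ) 2 ν.snd = ENNReal.ofReal B := by
    have := (memLp_env h 2 two_pos).2.ne
    rw [ENNReal.ofReal_ofNat] at this
    exact (ENNReal.ofReal_toReal this).symm
  refine ((isBigOp_mleError h hghat o).norm.const_mul B eventually_rate_nonneg).of_le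
    (isNegl_fit h hghat o) (Eventually.of_forall fun N ω hω => ?_)
  rw [Set.mem_ofPred_eq, not_not] at hω
  obtain ⟨c1, c2, c3⟩ := hω
  rw [enorm_eq_self]
  set δ := mleError Q γ₀ (ghat N) (trainSet (fold N ω) o) (obs (Z N) ω)
  calc _ ≤ eLpNorm (‖δ‖ • (env 2 : Cov p → ℝ)) 2 ν.snd := by
        refine eLpNorm_mono_real fun x => ?_
        exact abs_one_sub_truePS_div_le c1 c2 c3 x
    _ = ‖B * ‖δ‖‖ₑ := by
        rw [eLpNorm_const_smul, hB, enorm_mul, Real.enorm_of_nonneg (ENNReal.toReal_nonneg),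
          mul_comm]

theorem isBigOp_weighted_fit (h : Regime ν Q γ₀ C P Z fold)
    {ghat : ∀ N, Finset (Fin N) → (Fin N → Pt p) → Par p} (hghat : ∀ N, IsOffsetMLE (ghat N))
    (o : Option (Fin K)) :
    IsBigOp P (fun N ω => ∫⁻ x, ENNReal.ofReal
        (invMeanInvPS ν (Q N) (γ₀ N) / truePS (Q N) (γ₀ N) x *
          (1 - truePS (Q N) (γ₀ N) x /
            fittedPS (ghat N) (trainSet (fold N ω) o) (obs (Z N) ω) x) ^ 2) ∂ν.snd)
      (fun N => rate Q N * rate Q N) := by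
  -- The weight a_N/π_N(x) contributes `env (C + 1)` and the squared relative error `env 2` twice,
  -- hence C + 5.
  set B := (∫ x, env (-C) x ∂ν.snd)⁻¹ * ∫ x, env (C + 5) x ∂ν.snd
  have m1 := integral_env_pos h (-C)
  have m2 := integral_env_pos h (C + 5)
  have hd := (isBigOp_mleError h hghat o).norm
  refine ((hd.mul hd eventually_rate_nonneg eventually_rate_nonneg).const_mul B
    (Eventually.of_forall fun N => mul_self_nonneg _)).of_le
    (isNegl_fit h hghat o) (Eventually.of_forall fun N ω hω => ?_)
  rw [Set.mem_ofPred_eq, not_not] at hω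
  obtain ⟨c1, c2, c3⟩ := hω
  rw [enorm_eq_self]
  set δ := mleError Q γ₀ (ghat N) (trainSet (fold N ω) o) (obs (Z N) ω)
  calc _ ≤ ∫⁻ x, ENNReal.ofReal ((∫ x, env (-C) x ∂ν.snd)⁻¹ * (‖δ‖ * ‖δ‖)) *
        ENNReal.ofReal (env (C + 5) x) ∂ν.snd := by
        refine lintegral_mono fun x => ?_
        rw [← ENNReal.ofReal_mul (by positivity)]
        refine ENNReal.ofReal_le_ofReal ?_
        have h1 := weight_le_env h c1 x
        have h2 := abs_one_sub_truePS_div_le c1 c2 c3 x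
        have h3 := env_pos (C + 1) x
        rw [← sq_abs]
        calc _ ≤ ((∫ x, env (-C) x ∂ν.snd)⁻¹ * env (C + 1) x) * (‖δ‖ * env 2 x) ^ 2 := by
              gcongr
          _ = (∫ x, env (-C) x ∂ν.snd)⁻¹ * (‖δ‖ * ‖δ‖) * (env (C + 1) x * env 2 x ^ 2) := by ring
          _ = _ := by
              rw [env_pow, env_mul]
              congr 2
              norm_num
              ring
    _ = ‖B * (‖δ‖ * ‖δ‖)‖ₑ := by
        rw [lintegral_const_mul _ (by fun_prop), lintegral_env h,
          ← ENNReal.ofReal_mul (by positivity), Real.enorm_of_nonneg (by positivity)]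
        congr 1
        ring

theorem rate_mul_rate (N : ℕ) : rate Q N * rate Q N = ((N : ℝ) * labelProb (Q N))⁻¹ := by
  rw [rate, ← mul_inv, Real.mul_self_sqrt]
  exact mul_nonneg (Nat.cast_nonneg N) labelProb_nonneg

/-! #### Weighted norms of estimation errors -/

/-- Hölder's inequality against the envelope. -/
theorem lintegral_env_mul_sq_le (h : Regime ν Q γ₀ C P Z fold) (t : ℝ) {c : ℝ} (hc : 0 < c) :
    ∃ B : ℝ, 0 < B ∧ ∀ D : Cov p → ℝ, Measurable D →
      ∫⁻ x, ENNReal.ofReal (env t x) * ‖D x‖ₑ ^ 2 ∂ν.snd ≤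
        ENNReal.ofReal B * eLpNorm D (ENNReal.ofReal (2 + c)) ν.snd ^ 2 := by
  have hq1 : 1 < (2 + c) / 2 := by linarith
  -- The exponent (2 + c)/2 falls on D², giving |D|^(2 + c). Its conjugate falls on the envelope,
  -- which stays integrable however large it is; any c > 0 therefore suffices.
  have hpq := (Real.HolderConjugate.conjExponent hq1).symm
  set q := (2 + c) / 2
  set p' := q.conjExponent
  have hp' : 0 < p' := hpq.pos
  have hint : ∫⁻ x : Cov p, ENNReal.ofReal (env t x) ^ p' ∂ν.snd =
      ENNReal.ofReal (∫ x, env (p' * t) x ∂ν.snd) := by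
    rw [← lintegral_env h]
    refine lintegral_congr fun x => ?_
    rw [ENNReal.ofReal_rpow_of_pos (env_pos t x), env, ← Real.exp_mul, env]
    congr 2
    ring
  have m := integral_env_pos h (p' * t)
  refine ⟨(∫ x, env (p' * t) x ∂ν.snd) ^ (1 / p'), by positivity, fun D hD => ?_⟩
  have h1 := ENNReal.lintegral_mul_le_Lp_mul_Lq ν.snd hpq
    (f := fun x => ENNReal.ofReal (env t x)) (g := fun x => ‖D x‖ₑ ^ 2) (by fun_prop) (by fun_prop)
  simp only [Pi.mul_apply] at h1
  refine h1.trans ?_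
  rw [hint, ENNReal.ofReal_rpow_of_pos m]
  gcongr
  rw [eLpNorm_eq_lintegral_rpow_enorm_toReal (by simp; linarith) (by simp),
    ENNReal.toReal_ofReal (by linarith), ← ENNReal.rpow_natCast, ← ENNReal.rpow_mul]
  have e1 : ∀ x, (‖D x‖ₑ ^ 2) ^ q = ‖D x‖ₑ ^ (2 + c) := by
    intro x
    rw [← ENNReal.rpow_natCast, ← ENNReal.rpow_mul]
    congr 1
    simp only [q]
    push_cast
    ring
  simp only [e1]
  refine le_of_eq ?_
  congr 1
  simp only [q]
  push_cast
  field_simp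

theorem isLittleOp_env_sq (h : Regime ν Q γ₀ C P Z fold) (t : ℝ) {c : ℝ} (hc : 0 < c)
    {D : ∀ N, Ω N → Cov p → ℝ} (hD : ∀ N ω, Measurable (D N ω))
    (hlim : IsLittleOp P (fun N ω => eLpNorm (D N ω) (ENNReal.ofReal (2 + c)) ν.snd)
      (fun _ => 1)) :
    IsLittleOp P (fun N ω => ∫⁻ x, ENNReal.ofReal (env t x) * ‖D N ω x‖ₑ ^ 2 ∂ν.snd)
      (fun _ => 1) := by
  obtain ⟨B, hB, hle⟩ := lintegral_env_mul_sq_le h t hc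
  intro δ hδ
  refine (hlim.isNegl (show 0 < Real.sqrt (δ / B) by positivity)).mono'
    (Eventually.of_forall fun N ω hω => ?_)
  simp only [Set.mem_ofPred_eq, enorm_eq_self, mul_one] at hω ⊢
  by_contra! hcon
  refine absurd hω (not_lt.2 ((hle _ (hD N ω)).trans ?_))
  calc _ ≤ ENNReal.ofReal B * ENNReal.ofReal (Real.sqrt (δ / B)) ^ 2 := by gcongr
    _ = ENNReal.ofReal δ := by
        rw [← ENNReal.ofReal_pow (by positivity), Real.sq_sqrt (by positivity),
          ← ENNReal.ofReal_mul (by positivity)]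
        congr 1
        field_simp

theorem isLittleOp_weighted_outcome (h : Regime ν Q γ₀ C P Z fold) {c : ℝ} (hc : 0 < c)
    {D : ∀ N, Ω N → Cov p → ℝ} (hD : ∀ N ω, Measurable (D N ω))
    (hlim : IsLittleOp P (fun N ω => eLpNorm (D N ω) (ENNReal.ofReal (2 + c)) ν.snd)
      (fun _ => 1)) :
    IsLittleOp P (fun N ω => ∫⁻ x, ENNReal.ofReal
        (invMeanInvPS ν (Q N) (γ₀ N) / truePS (Q N) (γ₀ N) x * D N ω x ^ 2) ∂ν.snd)
      (fun _ => 1) := by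
  have m1 := integral_env_pos h (-C)
  intro δ hδ
  refine ((isLittleOp_env_sq h (C + 1) hc hD hlim).isNegl
    (show 0 < δ * ∫ x, env (-C) x ∂ν.snd by positivity)).mono' ?_
  filter_upwards [h.labelProb_pos] with N hN ω hω
  simp only [Set.mem_ofPred_eq, enorm_eq_self, mul_one] at hω ⊢
  by_contra! hcon
  refine absurd hω (not_lt.2 ?_)
  calc _ ≤ ∫⁻ x, ENNReal.ofReal (∫ x, env (-C) x ∂ν.snd)⁻¹ *
        (ENNReal.ofReal (env (C + 1) x) * ‖D N ω x‖ₑ ^ 2) ∂ν.snd := by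
        refine lintegral_mono fun x => ?_
        rw [← enorm_pow, Real.enorm_of_nonneg (by positivity),
          ← ENNReal.ofReal_mul (env_pos _ _).le, ← ENNReal.ofReal_mul (by positivity), ← mul_assoc]
        refine ENNReal.ofReal_le_ofReal ?_
        gcongr
        exact weight_le_env h hN x
    _ ≤ ENNReal.ofReal (∫ x, env (-C) x ∂ν.snd)⁻¹ *
        ENNReal.ofReal (δ * ∫ x, env (-C) x ∂ν.snd) := by
        rw [lintegral_const_mul' _ _ (by simp)]
        gcongr
    _ = _ := by
        rw [← ENNReal.ofReal_mul (by positivity)]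
        congr 1
        field_simp

end PropensityRates

/-! ### The expansion of inverse probability weighted averages -/

section FoldAlgebra

variable {N K : ℕ} {E : Type*} [NormedAddCommGroup E] [InnerProductSpace ℝ E]

/-- The share of the `k`-th fold. -/
def foldShare (f : Fin N → Fin K) (k : Fin K) : ℝ :=
  ((Finset.univ.filter fun i => f i = k).card : ℝ) / N

theorem card_trainSet_add (f : Fin N → Fin K) (k : Fin K) :
    ((Finset.univ.filter fun i => f i = k).card : ℝ) + ((trainSet f (some k)).card : ℝ) = N := by
  have := Finset.card_filter_add_card_filter_not (s := (Finset.univ : Finset (Fin N)))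
    (fun i => f i = k)
  have h2 : (Finset.univ.filter fun i => f i = k).card + (trainSet f (some k)).card = N := by
    simpa [trainSet] using this
  exact_mod_cast h2

theorem foldShare_nonneg (f : Fin N → Fin K) (k : Fin K) : 0 ≤ foldShare f k := by
  unfold foldShare; positivity

theorem one_sub_foldShare (hN : 0 < N) (f : Fin N → Fin K) (k : Fin K) :
    1 - foldShare f k = ((trainSet f (some k)).card : ℝ) / N := by
  have hN' : (N : ℝ) ≠ 0 := by exact_mod_cast hN.ne'
  rw [foldShare, ← card_trainSet_add f k]
  rw [← card_trainSet_add f k] at hN'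
  field_simp
  ring

theorem foldShare_le_one (hN : 0 < N) (f : Fin N → Fin K) (k : Fin K) : foldShare f k ≤ 1 := by
  have h : 0 ≤ 1 - foldShare f k := by
    rw [one_sub_foldShare hN]; positivity
  linarith

/-- The full average as a combination of the averages over the training samples. -/
theorem average_eq_sum_train (hN : 0 < N) (hK : 2 ≤ K) (f : Fin N → Fin K) (s : Fin N → E) :
    (N : ℝ)⁻¹ • ∑ i, s i = ∑ k, ((1 - foldShare f k) / (K - 1 : ℝ)) •
      (((trainSet f (some k)).card : ℝ)⁻¹ • ∑ i ∈ trainSet f (some k), s i) := by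
  have hN' : (N : ℝ) ≠ 0 := by exact_mod_cast hN.ne'
  have hK' : (K : ℝ) - 1 ≠ 0 := by
    have : (2 : ℝ) ≤ K := by exact_mod_cast hK
    linarith
  have h1 : ∀ k, ((1 - foldShare f k) / (K - 1 : ℝ)) •
      (((trainSet f (some k)).card : ℝ)⁻¹ • ∑ i ∈ trainSet f (some k), s i) =
      ((N : ℝ)⁻¹ * (K - 1 : ℝ)⁻¹) • ∑ i ∈ trainSet f (some k), s i := by
    intro k
    rcases Finset.eq_empty_or_nonempty (trainSet f (some k)) with h0 | h0
    · rw [h0]; simp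
    · have : ((trainSet f (some k)).card : ℝ) ≠ 0 := by
        exact_mod_cast (Finset.card_pos.2 h0).ne'
      rw [one_sub_foldShare hN, smul_smul]
      congr 1
      field_simp
  simp only [h1]
  rw [← Finset.smul_sum]
  -- Each index lies in exactly K - 1 training sets.
  have h2 : ∑ k, ∑ i ∈ trainSet f (some k), s i = (K - 1 : ℝ) • ∑ i, s i := by
    simp only [trainSet, Finset.sum_filter]
    rw [Finset.sum_comm, Finset.smul_sum]
    refine Finset.sum_congr rfl fun i _ => ?_
    rw [← Finset.sum_filter, Finset.sum_const, Finset.filter_ne, Finset.card_erase_of_mem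
      (Finset.mem_univ _), Finset.card_univ, Fintype.card_fin, ← Nat.cast_smul_eq_nsmul ℝ,
      Nat.cast_sub (by omega), Nat.cast_one]
  rw [h2, smul_smul]
  congr 1
  field_simp

/-- The remainder of the linearization of a cross-fitted weighted average. -/
theorem abs_crossfit_expansion_le (hN : 0 < N) (hK : 2 ≤ K) (f : Fin N → Fin K) (x : Fin N → E)
    (ξ : Fin N → ℝ) (s : Fin N → E) (d : Fin K → E) (hd : ∀ k, ‖d k‖ ≤ 1) (v : E)
    (L : E →L[ℝ] E) :
    |(N : ℝ)⁻¹ * ∑ i, ξ i * (1 - Real.exp (-inner ℝ (x i) (d (f i)))) -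
        inner ℝ v (L ((N : ℝ)⁻¹ • ∑ i, s i))| ≤
      ∑ k, (‖(N : ℝ)⁻¹ • ∑ i with f i = k, (ξ i • x i - v)‖ * ‖d k‖ +
        ‖v‖ * ‖d k - L (((trainSet f (some k)).card : ℝ)⁻¹ •
          ∑ i ∈ trainSet f (some k), s i)‖ +
        2 * |foldShare f k - 1 / K| * (‖v‖ * ‖L (((trainSet f (some k)).card : ℝ)⁻¹ •
          ∑ i ∈ trainSet f (some k), s i)‖) +
        (N : ℝ)⁻¹ * (∑ i with f i = k, |ξ i| * (‖x i‖ ^ 2 * Real.exp ‖x i‖)) *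
          (‖d k‖ * ‖d k‖)) := by
  have hN' : (N : ℝ) ≠ 0 := by exact_mod_cast hN.ne'
  have hK2 : (2 : ℝ) ≤ K := by exact_mod_cast hK
  have hK' : (K : ℝ) - 1 ≠ 0 := by linarith
  set V : Fin K → E := fun k => (N : ℝ)⁻¹ • ∑ i with f i = k, (ξ i • x i - v)
  set S : Fin K → E := fun k => ((trainSet f (some k)).card : ℝ)⁻¹ •
    ∑ i ∈ trainSet f (some k), s i
  set w : Fin K → ℝ := foldShare f
  -- On each fold 1 - e^(-t) is split into t and a quadratic remainder, and ξ x into its deviation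
  -- from v and v itself; the v part produces the fold share.
  have id1 : (N : ℝ)⁻¹ * ∑ i, ξ i * (1 - Real.exp (-inner ℝ (x i) (d (f i)))) =
      ∑ k, (inner ℝ (V k) (d k) + w k * inner ℝ v (d k) +
        (N : ℝ)⁻¹ * ∑ i with f i = k, ξ i *
          (1 - Real.exp (-inner ℝ (x i) (d k)) - inner ℝ (x i) (d k))) := by
    rw [← Finset.sum_fiberwise Finset.univ f, Finset.mul_sum]
    refine Finset.sum_congr rfl fun k _ => ?_
    have e1 : inner ℝ (V k) (d k) + w k * inner ℝ v (d k) =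
        (N : ℝ)⁻¹ * ∑ i with f i = k, ξ i * inner ℝ (x i) (d k) := by
      simp only [V, w, foldShare, real_inner_smul_left, sum_inner, inner_sub_left,
        Finset.sum_sub_distrib, Finset.sum_const, ← Nat.cast_smul_eq_nsmul ℝ, Finset.mul_sum]
      simp only [← Finset.mul_sum]
      ring
    rw [e1, ← mul_add, ← Finset.sum_add_distrib]
    congr 1
    refine Finset.sum_congr rfl fun i hi => ?_
    rw [(Finset.mem_filter.1 hi).2]
    ring
  have id2 : inner ℝ v (L ((N : ℝ)⁻¹ • ∑ i, s i)) =
      ∑ k, (1 - w k) / (K - 1 : ℝ) * inner ℝ v (L (S k)) := by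
    rw [average_eq_sum_train hN hK f s, map_sum, inner_sum]
    refine Finset.sum_congr rfl fun k _ => ?_
    rw [map_smul, real_inner_smul_right]
  rw [id1, id2, ← Finset.sum_sub_distrib]
  refine (Finset.abs_sum_le_sum_abs _ _).trans (Finset.sum_le_sum fun k _ => ?_)
  -- The fold share w and the recombination weight differ by w - (1 - w)/(K - 1) = K/(K - 1) (w -
  -- 1/K). This is where asymptotically equal folds are needed; K/(K - 1) ≤ 2 because K ≥ 2.
  have e2 : inner ℝ (V k) (d k) + w k * inner ℝ v (d k) + (N : ℝ)⁻¹ * ∑ i with f i = k, ξ i *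
          (1 - Real.exp (-inner ℝ (x i) (d k)) - inner ℝ (x i) (d k)) -
        (1 - w k) / (K - 1 : ℝ) * inner ℝ v (L (S k)) =
      inner ℝ (V k) (d k) + w k * inner ℝ v (d k - L (S k)) +
        (K / (K - 1 : ℝ) * (w k - 1 / K)) * inner ℝ v (L (S k)) +
        (N : ℝ)⁻¹ * ∑ i with f i = k, ξ i *
          (1 - Real.exp (-inner ℝ (x i) (d k)) - inner ℝ (x i) (d k)) := by
    rw [inner_sub_right]
    have : (K : ℝ) ≠ 0 := by linarith
    field_simp
    ring
  rw [e2]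
  have b1 : |inner ℝ (V k) (d k)| ≤ ‖V k‖ * ‖d k‖ := abs_real_inner_le_norm _ _
  have b2 : |w k * inner ℝ v (d k - L (S k))| ≤ ‖v‖ * ‖d k - L (S k)‖ := by
    rw [abs_mul, abs_of_nonneg (foldShare_nonneg f k)]
    calc _ ≤ 1 * (‖v‖ * ‖d k - L (S k)‖) := by
          gcongr
          · exact foldShare_le_one hN f k
          · exact abs_real_inner_le_norm _ _
      _ = _ := one_mul _
  have b3 : |(K / (K - 1 : ℝ) * (w k - 1 / K)) * inner ℝ v (L (S k))| ≤
      2 * |w k - 1 / K| * (‖v‖ * ‖L (S k)‖) := by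
    rw [abs_mul, abs_mul]
    gcongr
    · rw [abs_of_nonneg (div_nonneg (by linarith) (by linarith)), div_le_iff₀ (by linarith)]
      linarith
    · exact abs_real_inner_le_norm _ _
  have b4 : |(N : ℝ)⁻¹ * ∑ i with f i = k, ξ i *
          (1 - Real.exp (-inner ℝ (x i) (d k)) - inner ℝ (x i) (d k))| ≤
      (N : ℝ)⁻¹ * (∑ i with f i = k, |ξ i| * (‖x i‖ ^ 2 * Real.exp ‖x i‖)) *
          (‖d k‖ * ‖d k‖) := by
    rw [abs_mul, abs_of_nonneg (by positivity : (0 : ℝ) ≤ (N : ℝ)⁻¹), mul_assoc, Finset.sum_mul]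
    gcongr
    refine (Finset.abs_sum_le_sum_abs _ _).trans (Finset.sum_le_sum fun i _ => ?_)
    rw [abs_mul, mul_assoc]
    gcongr
    have h1 := abs_inner_le_of_norm_le_one (y := x i) (hd k)
    have h2 := abs_real_inner_le_norm (x i) (d k)
    calc _ ≤ |inner ℝ (x i) (d k)| ^ 2 * Real.exp |inner ℝ (x i) (d k)| := by
          rw [sq_abs]
          exact abs_exp_taylor _
      _ ≤ (‖x i‖ * ‖d k‖) ^ 2 * Real.exp ‖x i‖ := by gcongr
      _ = _ := by ring
  refine (abs_add_le _ _).trans (add_le_add ((abs_add_le _ _).trans (add_le_add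
    ((abs_add_le _ _).trans (add_le_add b1 b2)) b3)) b4)

end FoldAlgebra

/-! ### Asymptotic linearity of the cross-fitted inverse weighting error. -/

section Expansion

variable {p K : ℕ} {ν : Measure (ℝ × Cov p)} [IsProbabilityMeasure ν] {Q : ℕ → Measure (Pt p)}
  [∀ N, IsProbabilityMeasure (Q N)] {γ₀ : ℕ → Par p} {C : ℝ} {Ω : ℕ → Type*}
  [∀ N, MeasurableSpace (Ω N)] {P : ∀ N, Measure (Ω N)} [∀ N, IsProbabilityMeasure (P N)]
  {Z : ∀ N, Fin N → Ω N → Pt p} {fold : ∀ N, Ω N → Fin N → Fin K}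

/-- The weighted residual `R {1 - π(X)} W / π(X)`. -/
def weightedResidual (Q : Measure (Pt p)) (γ : Par p) (W : ℝ × Cov p → ℝ) (z : Pt p) : ℝ :=
  z.1 * ((truePS Q γ z.2.2)⁻¹ * (1 - truePS Q γ z.2.2) * W z.2)

@[fun_prop]
theorem measurable_weightedResidual (Q : Measure (Pt p)) (γ : Par p) {W : ℝ × Cov p → ℝ}
    (hW : Measurable W) : Measurable (weightedResidual Q γ W) := by
  unfold weightedResidual
  fun_prop

/-- The variable `W` has second moments weighted by the envelopes, and conditional mean `μ - m`
given the covariates. -/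
structure IsOutcomeResidual (ν : Measure (ℝ × Cov p)) (m μ : Cov p → ℝ) (W : ℝ × Cov p → ℝ) :
    Prop where
  measurable : Measurable W
  moments : ∀ t : ℝ, ∫⁻ w, ENNReal.ofReal (env t w.2) * ‖W w‖ₑ ^ 2 ∂ν ≠ ∞
  mean : ∀ (φ : Cov p → ℝ) (t : ℝ), Measurable φ → (∀ x, |φ x| ≤ env t x) →
    ∫ w, φ w.2 * W w ∂ν = ∫ x, φ x * (μ x - m x) ∂ν.snd

variable {m μ : Cov p → ℝ} {W : ℝ × Cov p → ℝ}

theorem truePS_pos {N : ℕ} (hN : 0 < labelProb (Q N)) (x : Cov p) :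
    0 < truePS (Q N) (γ₀ N) x := offsetPS_pos hN _ _

theorem abs_inv_mul_one_sub_le {N : ℕ} (x : Cov p) :
    |(truePS (Q N) (γ₀ N) x)⁻¹ * (1 - truePS (Q N) (γ₀ N) x)| ≤ (truePS (Q N) (γ₀ N) x)⁻¹ := by
  have h1 := truePS_nonneg (Q := Q N) (γ := γ₀ N) x
  have h2 := truePS_le_one (Q := Q N) (γ := γ₀ N) x
  rw [abs_mul, abs_of_nonneg (inv_nonneg.2 h1), abs_of_nonneg (by linarith)]
  exact mul_le_of_le_one_right (inv_nonneg.2 h1) (by linarith)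

/-- Second moments of weighted residuals times functions of the covariates. -/
theorem lintegral_weightedResidual_sq_le (h : Regime ν Q γ₀ C P Z fold)
    (hW : Measurable W) {N : ℕ} (hN : 0 < labelProb (Q N))
    {φ : Cov p → ℝ} (hφ : Measurable φ) {t : ℝ} (hφt : ∀ x, |φ x| ≤ env t x) :
    ∫⁻ z, ‖weightedResidual (Q N) (γ₀ N) W z * φ z.2.2‖ₑ ^ 2 ∂(Q N) ≤
      ENNReal.ofReal (labelProb (Q N))⁻¹ *
        ∫⁻ w, ENNReal.ofReal (env (C + 1 + 2 * t) w.2) * ‖W w‖ₑ ^ 2 ∂ν := by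
  set π := truePS (Q N) (γ₀ N)
  have hπm : Measurable π := measurable_truePS _ _
  have h1 : ∫⁻ z, ‖weightedResidual (Q N) (γ₀ N) W z * φ z.2.2‖ₑ ^ 2 ∂(Q N) =
      ∫⁻ z, ‖z.1‖ₑ * ‖(π z.2.2)⁻¹ * (1 - π z.2.2) * W z.2 * φ z.2.2‖ₑ ^ 2 ∂(Q N) := by
    refine lintegral_congr_ae ?_
    filter_upwards [(h.model N).binary] with z hz
    rw [weightedResidual, mul_assoc, enorm_mul, mul_pow]
    congr 1
    rcases hz with hz | hz <;> simp [hz]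
  rw [h1, (h.model N).lintegral_label
    (φ := fun w => ‖(π w.2)⁻¹ * (1 - π w.2) * W w * φ w.2‖ₑ ^ 2) (by fun_prop),
    ← lintegral_const_mul' _ _ (by simp)]
  refine lintegral_mono fun w => ?_
  have hπ : 0 < π w.2 := truePS_pos hN w.2
  rw [← enorm_pow, ← enorm_pow, Real.enorm_of_nonneg (sq_nonneg _),
    Real.enorm_of_nonneg (sq_nonneg _), ← ENNReal.ofReal_mul hπ.le,
    ← ENNReal.ofReal_mul (env_pos _ _).le, ← ENNReal.ofReal_mul (by positivity)]
  refine ENNReal.ofReal_le_ofReal ?_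
  have h2 := abs_inv_mul_one_sub_le (Q := Q) (γ₀ := γ₀) (N := N) w.2
  have h3 := inv_truePS_le_env h hN w.2
  have h4 := env_pos t w.2
  rw [mul_pow, mul_pow, ← sq_abs (_ * _), ← sq_abs (φ w.2)]
  calc _ ≤ π w.2 * ((π w.2)⁻¹ ^ 2 * W w ^ 2 * env t w.2 ^ 2) := by
        gcongr
        exact hφt w.2
    _ = (π w.2)⁻¹ * (env t w.2 ^ 2 * W w ^ 2) := by field_simp
    _ ≤ ((labelProb (Q N))⁻¹ * env (C + 1) w.2) * (env t w.2 ^ 2 * W w ^ 2) := by gcongr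
    _ = (labelProb (Q N))⁻¹ * ((env (C + 1) w.2 * env t w.2 ^ 2) * W w ^ 2) := by ring
    _ = _ := by rw [env_pow, env_mul]; norm_num

/-- From |W| ≤ 1 + W² and the integrability of the envelopes. -/
theorem IsOutcomeResidual.lintegral_abs_ne_top (hW : IsOutcomeResidual ν m μ W)
    (h : Regime ν Q γ₀ C P Z fold) (t : ℝ) :
    ∫⁻ w, ENNReal.ofReal (env t w.2) * ‖W w‖ₑ ∂ν ≠ ∞ := by
  have hWm := hW.measurable
  refine ne_top_of_le_ne_top (ENNReal.add_ne_top.2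
    ⟨show ∫⁻ w, ENNReal.ofReal (env t w.2) ∂ν ≠ ∞ from ?_, hW.moments t⟩) ?_
  · have := lintegral_env h t
    rw [Measure.snd, lintegral_map (by fun_prop) measurable_snd] at this
    rw [this]
    simp
  · rw [← lintegral_add_left (by fun_prop)]
    refine lintegral_mono fun w => ?_
    rw [← mul_one_add]
    gcongr
    rcases le_total ‖W w‖ₑ 1 with h1 | h1
    · exact h1.trans le_self_add
    · exact (le_self_pow₀ h1 two_ne_zero).trans le_add_self

/-- For first moments the label R integrates to π(X) and cancels 1/π(X), so the bound does not
involve π_N. -/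
theorem lintegral_weightedResidual_abs_le (h : Regime ν Q γ₀ C P Z fold)
    (hW : Measurable W) {N : ℕ} (hN : 0 < labelProb (Q N))
    {φ : Cov p → ℝ} (hφ : Measurable φ) {t : ℝ} (hφt : ∀ x, |φ x| ≤ env t x) :
    ∫⁻ z, ‖weightedResidual (Q N) (γ₀ N) W z * φ z.2.2‖ₑ ∂(Q N) ≤
        ∫⁻ w, ENNReal.ofReal (env t w.2) * ‖W w‖ₑ ∂ν := by
  set π := truePS (Q N) (γ₀ N)
  have hπm : Measurable π := measurable_truePS _ _
  have h1 : ∀ z : Pt p, ‖weightedResidual (Q N) (γ₀ N) W z * φ z.2.2‖ₑ =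
      ‖z.1‖ₑ * ‖(π z.2.2)⁻¹ * (1 - π z.2.2) * W z.2 * φ z.2.2‖ₑ := by
    intro z
    rw [weightedResidual, mul_assoc, enorm_mul]
  simp only [h1]
  rw [(h.model N).lintegral_label
    (φ := fun w => ‖(π w.2)⁻¹ * (1 - π w.2) * W w * φ w.2‖ₑ) (by fun_prop)]
  refine lintegral_mono fun w => ?_
  have hπ : 0 < π w.2 := truePS_pos hN w.2
  rw [Real.enorm_eq_ofReal_abs, Real.enorm_eq_ofReal_abs, ← ENNReal.ofReal_mul hπ.le,
    ← ENNReal.ofReal_mul (env_pos _ _).le]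
  refine ENNReal.ofReal_le_ofReal ?_
  have h2 := abs_inv_mul_one_sub_le (Q := Q) (γ₀ := γ₀) (N := N) w.2
  rw [abs_mul, abs_mul]
  calc _ ≤ π w.2 * ((π w.2)⁻¹ * |W w| * env t w.2) := by
        gcongr
        exact hφt w.2
    _ = _ := by field_simp

theorem biasVector_apply (hW : IsOutcomeResidual ν m μ W) (N : ℕ) (j : Fin (p + 1)) :
    biasVector ν (Q N) (γ₀ N) m μ j =
      ∫ w, ((1 - truePS (Q N) (γ₀ N) w.2) * aug w.2 j) * W w ∂ν := by
  rw [hW.mean (fun x => (1 - truePS (Q N) (γ₀ N) x) * aug x j) 1 (by fun_prop)]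
  · rw [biasVector]
    refine integral_congr_ae (Eventually.of_forall fun x => ?_)
    ring
  · intro x
    have h1 := truePS_nonneg (Q := Q N) (γ := γ₀ N) x
    have h2 := truePS_le_one (Q := Q N) (γ := γ₀ N) x
    rw [abs_mul, abs_of_nonneg (by linarith)]
    exact (mul_le_of_le_one_left (abs_nonneg _) (by linarith)).trans (abs_aug_apply_le_env x j)

theorem integral_weightedResidual (h : Regime ν Q γ₀ C P Z fold)
    (hW : IsOutcomeResidual ν m μ W) {N : ℕ} (hN : 0 < labelProb (Q N)) (j : Fin (p + 1)) :
    ∫ z, weightedResidual (Q N) (γ₀ N) W z * aug z.2.2 j ∂(Q N) =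
      biasVector ν (Q N) (γ₀ N) m μ j := by
  have hWm := hW.measurable
  rw [biasVector_apply hW]
  simp only [weightedResidual, mul_assoc]
  rw [(h.model N).integral_label (φ := fun w => (truePS (Q N) (γ₀ N) w.2)⁻¹ *
    ((1 - truePS (Q N) (γ₀ N) w.2) * (W w * aug w.2 j))) (by fun_prop)]
  refine integral_congr_ae (Eventually.of_forall fun w => ?_)
  have hπ := truePS_pos (γ₀ := γ₀) hN w.2
  simp only
  field_simp

/-- The bound is uniform in N because 0 ≤ 1 - π ≤ 1 and the law of (Y, X) is fixed. -/
theorem exists_norm_biasVector_le (h : Regime ν Q γ₀ C P Z fold)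
    (hW : IsOutcomeResidual ν m μ W) :
    ∃ B : ℝ, 0 ≤ B ∧ ∀ N, ‖biasVector ν (Q N) (γ₀ N) m μ‖ ≤ B := by
  refine ⟨∑ _j : Fin (p + 1), (∫⁻ w, ENNReal.ofReal (env 1 w.2) * ‖W w‖ₑ ∂ν).toReal,
    by positivity, fun N => (norm_le_sum_abs _).trans (Finset.sum_le_sum fun j _ => ?_)⟩
  rw [biasVector_apply hW, ← Real.norm_eq_abs]
  refine (norm_integral_le_lintegral_norm _).trans
    (ENNReal.toReal_mono (hW.lintegral_abs_ne_top h 1) (lintegral_mono fun w => ?_))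
  rw [Real.enorm_eq_ofReal_abs, ← ENNReal.ofReal_mul (env_pos _ _).le]
  refine ENNReal.ofReal_le_ofReal ?_
  have h1 := truePS_nonneg (Q := Q N) (γ := γ₀ N) w.2
  have h2 := truePS_le_one (Q := Q N) (γ := γ₀ N) w.2
  rw [Real.norm_eq_abs, abs_mul, abs_mul, abs_of_nonneg (by linarith)]
  gcongr
  exact (mul_le_of_le_one_left (abs_nonneg _) (by linarith)).trans (abs_aug_apply_le_env _ j)

/-- The covariate-weighted residuals concentrate at the bias vector. -/
theorem isBigOp_residual_fold (h : Regime ν Q γ₀ C P Z fold)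
    (hW : IsOutcomeResidual ν m μ W) (k : Fin K) :
    IsBigOp P (fun N ω => (N : ℝ)⁻¹ • ∑ i with fold N ω i = k,
      (weightedResidual (Q N) (γ₀ N) W (Z N i ω) • aug (Z N i ω).2.2 -
        biasVector ν (Q N) (γ₀ N) m μ)) (rate Q) := by
  have hWm := hW.measurable
  have hj : ∀ j, IsBigOp P (fun N ω => ((N : ℝ)⁻¹ • ∑ i with fold N ω i = k,
      (weightedResidual (Q N) (γ₀ N) W (Z N i ω) • aug (Z N i ω).2.2 -
        biasVector ν (Q N) (γ₀ N) m μ)) j) (rate Q) := by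
    intro j
    have h1 := isBigOp_average h.sample h.labelProb_pos
      (F := fun N z => weightedResidual (Q N) (γ₀ N) W z * aug z.2.2 j)
      (fun N => (measurable_weightedResidual _ _ hWm).mul (by fun_prop))
      (c := (∫⁻ w, ENNReal.ofReal (env (C + 1 + 2 * 1) w.2) * ‖W w‖ₑ ^ 2 ∂ν).toReal) ?_
      (fun N f => Finset.univ.filter fun i => f i = k)
    · refine h1.of_norm_le IsNegl.empty ?_
      filter_upwards [h.labelProb_pos] with N hN ω _
      rw [integral_weightedResidual h hW hN]
      refine le_of_eq (congrArg _ ?_)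
      simp
    · filter_upwards [h.labelProb_pos] with N hN
      refine (lintegral_weightedResidual_sq_le h hWm hN (measurable_aug_apply j)
        (fun x => abs_aug_apply_le_env x j)).trans (le_of_eq ?_)
      rw [div_eq_inv_mul, ENNReal.ofReal_mul (by positivity),
        ENNReal.ofReal_toReal (hW.moments _)]
  have h2 := IsBigOp.sum Finset.univ (fun j => (hj j).abs) eventually_rate_nonneg
  refine h2.of_norm_le IsNegl.empty (Eventually.of_forall fun N ω _ => ?_)
  exact (norm_le_sum_abs _).trans (le_abs_self _)

theorem isBigOp_residual_third (h : Regime ν Q γ₀ C P Z fold)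
    (hW : IsOutcomeResidual ν m μ W) (k : Fin K) :
    IsBigOp P (fun N ω => (N : ℝ)⁻¹ * ∑ i with fold N ω i = k,
      |weightedResidual (Q N) (γ₀ N) W (Z N i ω)| *
        (‖aug (Z N i ω).2.2‖ ^ 2 * Real.exp ‖aug (Z N i ω).2.2‖)) (fun _ => 1) := by
  have hWm := hW.measurable
  have h1 := isBigOp_average_abs h.sample
    (F := fun N z => weightedResidual (Q N) (γ₀ N) W z *
      (‖aug z.2.2‖ ^ 2 * Real.exp ‖aug z.2.2‖))
    (fun N => (measurable_weightedResidual _ _ hWm).mul (by fun_prop))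
    (c := (∫⁻ w, ENNReal.ofReal (env 3 w.2) * ‖W w‖ₑ ∂ν).toReal) ?_
    (fun N f => Finset.univ.filter fun i => f i = k)
  · refine h1.of_norm_le IsNegl.empty (Eventually.of_forall fun N ω _ => ?_)
    refine le_of_eq (congrArg _ ?_)
    congr 1
    refine Finset.sum_congr rfl fun i _ => ?_
    rw [abs_mul, abs_of_nonneg (by positivity : 0 ≤ ‖aug (Z N i ω).2.2‖ ^ 2 *
      Real.exp ‖aug (Z N i ω).2.2‖)]
  · filter_upwards [h.labelProb_pos] with N hN
    rw [ENNReal.ofReal_toReal (hW.lintegral_abs_ne_top h 3)]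
    refine lintegral_weightedResidual_abs_le h hWm hN
      (φ := fun x => ‖aug x‖ ^ 2 * Real.exp ‖aug x‖) (by fun_prop) fun x => ?_
    rw [abs_of_nonneg (by positivity)]
    calc _ ≤ env 1 x ^ 2 * env 1 x := by
          have := env_pos 1 x
          gcongr
          · exact norm_aug_le_env x
          · exact exp_norm_aug_le_env x
      _ = _ := by rw [env_pow, env_mul]; norm_num

/-- The cross-fitted inverse probability weighting error of `W` is asymptotically linear. -/
theorem isLittleOp_expansion (h : Regime ν Q γ₀ C P Z fold)
    {ghat : ∀ N, Finset (Fin N) → (Fin N → Pt p) → Par p} (hghat : ∀ N, IsOffsetMLE (ghat N))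
    (hW : IsOutcomeResidual ν m μ W) :
    IsLittleOp P (fun N ω =>
      (N : ℝ)⁻¹ * ∑ i, ((Z N i ω).1 / truePS (Q N) (γ₀ N) (Z N i ω).2.2 -
          (Z N i ω).1 / crossPS (ghat N) (fold N ω) (obs (Z N) ω) i (Z N i ω).2.2) * W (Z N i ω).2
        - (N : ℝ)⁻¹ * ∑ i, ifPi ν (Q N) (γ₀ N) m μ (Z N i ω)) (rate Q) := by
  have hC := h.const_pos
  obtain ⟨B, hB0, hB⟩ := exists_norm_biasVector_le h hW
  have hr := eventually_rate_nonneg (Q := Q)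
  have hone : ∀ᶠ N : ℕ in atTop, (0 : ℝ) ≤ 1 := by simp
  have hrr : ∀ᶠ N in atTop, (0 : ℝ) ≤ rate Q N * rate Q N :=
    Eventually.of_forall fun N => mul_self_nonneg _
  have hd := fun k : Fin K => (isBigOp_mleError h hghat (some k)).norm
  -- The four summands are of order rate · rate, o(rate), o(1) · rate and 1 · rate² respectively;
  -- the norm of the bias vector is replaced by its uniform bound B.
  have hterm : ∀ k : Fin K, IsLittleOp P (fun N ω =>
      ‖(N : ℝ)⁻¹ • ∑ i with fold N ω i = k,
        (weightedResidual (Q N) (γ₀ N) W (Z N i ω) • aug (Z N i ω).2.2 -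
          biasVector ν (Q N) (γ₀ N) m μ)‖ *
        ‖mleError Q γ₀ (ghat N) (trainSet (fold N ω) (some k)) (obs (Z N) ω)‖ +
      B * ‖mleError Q γ₀ (ghat N) (trainSet (fold N ω) (some k)) (obs (Z N) ω) -
        infoInv ν Q γ₀ N (trainScore Q γ₀ (trainSet (fold N ω) (some k)) (fun i => Z N i ω))‖ +
      2 * |foldShare (fold N ω) k - 1 / K| * (B * (C * ((labelProb (Q N))⁻¹ *
        ‖trainScore Q γ₀ (trainSet (fold N ω) (some k)) (fun i => Z N i ω)‖))) +
      (N : ℝ)⁻¹ * (∑ i with fold N ω i = k, |weightedResidual (Q N) (γ₀ N) W (Z N i ω)| *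
        (‖aug (Z N i ω).2.2‖ ^ 2 * Real.exp ‖aug (Z N i ω).2.2‖)) *
        (‖mleError Q γ₀ (ghat N) (trainSet (fold N ω) (some k)) (obs (Z N) ω)‖ *
          ‖mleError Q γ₀ (ghat N) (trainSet (fold N ω) (some k)) (obs (Z N) ω)‖)) (rate Q) := by
    intro k
    have t1 := ((isBigOp_residual_fold h hW k).norm.mul (hd k) hr hr).isLittleOp
      (s := rate Q) (rate_mul_rate_isLittle h)
    have t2 := (isLittleOp_mleError_sub h hghat (some k)).norm.const_mul B hr
    have t3a := ((isBigOp_trainScore h (some k)).const_mul C hr).const_mul B hr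
    have t3b : IsLittleOp P (fun N ω => 2 * |foldShare (fold N ω) k - 1 / K|) (fun _ => 1) :=
      ((h.folds k).norm).const_mul 2 hone
    have t3 := t3a.mul_isLittleOp t3b hr hone
    have t4 := ((isBigOp_residual_third h hW k).mul ((hd k).mul (hd k) hr hr) hone hrr)
    simp only [one_mul, mul_one] at t3 t4
    have t4' := t4.isLittleOp (s := rate Q) (rate_mul_rate_isLittle h)
    simp only [mul_comm (B * _) (2 * _)] at t3
    exact ((t1.add t2 hr).add t3 hr).add t4' hr
  have hsum := IsLittleOp.sum Finset.univ hterm hr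
  refine hsum.of_norm_le (IsNegl.iUnion fun k => isNegl_fit h hghat (some k)) ?_
  filter_upwards [eventually_gt_atTop 0, h.labelProb_pos] with N hN hpos ω hω
  simp only [Set.mem_iUnion, Set.mem_ofPred_eq, not_exists, not_not] at hω
  set z : Fin N → Pt p := fun i => Z N i ω with hz
  set f := fold N ω
  set δ : Fin K → Par p := fun k => mleError Q γ₀ (ghat N) (trainSet f (some k)) (obs (Z N) ω)
  set v := biasVector ν (Q N) (γ₀ N) m μ
  have key := abs_crossfit_expansion_le hN h.two_le f (fun i => aug (z i).2.2)
    (fun i => weightedResidual (Q N) (γ₀ N) W (z i))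
    (fun i => ((z i).1 - logistic (inner ℝ (aug (z i).2.2)
      (shifted (labelProb (Q N)) (γ₀ N)))) • aug (z i).2.2) δ (fun k => (hω k).2.2) v
    (infoInv ν Q γ₀ N)
  have e1 : ∀ i, ((z i).1 / truePS (Q N) (γ₀ N) (z i).2.2 -
      (z i).1 / crossPS (ghat N) f (obs (Z N) ω) i (z i).2.2) * W (z i).2 =
      weightedResidual (Q N) (γ₀ N) W (z i) *
        (1 - Real.exp (-inner ℝ (aug (z i).2.2) (δ (f i)))) := by
    intro i
    have h1 := one_sub_truePS_div_fittedPS (γ₀ := γ₀) (ghat := ghat N) hpos (hω (f i)).2.1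
      (z i).2.2
    have hπ := truePS_pos (γ₀ := γ₀) hpos (z i).2.2
    rw [weightedResidual]
    calc _ = (z i).1 * (truePS (Q N) (γ₀ N) (z i).2.2)⁻¹ * (1 - truePS (Q N) (γ₀ N) (z i).2.2 /
          fittedPS (ghat N) (trainSet f (some (f i))) (obs (Z N) ω) (z i).2.2) * W (z i).2 := by
          rw [crossPS]
          field_simp
      _ = _ := by rw [h1]; ring
  have e2 : (N : ℝ)⁻¹ * ∑ i, ifPi ν (Q N) (γ₀ N) m μ (z i) =
      inner ℝ v (infoInv ν Q γ₀ N ((N : ℝ)⁻¹ • ∑ i, ((z i).1 - logistic (inner ℝ (aug (z i).2.2)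
      (shifted (labelProb (Q N)) (γ₀ N)))) • aug (z i).2.2)) := by
    rw [map_smul, map_sum, real_inner_smul_right, inner_sum]
    congr 1
    refine Finset.sum_congr rfl fun i _ => ?_
    rw [map_smul, real_inner_smul_right, ifPi, truePS_eq_shifted hpos, mul_comm]
    rfl
  have e3 : ∑ i, ((z i).1 / truePS (Q N) (γ₀ N) (z i).2.2 -
      (z i).1 / crossPS (ghat N) f (obs (Z N) ω) i (z i).2.2) * W (z i).2 =
      ∑ i, weightedResidual (Q N) (γ₀ N) W (z i) *
        (1 - Real.exp (-inner ℝ (aug (z i).2.2) (δ (f i)))) :=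
    Finset.sum_congr rfl fun i _ => e1 i
  change ‖(N : ℝ)⁻¹ * ∑ i, ((z i).1 / truePS (Q N) (γ₀ N) (z i).2.2 -
      (z i).1 / crossPS (ghat N) f (obs (Z N) ω) i (z i).2.2) * W (z i).2 -
      (N : ℝ)⁻¹ * ∑ i, ifPi ν (Q N) (γ₀ N) m μ (z i)‖ ≤ _
  rw [e3, e2, Real.norm_eq_abs]
  refine key.trans (le_trans (Finset.sum_le_sum fun k _ => ?_) (le_abs_self _))
  have hv : ‖v‖ ≤ B := hB N
  have hL := norm_infoInv_le h hpos (trainScore Q γ₀ (trainSet f (some k)) z)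
  refine add_le_add (add_le_add (add_le_add le_rfl ?_) ?_) le_rfl
  · exact mul_le_mul_of_nonneg_right hv (norm_nonneg _)
  · exact mul_le_mul_of_nonneg_left (mul_le_mul hv hL (norm_nonneg _) hB0) (by positivity)

end Expansion

/-! ### Outcome residuals -/

section Residuals

variable {p K : ℕ} {ν : Measure (ℝ × Cov p)} [IsProbabilityMeasure ν] {Q : ℕ → Measure (Pt p)}
  [∀ N, IsProbabilityMeasure (Q N)] {γ₀ : ℕ → Par p} {C : ℝ} {Ω : ℕ → Type*}
  [∀ N, MeasurableSpace (Ω N)] {P : ∀ N, Measure (Ω N)} [∀ N, IsProbabilityMeasure (P N)]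
  {Z : ∀ N, Fin N → Ω N → Pt p} {fold : ∀ N, Ω N → Fin N → Fin K}
  {m μ : Cov p → ℝ}

/-- The choice W = μ - m, for the bias term; the weighted moments come from Hölder's inequality
against the envelope. -/
theorem isOutcomeResidual_sub (h : Regime ν Q γ₀ C P Z fold) (hm : Measurable m)
    (hμ : Measurable μ) {c : ℝ} (hc : 0 < c)
    (hmem : MemLp (fun x => m x - μ x) (ENNReal.ofReal (2 + c)) ν.snd) :
    IsOutcomeResidual ν m μ (fun w => μ w.2 - m w.2) where
  measurable := by fun_prop
  moments t := by
    obtain ⟨B, hB, hle⟩ := lintegral_env_mul_sq_le h t hc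
    have h1 := hle (fun x => m x - μ x) (by fun_prop)
    rw [Measure.snd, lintegral_map (by fun_prop) measurable_snd] at h1
    simp only [← enorm_neg (m _ - μ _), neg_sub] at h1
    exact ne_top_of_le_ne_top (ENNReal.mul_ne_top (by simp) (ENNReal.pow_ne_top hmem.2.ne)) h1
  mean φ t hφ _ := by
    rw [Measure.snd, integral_map measurable_snd.aemeasurable
      (Measurable.aestronglyMeasurable (by fun_prop))]

theorem measurable_snd_sigmaX' : Measurable[sigmaX' p] (fun w : ℝ × Cov p => w.2) :=
  comap_measurable _

theorem sigmaX'_le : sigmaX' p ≤ (inferInstance : MeasurableSpace (ℝ × Cov p)) :=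
  Measurable.comap_le measurable_snd

/-- Weighted second moments of a variable with bounded conditional second moment. -/
theorem lintegral_mul_sq_le_of_condExp_le {W : ℝ × Cov p → ℝ} (hW : Measurable W)
    (hint : Integrable (fun w => W w ^ 2) ν) {σ : ℝ}
    (hσ : ν[fun w => W w ^ 2 | sigmaX' p] ≤ᵐ[ν] fun _ => σ ^ 2)
    {φ : Cov p → ℝ≥0∞} (hφ : Measurable φ) :
    ∫⁻ w, φ w.2 * ‖W w‖ₑ ^ 2 ∂ν ≤ ENNReal.ofReal (σ ^ 2) * ∫⁻ x, φ x ∂ν.snd := by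
  -- The conditional bound says that the X-marginal of W² ν is at most σ² times that of ν. As a
  -- domination of measures it applies to every nonnegative weight, with no integrability condition.
  have hle : (ν.withDensity fun w => ‖W w‖ₑ ^ 2).map Prod.snd ≤
      ENNReal.ofReal (σ ^ 2) • ν.snd := by
    refine Measure.le_iff.2 fun A hA => ?_
    have hA' : MeasurableSet (Prod.snd ⁻¹' A : Set (ℝ × Cov p)) := measurable_snd hA
    rw [Measure.map_apply measurable_snd hA, withDensity_apply _ hA', Measure.smul_apply,
      Measure.snd_apply hA, smul_eq_mul]
    have h1 : ∫⁻ w in Prod.snd ⁻¹' A, ‖W w‖ₑ ^ 2 ∂ν =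
        ENNReal.ofReal (∫ w in Prod.snd ⁻¹' A, W w ^ 2 ∂ν) := by
      rw [ofReal_integral_eq_lintegral_ofReal hint.integrableOn
        (Eventually.of_forall fun w => sq_nonneg _)]
      refine lintegral_congr fun w => ?_
      rw [← enorm_pow, Real.enorm_of_nonneg (sq_nonneg _)]
    have h2 : ∫ w in Prod.snd ⁻¹' A, W w ^ 2 ∂ν ≤ σ ^ 2 * ν.real (Prod.snd ⁻¹' A) := by
      rw [← setIntegral_condExp sigmaX'_le hint (measurable_snd_sigmaX' hA)]
      calc _ ≤ ∫ w in Prod.snd ⁻¹' A, σ ^ 2 ∂ν :=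
            setIntegral_mono_ae integrable_condExp.integrableOn integrableOn_const hσ
        _ = _ := by rw [setIntegral_const, smul_eq_mul, mul_comm]
    rw [h1]
    calc _ ≤ ENNReal.ofReal (σ ^ 2 * ν.real (Prod.snd ⁻¹' A)) := ENNReal.ofReal_le_ofReal h2
      _ = _ := by
        rw [ENNReal.ofReal_mul (sq_nonneg _), ofReal_measureReal]
  calc ∫⁻ w, φ w.2 * ‖W w‖ₑ ^ 2 ∂ν
      = ∫⁻ x, φ x ∂((ν.withDensity fun w => ‖W w‖ₑ ^ 2).map Prod.snd) := by
        rw [lintegral_map hφ measurable_snd,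
          lintegral_withDensity_eq_lintegral_mul _ (by fun_prop) (by fun_prop)]
        simp only [Pi.mul_apply, mul_comm]
    _ ≤ ∫⁻ x, φ x ∂(ENNReal.ofReal (σ ^ 2) • ν.snd) := lintegral_mono' hle le_rfl
    _ = _ := by rw [lintegral_smul_measure, smul_eq_mul]

/-- Conditional expectation contracts L², so m(X) is square integrable, and μ differs from m by a
function in L^(2+c), which is contained in L². -/
theorem memLp_comp_snd_of_condExp (hm : Measurable m)
    (hcond : ν[fun w : ℝ × Cov p => w.1 | sigmaX' p] =ᵐ[ν] fun w => m w.2)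
    (hY2 : MemLp (fun w : ℝ × Cov p => w.1) 2 ν) (hμ : Measurable μ) {c : ℝ} (hc : 0 < c)
    (hmem : MemLp (fun x => m x - μ x) (ENNReal.ofReal (2 + c)) ν.snd) :
    MemLp (fun w : ℝ × Cov p => μ w.2) 2 ν := by
  have h1 : MemLp (fun w : ℝ × Cov p => m w.2) 2 ν :=
    (memLp_congr_ae hcond).1 (hY2.condExp (by norm_num))
  have h2 : MemLp (fun x => m x - μ x) 2 ν.snd := by
    refine hmem.mono_exponent ?_
    rw [show (2 : ℝ≥0∞) = ENNReal.ofReal 2 by simp]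
    exact ENNReal.ofReal_le_ofReal (by linarith)
  have h3 : MemLp (fun w : ℝ × Cov p => m w.2 - μ w.2) 2 ν :=
    (memLp_map_measure_iff (Measurable.aestronglyMeasurable (by fun_prop))
      measurable_snd.aemeasurable).1 h2
  refine (h1.sub h3).ae_eq (Eventually.of_forall fun w => ?_)
  simp

/-- The choice W = μ - Y, for the doubly robust estimator. The bounded conditional second moment
gives all envelope-weighted moments, and conditioning on X replaces Y by m. -/
theorem isOutcomeResidual_outcome (h : Regime ν Q γ₀ C P Z fold) (hm : Measurable m)
    (hcond : ν[fun w : ℝ × Cov p => w.1 | sigmaX' p] =ᵐ[ν] fun w => m w.2)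
    (hY2 : MemLp (fun w : ℝ × Cov p => w.1) 2 ν) (hμ : Measurable μ)
    (hμ2 : MemLp (fun w : ℝ × Cov p => μ w.2) 2 ν) {σ : ℝ}
    (hσ : ν[fun w : ℝ × Cov p => (w.1 - μ w.2) ^ 2 | sigmaX' p] ≤ᵐ[ν] fun _ => σ ^ 2) :
    IsOutcomeResidual ν m μ (fun w => μ w.2 - w.1) := by
  have hW2 : MemLp (fun w : ℝ × Cov p => μ w.2 - w.1) 2 ν := hμ2.sub hY2
  have hWint : Integrable (fun w : ℝ × Cov p => μ w.2 - w.1) ν := hW2.integrable (by norm_num)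
  have hWm : Measurable fun w : ℝ × Cov p => μ w.2 - w.1 := by fun_prop
  have hσ' : ν[fun w : ℝ × Cov p => (μ w.2 - w.1) ^ 2 | sigmaX' p] ≤ᵐ[ν] fun _ => σ ^ 2 := by
    have : (fun w : ℝ × Cov p => (μ w.2 - w.1) ^ 2) = fun w => (w.1 - μ w.2) ^ 2 := by
      ext w; ring
    rwa [this]
  have hmom : ∀ t : ℝ, ∫⁻ w, ENNReal.ofReal (env t w.2) * ‖μ w.2 - w.1‖ₑ ^ 2 ∂ν ≠ ∞ := by
    intro t
    refine ne_top_of_le_ne_top ?_ (lintegral_mul_sq_le_of_condExp_le hWm hW2.integrable_sq hσ'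
      (φ := fun x => ENNReal.ofReal (env t x)) (by fun_prop))
    rw [lintegral_env h]
    exact ENNReal.mul_ne_top (by simp) (by simp)
  refine ⟨hWm, hmom, fun φ t hφ hφt => ?_⟩
  have hcW : ν[fun w : ℝ × Cov p => μ w.2 - w.1 | sigmaX' p] =ᵐ[ν] fun w => μ w.2 - m w.2 := by
    have hμs : ν[fun w : ℝ × Cov p => μ w.2 | sigmaX' p] = fun w => μ w.2 :=
      condExp_of_stronglyMeasurable sigmaX'_le
        (hμ.comp measurable_snd_sigmaX').stronglyMeasurable (hμ2.integrable (by norm_num))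
    refine (condExp_sub (hμ2.integrable (by norm_num)) (hY2.integrable (by norm_num)) _).trans ?_
    filter_upwards [hcond] with w hw
    rw [Pi.sub_apply, hw, hμs]
  have hφ2 : MemLp (fun w : ℝ × Cov p => φ w.2 * (μ w.2 - w.1)) 2 ν := by
    refine memLp_two_of_lintegral_lt_top (by fun_prop)
      (lt_of_le_of_lt (lintegral_mono fun w => ?_) (hmom (2 * t)).lt_top)
    rw [enorm_mul, mul_pow]
    gcongr
    rw [← enorm_pow, Real.enorm_of_nonneg (sq_nonneg _), ← sq_abs]
    refine ENNReal.ofReal_le_ofReal ?_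
    calc |φ w.2| ^ 2 ≤ env t w.2 ^ 2 := by gcongr; exact hφt _
      _ = _ := by rw [env_pow]; norm_num
  have hprod : ν[fun w : ℝ × Cov p => φ w.2 * (μ w.2 - w.1) | sigmaX' p] =ᵐ[ν]
      fun w => φ w.2 * (μ w.2 - m w.2) := by
    have := condExp_mul_of_stronglyMeasurable_left (μ := ν) (m := sigmaX' p)
      (f := fun w : ℝ × Cov p => φ w.2) (g := fun w : ℝ × Cov p => μ w.2 - w.1)
      (hφ.comp measurable_snd_sigmaX').stronglyMeasurable (hφ2.integrable (by norm_num)) hWint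
    refine this.trans ?_
    filter_upwards [hcW] with w hw
    rw [Pi.mul_apply, hw]
  rw [← integral_condExp sigmaX'_le, integral_congr_ae hprod, Measure.snd,
    integral_map measurable_snd.aemeasurable (Measurable.aestronglyMeasurable (by fun_prop))]

end Residuals

/-! ### Cross-fitted averages of estimated functions -/

section CrossFit

variable {p K : ℕ} {ν : Measure (ℝ × Cov p)} [IsProbabilityMeasure ν] {Q : ℕ → Measure (Pt p)}
  [∀ N, IsProbabilityMeasure (Q N)] {γ₀ : ℕ → Par p} {C : ℝ} {Ω : ℕ → Type*}
  [∀ N, MeasurableSpace (Ω N)] {P : ∀ N, Measure (Ω N)} [∀ N, IsProbabilityMeasure (P N)]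
  {Z : ∀ N, Fin N → Ω N → Pt p} {fold : ∀ N, Ω N → Fin N → Fin K}
  {D : ∀ N, Finset (Fin N) → (Fin N → Pt p) → Cov p → ℝ}

/-- A functional of the held-out fold and of a function estimated from the other folds is
negligible when its conditional moments are small for small functions. -/
theorem isLittleOp_crossfit (h : Regime ν Q γ₀ C P Z fold) (hD : ∀ N, IsOutcomeEstimator (D N))
    (k : Fin K) (t : ℝ)
    (hlim : IsLittleOp P (fun N ω => ∫⁻ x, ENNReal.ofReal (env t x) *
      ‖D N (trainSet (fold N ω) (some k)) (fun i => Z N i ω) x‖ₑ ^ 2 ∂ν.snd) (fun _ => 1))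
    {r : ℕ → ℝ} (hr : ∀ᶠ N in atTop, 0 < r N) {c : ℝ} {j : ℕ}
    (hj : j ≠ 0)
    {G : ∀ N, Finset (Fin N) → (Cov p → ℝ) → (Fin N → Pt p) → ℝ}
    (hG : ∀ N I T, Measurable fun z => G N I (D N T z) z)
    (hdep : ∀ N I φ z z', (∀ i ∈ I, z i = z' i) → G N I φ z = G N I φ z')
    (hle : ∀ η : ℝ, 0 < η → ∃ η' : ℝ, 0 < η' ∧ ∀ᶠ N in atTop, ∀ I φ, Measurable φ →
      ∫⁻ x, ENNReal.ofReal (env t x) * ‖φ x‖ₑ ^ 2 ∂ν.snd ≤ ENNReal.ofReal η' →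
      ∫⁻ z, ‖G N I φ z‖ₑ ^ j ∂(Measure.pi fun _ => Q N) ≤ ENNReal.ofReal (c * η * r N ^ j)) :
    IsLittleOp P (fun N ω => G N (Finset.univ.filter fun i => fold N ω i = k)
      (D N (trainSet (fold N ω) (some k)) (fun i => Z N i ω)) (fun i => Z N i ω)) r := by
  classical
  set S : ∀ N, (Fin N → Fin K) → (Fin N → Pt p) → ℝ≥0∞ := fun N f z =>
    ∫⁻ x, ENNReal.ofReal (env t x) * ‖D N (trainSet f (some k)) z x‖ₑ ^ 2 ∂ν.snd with hS
  have hSm : ∀ N f, Measurable (S N f) := by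
    intro N f
    refine Measurable.lintegral_prod_right' (f := fun q : (Fin N → Pt p) × Cov p =>
      ENNReal.ofReal (env t q.2) * ‖D N (trainSet f (some k)) q.1 q.2‖ₑ ^ 2) ?_
    have := (hD N (trainSet f (some k))).2
    fun_prop
  refine isLittleOp_of_trunc h.sample (U := fun N f z =>
    G N (Finset.univ.filter fun i => f i = k) (D N (trainSet f (some k)) z) z) hr (c := c) j
    fun η hη => ?_
  obtain ⟨η', hη', hN⟩ := hle η hη
  -- The truncation keeps the functional only where the estimated function is small; by `hlim` it
  -- acts with vanishing probability.
  refine ⟨fun N f => {z | S N f z ≤ ENNReal.ofReal η'}.indicator fun z =>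
    G N (Finset.univ.filter fun i => f i = k) (D N (trainSet f (some k)) z) z,
    fun N f => (hG N _ _).indicator (measurableSet_le (hSm N f) measurable_const), ?_, ?_⟩
  · refine (hlim.isNegl hη').mono' (Eventually.of_forall fun N ω hω => ?_)
    simp only [Set.mem_ofPred_eq, enorm_eq_self, mul_one] at hω ⊢
    by_contra! hcon
    exact hω (Set.indicator_of_mem (s := {z | S N (fold N ω) z ≤ ENNReal.ofReal η'}) hcon _).symm
  · filter_upwards [hN] with N hN f
    set T := trainSet f (some k)
    set I := Finset.univ.filter fun i => f i = k
    have hm : Measurable fun z => ‖{z | S N f z ≤ ENNReal.ofReal η'}.indicator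
        (fun z => G N I (D N T z) z) z‖ₑ ^ j :=
      ((hG N _ _).indicator (measurableSet_le (hSm N f) measurable_const)).enorm.pow_const _
    -- Resampling the held-out coordinates stands for conditioning on the training data: the
    -- estimated function and the truncation depend on z alone, the functional on the fresh z'
    -- alone, and the moment bound applies to a fixed φ.
    rw [lintegral_pi_eq_glue (Q N) T hm]
    calc _ ≤ ∫⁻ _z, ENNReal.ofReal (c * η * r N ^ j) ∂(Measure.pi fun _ : Fin N => Q N) := by
          refine lintegral_mono fun z => ?_
          have hDz : ∀ z', D N T (glue T z z') = D N T z := fun z' =>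
            (hD N T).1 fun i hi => by simp [glue, Finset.mem_coe.1 hi]
          have hSz : ∀ z', S N f (glue T z z') = S N f z := fun z' => by
            simp only [hS]
            rw [hDz]
          have hGz : ∀ z', G N I (D N T z) (glue T z z') = G N I (D N T z) z' := fun z' =>
            hdep _ _ _ _ _ fun i hi => by
              have : i ∉ T := by
                simpa [T, trainSet] using (Finset.mem_filter.1 hi).2
              simp [glue, this]
          by_cases hz : S N f z ≤ ENNReal.ofReal η'
          · refine le_of_eq_of_le (lintegral_congr fun z' => ?_)
              (hN I (D N T z) ((hD N T).2.comp measurable_prodMk_left) hz)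
            rw [Set.indicator_of_mem (by simpa [hSz] using hz), hDz, hGz]
          · refine le_of_eq_of_le (lintegral_congr (g := fun _ => 0) fun z' => ?_) (by simp)
            rw [Set.indicator_of_notMem (by simpa [hSz] using hz)]
            simp [hj]
      _ = _ := by simp

/-- Since R is binary, (1 - R/π)² ≤ 1 + R/π², whose conditional mean is 1 + 1/π. Only one power of
1/π_N is lost. -/
theorem lintegral_ipw_sq_le (h : Regime ν Q γ₀ C P Z fold) {N : ℕ} (hN : 0 < labelProb (Q N))
    {φ : Cov p → ℝ} (hφ : Measurable φ) :
    ∫⁻ z, ‖φ z.2.2 * (1 - z.1 / truePS (Q N) (γ₀ N) z.2.2)‖ₑ ^ 2 ∂(Q N) ≤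
      ENNReal.ofReal (2 * (labelProb (Q N))⁻¹) *
        ∫⁻ x, ENNReal.ofReal (env (C + 1) x) * ‖φ x‖ₑ ^ 2 ∂ν.snd := by
  have hC := h.const_pos
  set π := truePS (Q N) (γ₀ N)
  have hπm : Measurable π := measurable_truePS _ _
  have hπ : ∀ x, 0 < π x := truePS_pos hN
  calc _ ≤ ∫⁻ z, (‖φ z.2.2‖ₑ ^ 2 + ‖z.1‖ₑ * ‖(π z.2.2)⁻¹ * φ z.2.2‖ₑ ^ 2) ∂(Q N) := by
        refine lintegral_mono_ae ?_
        filter_upwards [(h.model N).binary] with z hz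
        rcases hz with hz | hz
        · simp [hz]
        · rw [hz, enorm_one, one_mul, ← enorm_pow, ← enorm_pow, ← enorm_pow,
            Real.enorm_of_nonneg (sq_nonneg _), Real.enorm_of_nonneg (sq_nonneg _),
            Real.enorm_of_nonneg (sq_nonneg _), ← ENNReal.ofReal_add (sq_nonneg _) (sq_nonneg _)]
          refine ENNReal.ofReal_le_ofReal ?_
          have h1 : 0 < (π z.2.2)⁻¹ := inv_pos.2 (hπ _)
          rw [one_div, mul_pow, mul_pow]
          nlinarith [mul_nonneg (sq_nonneg (φ z.2.2)) h1.le]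
    _ = ∫⁻ w, (‖φ w.2‖ₑ ^ 2 + ENNReal.ofReal (π w.2) * ‖(π w.2)⁻¹ * φ w.2‖ₑ ^ 2) ∂ν := by
        rw [lintegral_add_left (by fun_prop), lintegral_add_left (by fun_prop),
          (h.model N).lintegral_snd (φ := fun w => ‖φ w.2‖ₑ ^ 2) (by fun_prop),
          (h.model N).lintegral_label (φ := fun w => ‖(π w.2)⁻¹ * φ w.2‖ₑ ^ 2) (by fun_prop)]
    _ ≤ ∫⁻ w, ENNReal.ofReal (2 * (labelProb (Q N))⁻¹) *
        (ENNReal.ofReal (env (C + 1) w.2) * ‖φ w.2‖ₑ ^ 2) ∂ν := by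
        refine lintegral_mono fun w => ?_
        have h1 := inv_truePS_le_env h hN w.2
        have h2 : 1 ≤ (labelProb (Q N))⁻¹ * env (C + 1) w.2 :=
          one_le_mul_of_one_le_of_one_le ((one_le_inv₀ hN).2 labelProb_le_one)
            (one_le_env (by linarith) _)
        have h3 := hπ w.2
        rw [← enorm_pow, ← enorm_pow, Real.enorm_of_nonneg (sq_nonneg _),
          Real.enorm_of_nonneg (sq_nonneg _), ← ENNReal.ofReal_mul h3.le,
          ← ENNReal.ofReal_add (sq_nonneg _) (by positivity),
          ← ENNReal.ofReal_mul (env_pos _ _).le, ← ENNReal.ofReal_mul (by positivity)]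
        refine ENNReal.ofReal_le_ofReal ?_
        calc _ = (1 + (π w.2)⁻¹) * φ w.2 ^ 2 := by field_simp
          _ ≤ ((labelProb (Q N))⁻¹ * env (C + 1) w.2 + (labelProb (Q N))⁻¹ * env (C + 1) w.2) *
              φ w.2 ^ 2 := by gcongr
          _ = _ := by ring
    _ = _ := by
        rw [lintegral_const_mul _ (by fun_prop), Measure.snd,
          lintegral_map (by fun_prop) measurable_snd]

/-- The integrand is (R - π) times -φ/π, a residual times a function of the covariates; the weighted
moment is there to make φ/π integrable. -/
theorem integral_ipw (h : Regime ν Q γ₀ C P Z fold) {N : ℕ} (hN : 0 < labelProb (Q N))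
    {φ : Cov p → ℝ} (hφ : Measurable φ)
    (hfin : ∫⁻ x, ENNReal.ofReal (env (C + 1) x) * ‖φ x‖ₑ ^ 2 ∂ν.snd ≠ ∞) :
    ∫ z, φ z.2.2 * (1 - z.1 / truePS (Q N) (γ₀ N) z.2.2) ∂(Q N) = 0 := by
  have hint : Integrable (fun x => -((truePS (Q N) (γ₀ N) x)⁻¹ * φ x)) ν.snd := by
    refine ⟨Measurable.aestronglyMeasurable (by fun_prop), ?_⟩
    refine lt_of_le_of_lt (b := ∫⁻ x, ENNReal.ofReal (labelProb (Q N))⁻¹ *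
      (ENNReal.ofReal (env (C + 1) x) + ENNReal.ofReal (env (C + 1) x) * ‖φ x‖ₑ ^ 2) ∂ν.snd)
      (lintegral_mono fun x => ?_) ?_
    · have h1 := inv_truePS_le_env h hN x
      have h3 := truePS_pos (γ₀ := γ₀) hN x
      have h4 := env_pos (C + 1) x
      rw [enorm_neg, ← enorm_pow, Real.enorm_of_nonneg (sq_nonneg _), Real.enorm_eq_ofReal_abs,
        ← ENNReal.ofReal_mul (env_pos _ _).le, ← ENNReal.ofReal_add h4.le (by positivity),
        ← ENNReal.ofReal_mul (by positivity)]
      refine ENNReal.ofReal_le_ofReal ?_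
      rw [abs_mul, abs_of_pos (inv_pos.2 h3)]
      calc _ ≤ ((labelProb (Q N))⁻¹ * env (C + 1) x) * (1 + φ x ^ 2) := by
            gcongr
            rw [← sq_abs]
            nlinarith [sq_nonneg (|φ x| - 1), abs_nonneg (φ x)]
        _ = _ := by ring
    · rw [lintegral_const_mul _ (by fun_prop), lintegral_add_left (by fun_prop), lintegral_env h]
      exact ENNReal.mul_lt_top (by simp) (ENNReal.add_lt_top.2 ⟨by simp, hfin.lt_top⟩)
  rw [← h.integral_residual N (by fun_prop) hint]
  refine integral_congr_ae (Eventually.of_forall fun z => ?_)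
  have h3 := truePS_pos (γ₀ := γ₀) hN z.2.2
  simp only
  field_simp
  ring

theorem IsOutcomeEstimator.measurable_apply {N : ℕ}
    {D : Finset (Fin N) → (Fin N → Pt p) → Cov p → ℝ} (hD : IsOutcomeEstimator D)
    (T : Finset (Fin N)) (i : Fin N) : Measurable fun z : Fin N → Pt p => D T z (z i).2.2 :=
  (hD T).2.comp (measurable_id.prodMk (by fun_prop))

/-- The centred inverse probability weighted average of a small estimated function. -/
theorem isLittleOp_crossfit_ipw (h : Regime ν Q γ₀ C P Z fold)
    (hD : ∀ N, IsOutcomeEstimator (D N)) (k : Fin K)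
    (hlim : IsLittleOp P (fun N ω => ∫⁻ x, ENNReal.ofReal (env (C + 1) x) *
      ‖D N (trainSet (fold N ω) (some k)) (fun i => Z N i ω) x‖ₑ ^ 2 ∂ν.snd) (fun _ => 1)) :
    IsLittleOp P (fun N ω => (N : ℝ)⁻¹ * ∑ i with fold N ω i = k,
      D N (trainSet (fold N ω) (some k)) (fun i => Z N i ω) (Z N i ω).2.2 *
        (1 - (Z N i ω).1 / truePS (Q N) (γ₀ N) (Z N i ω).2.2)) (rate Q) := by
  refine isLittleOp_crossfit h hD k (C + 1) hlim h.rate_pos (c := 2) two_ne_zero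
    (G := fun N I φ z => (N : ℝ)⁻¹ * ∑ i ∈ I, φ (z i).2.2 *
      (1 - (z i).1 / truePS (Q N) (γ₀ N) (z i).2.2)) (fun N I T => ?_) ?_ fun η hη => ⟨η, hη, ?_⟩
  · refine Measurable.const_mul (Finset.measurable_fun_sum _ fun i _ =>
      ((hD N).measurable_apply T i).mul ?_) _
    fun_prop
  · intro N I φ z z' hz
    exact congrArg _ (Finset.sum_congr rfl fun i hi => by rw [hz i hi])
  · filter_upwards [h.labelProb_pos, eventually_gt_atTop 0] with N hpos hN I φ hφ hle
    have hN' : (0 : ℝ) < N := by exact_mod_cast hN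
    have h1 := lintegral_ipw_sq_le h hpos hφ
    have hfin := ne_top_of_le_ne_top ENNReal.ofReal_ne_top hle
    have h2 : ∫⁻ z, ‖φ z.2.2 * (1 - z.1 / truePS (Q N) (γ₀ N) z.2.2)‖ₑ ^ 2 ∂(Q N) ≤
        ENNReal.ofReal (2 * (labelProb (Q N))⁻¹ * η) := by
      rw [ENNReal.ofReal_mul (by positivity)]
      exact h1.trans (by gcongr)
    have hL2 : MemLp (fun z : Pt p => φ z.2.2 * (1 - z.1 / truePS (Q N) (γ₀ N) z.2.2)) 2 (Q N) :=
      memLp_two_of_lintegral_lt_top (by fun_prop) (h2.trans_lt ENNReal.ofReal_lt_top)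
    have h3 := lintegral_pi_sum_sq_le (Q N) hL2 (integral_ipw h hpos hφ hfin) I
    rw [lintegral_congr (g := fun z => ‖(N : ℝ)⁻¹‖ₑ ^ 2 * ‖∑ i ∈ I, φ (z i).2.2 *
      (1 - (z i).1 / truePS (Q N) (γ₀ N) (z i).2.2)‖ₑ ^ 2) fun z => by rw [enorm_mul, mul_pow],
      lintegral_const_mul' _ _ (by simp)]
    have hcard : (I.card : ℝ≥0∞) ≤ ENNReal.ofReal N := by
      rw [ENNReal.ofReal_natCast]
      exact_mod_cast (Finset.card_le_univ I).trans (by simp)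
    calc _ ≤ ENNReal.ofReal ((N : ℝ)⁻¹ ^ 2) * (ENNReal.ofReal N *
          ENNReal.ofReal (2 * (labelProb (Q N))⁻¹ * η)) := by
          rw [← enorm_pow, Real.enorm_of_nonneg (by positivity)]
          gcongr
          exact h3.trans (by gcongr)
      _ = _ := by
          rw [← ENNReal.ofReal_mul (by positivity), ← ENNReal.ofReal_mul (by positivity),
            sq (rate Q N), rate_mul_rate]
          congr 1
          field_simp

/-- The absolute inverse probability weighted average of a small estimated function. -/
theorem isLittleOp_crossfit_abs (h : Regime ν Q γ₀ C P Z fold)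
    (hD : ∀ N, IsOutcomeEstimator (D N)) (k : Fin K)
    (hlim : IsLittleOp P (fun N ω => ∫⁻ x, ENNReal.ofReal (env 4 x) *
      ‖D N (trainSet (fold N ω) (some k)) (fun i => Z N i ω) x‖ₑ ^ 2 ∂ν.snd) (fun _ => 1)) :
    IsLittleOp P (fun N ω => (N : ℝ)⁻¹ * ∑ i with fold N ω i = k,
      |(Z N i ω).1 * ((truePS (Q N) (γ₀ N) (Z N i ω).2.2)⁻¹ * (env 2 (Z N i ω).2.2 *
        D N (trainSet (fold N ω) (some k)) (fun i => Z N i ω) (Z N i ω).2.2))|)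
      (fun _ => 1) := by
  refine isLittleOp_crossfit h hD k 4 hlim (by simp) (c := 2) one_ne_zero
    (G := fun N I φ z => (N : ℝ)⁻¹ * ∑ i ∈ I, |(z i).1 *
      ((truePS (Q N) (γ₀ N) (z i).2.2)⁻¹ * (env 2 (z i).2.2 * φ (z i).2.2))|) (fun N I T => ?_) ?_
    fun η hη => ⟨η ^ 2, by positivity, ?_⟩
  · refine Measurable.const_mul (Finset.measurable_fun_sum _ fun i _ => Measurable.abs ?_) _
    have h1 := (hD N).measurable_apply T i
    have h2 : Measurable fun z : Fin N → Pt p => env 2 (z i).2.2 * D N T z (z i).2.2 :=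
      Measurable.mul (by fun_prop) h1
    exact Measurable.mul (by fun_prop) (Measurable.mul (by fun_prop) h2)
  · intro N I φ z z' hz
    exact congrArg _ (Finset.sum_congr rfl fun i hi => by rw [hz i hi])
  · filter_upwards [h.labelProb_pos, eventually_gt_atTop 0] with N hpos hN I φ hφ hle
    have hN' : (0 : ℝ) < N := by exact_mod_cast hN
    set π := truePS (Q N) (γ₀ N)
    have hπm : Measurable π := measurable_truePS _ _
    have h2 : ∫⁻ z, ‖z.1 * ((π z.2.2)⁻¹ * (env 2 z.2.2 * φ z.2.2))‖ₑ ∂(Q N) ≤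
        ENNReal.ofReal (2 * η) := by
      rw [lintegral_congr (g := fun z : Pt p => ‖z.1‖ₑ *
        ‖(π z.2.2)⁻¹ * (env 2 z.2.2 * φ z.2.2)‖ₑ) fun z => enorm_mul _ _,
        (h.model N).lintegral_label (φ := fun w => ‖(π w.2)⁻¹ * (env 2 w.2 * φ w.2)‖ₑ)
        (by fun_prop)]
      -- The inequality y ≤ η + y²/η takes the place of Cauchy–Schwarz. A weighted second moment of
      -- at most η² then gives 2η, which accounts for the level η² and the constant 2.
      calc _ ≤ ∫⁻ w, (ENNReal.ofReal η + ENNReal.ofReal η⁻¹ *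
            (ENNReal.ofReal (env 4 w.2) * ‖φ w.2‖ₑ ^ 2)) ∂ν := by
            refine lintegral_mono fun w => ?_
            have h3 : 0 < π w.2 := truePS_pos hpos w.2
            have h4 := env_pos 2 w.2
            rw [← enorm_pow, Real.enorm_of_nonneg (sq_nonneg _), Real.enorm_eq_ofReal_abs,
              ← ENNReal.ofReal_mul h3.le, ← ENNReal.ofReal_mul (env_pos _ _).le,
              ← ENNReal.ofReal_mul (by positivity), ← ENNReal.ofReal_add hη.le
                (mul_nonneg (by positivity) (mul_nonneg (env_pos _ _).le (sq_nonneg _)))]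
            refine ENNReal.ofReal_le_ofReal ?_
            have h5 : env 4 w.2 = env 2 w.2 ^ 2 := by rw [env_pow]; norm_num
            rw [abs_mul, abs_of_pos (inv_pos.2 h3), ← mul_assoc, mul_inv_cancel₀ h3.ne', one_mul,
              h5, ← mul_pow, ← sq_abs, inv_mul_eq_div]
            set y := |env 2 w.2 * φ w.2|
            have h6 : 0 ≤ y := abs_nonneg _
            rw [← sub_nonneg]
            have : η + y ^ 2 / η - y = ((η - y) ^ 2 + η * y) / η := by
              field_simp
              ring
            rw [this]
            positivity
        _ = ENNReal.ofReal η + ENNReal.ofReal η⁻¹ *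
            ∫⁻ x, ENNReal.ofReal (env 4 x) * ‖φ x‖ₑ ^ 2 ∂ν.snd := by
            rw [lintegral_add_left (by fun_prop), lintegral_const_mul _ (by fun_prop), Measure.snd,
              lintegral_map (by fun_prop) measurable_snd]
            simp
        _ ≤ ENNReal.ofReal η + ENNReal.ofReal η⁻¹ * ENNReal.ofReal (η ^ 2) := by gcongr
        _ = _ := by
            rw [← ENNReal.ofReal_mul (by positivity), ← ENNReal.ofReal_add hη.le (by positivity)]
            congr 1
            field_simp
            ring
    have h3 := lintegral_pi_sum_abs (Q N)
      (f := fun z : Pt p => ‖z.1 * ((π z.2.2)⁻¹ * (env 2 z.2.2 * φ z.2.2))‖ₑ) (by fun_prop) I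
    have hcard : (I.card : ℝ≥0∞) ≤ ENNReal.ofReal N := by
      rw [ENNReal.ofReal_natCast]
      exact_mod_cast (Finset.card_le_univ I).trans (by simp)
    simp only [pow_one]
    calc _ ≤ ∫⁻ z, ENNReal.ofReal (N : ℝ)⁻¹ * ∑ i ∈ I,
          ‖(z i).1 * ((π (z i).2.2)⁻¹ * (env 2 (z i).2.2 * φ (z i).2.2))‖ₑ
            ∂(Measure.pi fun _ : Fin N => Q N) := by
          refine lintegral_mono fun z => ?_
          rw [enorm_mul, Real.enorm_of_nonneg (by positivity)]
          gcongr
          refine (enorm_sum_le _ _).trans (le_of_eq ?_)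
          simp only [Real.enorm_abs]
      _ ≤ ENNReal.ofReal (N : ℝ)⁻¹ * (ENNReal.ofReal N * ENNReal.ofReal (2 * η)) := by
          rw [lintegral_const_mul' _ _ (by simp), h3]
          gcongr
      _ = _ := by
          rw [← ENNReal.ofReal_mul (by positivity), ← ENNReal.ofReal_mul (by positivity)]
          congr 1
          field_simp

end CrossFit

/-! ### The doubly robust estimator -/

section DoublyRobust

variable {p K : ℕ} {ν : Measure (ℝ × Cov p)} [IsProbabilityMeasure ν] {Q : ℕ → Measure (Pt p)}
  [∀ N, IsProbabilityMeasure (Q N)] {γ₀ : ℕ → Par p} {C : ℝ} {Ω : ℕ → Type*}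
  [∀ N, MeasurableSpace (Ω N)] {P : ∀ N, Measure (Ω N)} [∀ N, IsProbabilityMeasure (P N)]
  {Z : ∀ N, Fin N → Ω N → Pt p} {fold : ∀ N, Ω N → Fin N → Fin K}
  {m μ : Cov p → ℝ}

@[fun_prop]
theorem measurable_observe : Measurable (observe : Pt p → Pt p) := by
  unfold observe
  fun_prop

/-- The error of an outcome estimator, as an estimator based on the unobserved data. -/
theorem IsOutcomeEstimator.sub_comp_observe {N : ℕ}
    {mhat : Finset (Fin N) → (Fin N → Pt p) → Cov p → ℝ} (h : IsOutcomeEstimator mhat)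
    (hμ : Measurable μ) :
    IsOutcomeEstimator fun T z x => mhat T (fun i => observe (z i)) x - μ x := by
  refine fun T => ⟨fun z z' hz => ?_, ?_⟩
  · have := (h T).1 (x := fun i => observe (z i)) (y := fun i => observe (z' i))
      fun i hi => by simp only [hz i hi]
    simp only [this]
  · have h1 : Measurable fun q : (Fin N → Pt p) × Cov p => mhat T (fun i => observe (q.1 i)) q.2 :=
      (h T).2.comp (f := fun q : (Fin N → Pt p) × Cov p => ((fun i => observe (q.1 i)), q.2))
        (by fun_prop)
    exact h1.sub (by fun_prop)

/-- A pointwise identity that isolates three mechanisms: the weighting error applied to μ - Y, the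
outcome error under the true weights, where 1 - R/π is centred, and the product of the two errors.
The centring of the bias expansion is placed with the first. -/
theorem thetaDRSS_decomposition {N : ℕ} (hN : 0 < N) (mh ph : Fin N → Cov p → ℝ)
    (Q : Measure (Pt p)) (γ : Par p) (z : Fin N → Pt p) :
    thetaDRSS mh ph z - theta0 ν - (N : ℝ)⁻¹ * ∑ i, adjustedIF ν Q γ m μ (z i) =
      ((N : ℝ)⁻¹ * ∑ i, ((z i).1 / truePS Q γ (z i).2.2 - (z i).1 / ph i (z i).2.2) *
          (μ (z i).2.2 - (z i).2.1) - (N : ℝ)⁻¹ * ∑ i, ifPi ν Q γ m μ (z i)) +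
        (N : ℝ)⁻¹ * ∑ i, (mh i (z i).2.2 - μ (z i).2.2) *
          (1 - (z i).1 / truePS Q γ (z i).2.2) +
        (N : ℝ)⁻¹ * ∑ i, (mh i (z i).2.2 - μ (z i).2.2) *
          ((z i).1 / truePS Q γ (z i).2.2 - (z i).1 / ph i (z i).2.2) := by
  have hN' : (N : ℝ) ≠ 0 := by exact_mod_cast hN.ne'
  have h0 : theta0 ν = (N : ℝ)⁻¹ * ∑ _i : Fin N, theta0 ν := by
    rw [Finset.sum_const, Finset.card_univ, Fintype.card_fin, nsmul_eq_mul]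
    field_simp
  rw [thetaDRSS, h0]
  simp only [← mul_add, ← mul_sub, ← Finset.sum_add_distrib, ← Finset.sum_sub_distrib]
  congr 1
  refine Finset.sum_congr rfl fun i _ => ?_
  rw [adjustedIF, psi]
  ring

/-- The cross-fitted doubly robust estimator is asymptotically linear. -/
theorem isLittleOp_thetaDRSS (h : Regime ν Q γ₀ C P Z fold)
    {ghat : ∀ N, Finset (Fin N) → (Fin N → Pt p) → Par p} (hghat : ∀ N, IsOffsetMLE (ghat N))
    {mhat : ∀ N, Finset (Fin N) → (Fin N → Pt p) → Cov p → ℝ}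
    (hmhat : ∀ N, IsOutcomeEstimator (mhat N)) (hμ : Measurable μ)
    (hW : IsOutcomeResidual ν m μ fun w => μ w.2 - w.1) {c : ℝ} (hc : 0 < c)
    (hlim : ∀ k : Fin K, IsLittleOp P (fun N ω => eLpNorm
      (fun x => mhat N (trainSet (fold N ω) (some k)) (obs (Z N) ω) x - μ x)
      (ENNReal.ofReal (2 + c)) ν.snd) (fun _ => 1)) :
    IsLittleOp P (fun N ω =>
      thetaDRSS (crossOutcome (mhat N) (fold N ω) (obs (Z N) ω))
          (crossPS (ghat N) (fold N ω) (obs (Z N) ω)) (fun i => Z N i ω) - theta0 ν -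
        (N : ℝ)⁻¹ * ∑ i, adjustedIF ν (Q N) (γ₀ N) m μ (Z N i ω)) (rate Q) := by
  have hr := eventually_rate_nonneg (Q := Q)
  set D : ∀ N, Finset (Fin N) → (Fin N → Pt p) → Cov p → ℝ :=
    fun N T z x => mhat N T (fun i => observe (z i)) x - μ x with hDdef
  have hD : ∀ N, IsOutcomeEstimator (D N) := fun N => (hmhat N).sub_comp_observe hμ
  have hsq : ∀ (t : ℝ) (k : Fin K), IsLittleOp P (fun N ω => ∫⁻ x, ENNReal.ofReal (env t x) *
      ‖D N (trainSet (fold N ω) (some k)) (fun i => Z N i ω) x‖ₑ ^ 2 ∂ν.snd) (fun _ => 1) :=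
    fun t k => isLittleOp_env_sq h t hc
      (fun N ω => ((hD N _).2.comp measurable_prodMk_left)) (hlim k)
  have hA := IsLittleOp.sum Finset.univ
    (fun k => isLittleOp_crossfit_ipw h hD k (hsq (C + 1) k)) hr
  -- The product term is at most ‖δ‖ times an average of R/π · `env 2` · |mhat - μ|. That average
  -- tends to zero in probability, so no rate for the outcome estimator is needed.
  have hB := IsLittleOp.sum Finset.univ (fun k => ((isBigOp_mleError h hghat (some k)).norm).mul_isLittleOp
    (isLittleOp_crossfit_abs h hD k (hsq 4 k)) hr (by simp)) (by simpa using hr)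
  simp only [mul_one] at hB
  have hB' : IsLittleOp P (fun N ω => (N : ℝ)⁻¹ * ∑ i,
      D N (trainSet (fold N ω) (some (fold N ω i))) (fun i => Z N i ω) (Z N i ω).2.2 *
        ((Z N i ω).1 / truePS (Q N) (γ₀ N) (Z N i ω).2.2 -
          (Z N i ω).1 / crossPS (ghat N) (fold N ω) (obs (Z N) ω) i (Z N i ω).2.2)) (rate Q) := by
    refine hB.of_norm_le (IsNegl.iUnion fun k => isNegl_fit h hghat (some k)) ?_
    filter_upwards [h.labelProb_pos] with N hpos ω hω
    simp only [Set.mem_iUnion, Set.mem_ofPred_eq, not_exists, not_not] at hω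
    rw [Real.norm_eq_abs, ← Finset.sum_fiberwise Finset.univ (fold N ω), Finset.mul_sum]
    refine ((Finset.abs_sum_le_sum_abs _ _).trans (Finset.sum_le_sum fun k _ => ?_)).trans
      (le_abs_self _)
    rw [abs_mul, abs_of_nonneg (by positivity : 0 ≤ (N : ℝ)⁻¹), mul_left_comm, Finset.mul_sum]
    refine mul_le_mul_of_nonneg_left ((Finset.abs_sum_le_sum_abs _ _).trans
      (Finset.sum_le_sum fun i hi => ?_)) (by positivity)
    rw [(Finset.mem_filter.1 hi).2]
    set x := (Z N i ω).2.2
    set e := mleError Q γ₀ (ghat N) (trainSet (fold N ω) (some k)) (obs (Z N) ω)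
    have h1 := abs_one_sub_truePS_div_le hpos (hω k).2.1 (hω k).2.2 x
    have hπ := truePS_pos (γ₀ := γ₀) hpos x
    have h2 : (Z N i ω).1 / truePS (Q N) (γ₀ N) x -
        (Z N i ω).1 / crossPS (ghat N) (fold N ω) (obs (Z N) ω) i x =
        (Z N i ω).1 * (truePS (Q N) (γ₀ N) x)⁻¹ * (1 - truePS (Q N) (γ₀ N) x /
          fittedPS (ghat N) (trainSet (fold N ω) (some k)) (obs (Z N) ω) x) := by
      rw [crossPS, (Finset.mem_filter.1 hi).2]
      field_simp
    rw [h2]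
    simp only [abs_mul]
    rw [abs_of_pos (env_pos 2 x)]
    calc _ ≤ |D N (trainSet (fold N ω) (some k)) (fun i => Z N i ω) x| *
          (|(Z N i ω).1| * |(truePS (Q N) (γ₀ N) x)⁻¹| * (‖e‖ * env 2 x)) := by gcongr
      _ = _ := by ring
  have hA' : IsLittleOp P (fun N ω => (N : ℝ)⁻¹ * ∑ i,
      D N (trainSet (fold N ω) (some (fold N ω i))) (fun i => Z N i ω) (Z N i ω).2.2 *
        (1 - (Z N i ω).1 / truePS (Q N) (γ₀ N) (Z N i ω).2.2)) (rate Q) := by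
    refine hA.of_norm_le IsNegl.empty (Eventually.of_forall fun N ω _ => le_of_eq ?_)
    rw [← Finset.sum_fiberwise Finset.univ (fold N ω), Finset.mul_sum]
    refine congrArg _ (Finset.sum_congr rfl fun k _ => ?_)
    refine congrArg _ (Finset.sum_congr rfl fun i hi => ?_)
    rw [(Finset.mem_filter.1 hi).2]
  refine (((isLittleOp_expansion h hghat hW).add hA' hr).add hB' hr).of_norm_le IsNegl.empty ?_
  filter_upwards [eventually_gt_atTop 0] with N hN ω _
  rw [thetaDRSS_decomposition hN]
  rfl

/-! #### Moments of the adjusted influence function -/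

@[fun_prop]
theorem measurable_ifPi (ν : Measure (ℝ × Cov p)) (Q : Measure (Pt p)) (γ : Par p)
    (m μ : Cov p → ℝ) : Measurable (ifPi ν Q γ m μ) := by
  unfold ifPi
  fun_prop

theorem abs_inner_infoInv_le (h : Regime ν Q γ₀ C P Z fold) {N : ℕ} (hN : 0 < labelProb (Q N))
    (v : Par p) (x : Cov p) :
    |inner ℝ v (infoInv ν Q γ₀ N (aug x))| ≤ ‖v‖ * (C * (labelProb (Q N))⁻¹) * env 1 x := by
  have hC := h.const_pos
  calc _ ≤ ‖v‖ * ‖infoInv ν Q γ₀ N (aug x)‖ := abs_real_inner_le_norm _ _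
    _ ≤ ‖v‖ * (C * ((labelProb (Q N))⁻¹ * env 1 x)) := by
        gcongr
        refine (norm_infoInv_le h hN _).trans ?_
        gcongr
        exact norm_aug_le_env x
    _ = _ := by ring

theorem integral_ifPi (h : Regime ν Q γ₀ C P Z fold) {N : ℕ} (hN : 0 < labelProb (Q N)) :
    ∫ z, ifPi ν (Q N) (γ₀ N) m μ z ∂(Q N) = 0 := by
  set v := biasVector ν (Q N) (γ₀ N) m μ
  have hint : Integrable (fun x => inner ℝ v (infoInv ν Q γ₀ N (aug x))) ν.snd := by
    refine ((integrable_env h.exp_moments 1).const_mul (‖v‖ * (C * (labelProb (Q N))⁻¹))).mono'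
      (Measurable.aestronglyMeasurable (by fun_prop)) (Eventually.of_forall fun x => ?_)
    exact abs_inner_infoInv_le h hN v x
  rw [← h.integral_residual N (by fun_prop) hint]
  refine integral_congr_ae (Eventually.of_forall fun z => ?_)
  exact mul_comm _ _

/-- J⁻¹ is of order 1/π_N while R - π has second moment of order π_N, so the square is of order
1/π_N. -/
theorem exists_lintegral_ifPi_sq_le (h : Regime ν Q γ₀ C P Z fold) {W : ℝ × Cov p → ℝ}
    (hW : IsOutcomeResidual ν m μ W) :
    ∃ B : ℝ, 0 ≤ B ∧ ∀ N, 0 < labelProb (Q N) →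
      ∫⁻ z, ‖ifPi ν (Q N) (γ₀ N) m μ z‖ₑ ^ 2 ∂(Q N) ≤ ENNReal.ofReal (B * (labelProb (Q N))⁻¹) := by
  obtain ⟨B, hB0, hB⟩ := exists_norm_biasVector_le h hW
  have hC := h.const_pos
  have he := integral_env_pos h (2 * (C + 1) + C)
  -- The added 1 keeps M positive when B = 0, so that dividing by M normalizes `ifPi` to the form
  -- required by `lintegral_sq_le`.
  set M := B * C + 1
  have hM : 0 < M := by positivity
  refine ⟨M ^ 2 * (4 * ∫ x, env (2 * (C + 1) + C) x ∂ν.snd), by positivity, fun N hN => ?_⟩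
  have h1 := h.lintegral_sq_le hN (t := C + 1)
    (F := fun z => M⁻¹ * ifPi ν (Q N) (γ₀ N) m μ z) fun z => ?_
  · calc ∫⁻ z, ‖ifPi ν (Q N) (γ₀ N) m μ z‖ₑ ^ 2 ∂(Q N)
        = ∫⁻ z, ENNReal.ofReal (M ^ 2) * ‖M⁻¹ * ifPi ν (Q N) (γ₀ N) m μ z‖ₑ ^ 2 ∂(Q N) := by
          refine lintegral_congr fun z => ?_
          rw [← enorm_pow, ← enorm_pow, Real.enorm_of_nonneg (sq_nonneg _),
            Real.enorm_of_nonneg (sq_nonneg _), ← ENNReal.ofReal_mul (by positivity)]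
          congr 1
          field_simp
      _ ≤ ENNReal.ofReal (M ^ 2) * ENNReal.ofReal (4 * (∫ x, env (2 * (C + 1) + C) x ∂ν.snd) /
            labelProb (Q N)) := by
          rw [lintegral_const_mul' _ _ (by simp)]
          gcongr
      _ = _ := by
          rw [← ENNReal.ofReal_mul (by positivity)]
          congr 1
          ring
  · set a := labelProb (Q N)
    set x := z.2.2
    have h2 := abs_inner_infoInv_le h hN (biasVector ν (Q N) (γ₀ N) m μ) x
    have h3 : |z.1 - truePS (Q N) (γ₀ N) x| ≤ |z.1| + a * env C x := by
      refine (abs_sub _ _).trans (add_le_add le_rfl ?_)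
      rw [abs_of_nonneg (truePS_nonneg x)]
      exact truePS_le_env h hN x
    have e1 := env_pos 1 x
    have e2 := env_pos C x
    have h4 : |ifPi ν (Q N) (γ₀ N) m μ z| ≤ M * a⁻¹ * env 1 x * (|z.1| + a * env C x) := by
      rw [ifPi, abs_mul]
      refine mul_le_mul (h2.trans (mul_le_mul_of_nonneg_right ?_ e1.le)) h3 (abs_nonneg _)
        (by positivity)
      calc _ ≤ B * (C * a⁻¹) := by gcongr; exact hB N
        _ = B * C * a⁻¹ := by ring
        _ ≤ M * a⁻¹ := by gcongr; simp [M]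
    rw [abs_mul, abs_of_pos (inv_pos.2 hM)]
    calc _ ≤ M⁻¹ * (M * a⁻¹ * env 1 x * (|z.1| + a * env C x)) := by gcongr
      _ = a⁻¹ * |z.1| * env 1 x + env 1 x * env C x := by field_simp
      _ ≤ _ := by
        rw [env_mul, add_comm 1 C]
        gcongr
        exact env_mono (by linarith) x

theorem lintegral_ipw_residual_sq_le (h : Regime ν Q γ₀ C P Z fold) {W : ℝ × Cov p → ℝ}
    (hW : Measurable W) {N : ℕ} (hN : 0 < labelProb (Q N)) :
    ∫⁻ z, ‖z.1 / truePS (Q N) (γ₀ N) z.2.2 * W z.2‖ₑ ^ 2 ∂(Q N) ≤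
      ENNReal.ofReal (labelProb (Q N))⁻¹ *
        ∫⁻ w, ENNReal.ofReal (env (C + 1) w.2) * ‖W w‖ₑ ^ 2 ∂ν := by
  set π := truePS (Q N) (γ₀ N)
  have hπm : Measurable π := measurable_truePS _ _
  have h1 : ∫⁻ z, ‖z.1 / π z.2.2 * W z.2‖ₑ ^ 2 ∂(Q N) =
      ∫⁻ z, ‖z.1‖ₑ * ‖(π z.2.2)⁻¹ * W z.2‖ₑ ^ 2 ∂(Q N) := by
    refine lintegral_congr_ae ?_
    filter_upwards [(h.model N).binary] with z hz
    rcases hz with hz | hz <;> simp [hz]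
  rw [h1, (h.model N).lintegral_label (φ := fun w => ‖(π w.2)⁻¹ * W w‖ₑ ^ 2) (by fun_prop),
    ← lintegral_const_mul' _ _ (by simp)]
  refine lintegral_mono fun w => ?_
  have hπ : 0 < π w.2 := truePS_pos hN w.2
  rw [← enorm_pow, ← enorm_pow, Real.enorm_of_nonneg (sq_nonneg _),
    Real.enorm_of_nonneg (sq_nonneg _), ← ENNReal.ofReal_mul hπ.le,
    ← ENNReal.ofReal_mul (env_pos _ _).le, ← ENNReal.ofReal_mul (by positivity)]
  refine ENNReal.ofReal_le_ofReal ?_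
  calc _ = (π w.2)⁻¹ * W w ^ 2 := by field_simp
    _ ≤ ((labelProb (Q N))⁻¹ * env (C + 1) w.2) * W w ^ 2 := by
        gcongr
        exact inv_truePS_le_env h hN w.2
    _ = _ := by ring

theorem Regime.memLp_snd (h : Regime ν Q γ₀ C P Z fold) (N : ℕ) {φ : ℝ × Cov p → ℝ}
    (hφ : MemLp φ 2 ν) : MemLp (fun z : Pt p => φ z.2) 2 (Q N) := by
  rw [← (h.model N).marginal] at hφ
  exact hφ.comp_of_map measurable_snd.aemeasurable

theorem memLp_ipw_residual (h : Regime ν Q γ₀ C P Z fold) {W : ℝ × Cov p → ℝ}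
    (hW : IsOutcomeResidual ν m μ W) {N : ℕ} (hN : 0 < labelProb (Q N)) :
    MemLp (fun z : Pt p => z.1 / truePS (Q N) (γ₀ N) z.2.2 * W z.2) 2 (Q N) := by
  have hWm := hW.measurable
  exact memLp_two_of_lintegral_lt_top (by fun_prop)
    ((lintegral_ipw_residual_sq_le h hWm hN).trans_lt
      (ENNReal.mul_lt_top (by simp) (hW.moments _).lt_top))

theorem adjustedIF_eq (Q : Measure (Pt p)) (γ : Par p) (z : Pt p) :
    adjustedIF ν Q γ m μ z = (μ z.2.2 - theta0 ν) -
      z.1 / truePS Q γ z.2.2 * (μ z.2.2 - z.2.1) + ifPi ν Q γ m μ z := by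
  rw [adjustedIF, psi]
  ring

/-- Mean zero holds for any μ because the propensity score is correct: inverse weighting integrates
μ - Y to its unweighted mean, which cancels μ - θ₀, and `ifPi` is a residual times a function of X.
-/
theorem integrable_adjustedIF (h : Regime ν Q γ₀ C P Z fold)
    (hμ2 : MemLp (fun w : ℝ × Cov p => μ w.2) 2 ν)
    (hY2 : MemLp (fun w : ℝ × Cov p => w.1) 2 ν)
    (hW : IsOutcomeResidual ν m μ fun w => μ w.2 - w.1) (hμ : Measurable μ) {N : ℕ}
    (hN : 0 < labelProb (Q N)) :
    Integrable (adjustedIF ν (Q N) (γ₀ N) m μ) (Q N) ∧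
      ∫ z, adjustedIF ν (Q N) (γ₀ N) m μ z ∂(Q N) = 0 := by
  have hWm := hW.measurable
  obtain ⟨B, _, hB⟩ := exists_lintegral_ifPi_sq_le h hW
  have i1 : Integrable (fun z : Pt p => μ z.2.2 - theta0 ν) (Q N) :=
    ((h.memLp_snd N hμ2).integrable (by norm_num)).sub (integrable_const _)
  have i2 := (memLp_ipw_residual h hW hN).integrable (by norm_num)
  have i3 : Integrable (ifPi ν (Q N) (γ₀ N) m μ) (Q N) :=
    (memLp_two_of_lintegral_lt_top (by fun_prop)
      ((hB N hN).trans_lt ENNReal.ofReal_lt_top)).integrable (by norm_num)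
  have e2 : ∫ z, z.1 / truePS (Q N) (γ₀ N) z.2.2 * (μ z.2.2 - z.2.1) ∂(Q N) =
      (∫ w, μ w.2 ∂ν) - theta0 ν := by
    have h1 : ∀ z : Pt p, z.1 / truePS (Q N) (γ₀ N) z.2.2 * (μ z.2.2 - z.2.1) =
        z.1 * ((truePS (Q N) (γ₀ N) z.2.2)⁻¹ * (μ z.2.2 - z.2.1)) := fun z => by ring
    rw [integral_congr_ae (Eventually.of_forall h1), (h.model N).integral_label
      (φ := fun w => (truePS (Q N) (γ₀ N) w.2)⁻¹ * (μ w.2 - w.1)) (by fun_prop), theta0,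
      ← integral_sub (hμ2.integrable (by norm_num)) (hY2.integrable (by norm_num))]
    refine integral_congr_ae (Eventually.of_forall fun w => ?_)
    exact mul_inv_cancel_left₀ (truePS_pos hN w.2).ne' _
  have e1 : ∫ z : Pt p, (μ z.2.2 - theta0 ν) ∂(Q N) = (∫ w, μ w.2 ∂ν) - theta0 ν := by
    rw [(h.model N).integral_snd (φ := fun w => μ w.2 - theta0 ν) (by fun_prop),
      integral_sub (hμ2.integrable (by norm_num)) (integrable_const _)]
    simp
  have heq := adjustedIF_eq (ν := ν) (m := m) (μ := μ) (Q N) (γ₀ N)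
  refine ⟨((i1.sub i2).add i3).congr (Eventually.of_forall fun z => (heq z).symm), ?_⟩
  have h12 : Integrable (fun z : Pt p => (μ z.2.2 - theta0 ν) -
      z.1 / truePS (Q N) (γ₀ N) z.2.2 * (μ z.2.2 - z.2.1)) (Q N) := i1.sub i2
  rw [integral_congr_ae (Eventually.of_forall heq), integral_add h12 i3,
    integral_sub i1 i2, integral_ifPi h hN, e1, e2]
  ring

theorem exists_integral_adjustedIF_sq_le (h : Regime ν Q γ₀ C P Z fold)
    (hμ2 : MemLp (fun w : ℝ × Cov p => μ w.2) 2 ν)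
    (hW : IsOutcomeResidual ν m μ fun w => μ w.2 - w.1) (hμ : Measurable μ) :
    ∃ B : ℝ, ∀ N, 0 < labelProb (Q N) →
      MemLp (adjustedIF ν (Q N) (γ₀ N) m μ) 2 (Q N) ∧
        ∫ z, adjustedIF ν (Q N) (γ₀ N) m μ z ^ 2 ∂(Q N) ≤ B * (labelProb (Q N))⁻¹ := by
  have hWm := hW.measurable
  obtain ⟨B, hB0, hB⟩ := exists_lintegral_ifPi_sq_le h hW
  have hμ3 : MemLp (fun w : ℝ × Cov p => μ w.2 - theta0 ν) 2 ν := hμ2.sub (memLp_const _)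
  set c₁ := (∫⁻ w, ‖μ w.2 - theta0 ν‖ₑ ^ 2 ∂ν).toReal
  set c₂ := (∫⁻ w, ENNReal.ofReal (env (C + 1) w.2) * ‖μ w.2 - w.1‖ₑ ^ 2 ∂ν).toReal
  have hc₁ : 0 ≤ c₁ := ENNReal.toReal_nonneg
  have hc₂ : 0 ≤ c₂ := ENNReal.toReal_nonneg
  refine ⟨3 * (c₁ + c₂ + B), fun N hN => ?_⟩
  have ha : 1 ≤ (labelProb (Q N))⁻¹ := (one_le_inv₀ hN).2 labelProb_le_one
  have heq := adjustedIF_eq (ν := ν) (m := m) (μ := μ) (Q N) (γ₀ N)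
  have hmeas : Measurable (adjustedIF ν (Q N) (γ₀ N) m μ) := by
    rw [funext heq]
    fun_prop
  have h1 : ∫⁻ z, ‖μ z.2.2 - theta0 ν‖ₑ ^ 2 ∂(Q N) ≤
      ENNReal.ofReal (c₁ * (labelProb (Q N))⁻¹) := by
    rw [(h.model N).lintegral_snd (φ := fun w => ‖μ w.2 - theta0 ν‖ₑ ^ 2) (by fun_prop),
      ← ENNReal.ofReal_toReal (lintegral_lt_top_of_memLp_two hμ3).ne]
    exact ENNReal.ofReal_le_ofReal (le_mul_of_one_le_right hc₁ ha)
  have h2 : ∫⁻ z, ‖z.1 / truePS (Q N) (γ₀ N) z.2.2 * (μ z.2.2 - z.2.1)‖ₑ ^ 2 ∂(Q N) ≤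
      ENNReal.ofReal (c₂ * (labelProb (Q N))⁻¹) := by
    refine (lintegral_ipw_residual_sq_le h hWm hN).trans (le_of_eq ?_)
    rw [mul_comm c₂, ENNReal.ofReal_mul (by positivity), ENNReal.ofReal_toReal (hW.moments _)]
  have key : ∫⁻ z, ‖adjustedIF ν (Q N) (γ₀ N) m μ z‖ₑ ^ 2 ∂(Q N) ≤
      ENNReal.ofReal (3 * (c₁ + c₂ + B) * (labelProb (Q N))⁻¹) := by
    calc _ ≤ ∫⁻ z, ENNReal.ofReal 3 * (‖μ z.2.2 - theta0 ν‖ₑ ^ 2 +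
          ‖z.1 / truePS (Q N) (γ₀ N) z.2.2 * (μ z.2.2 - z.2.1)‖ₑ ^ 2 +
          ‖ifPi ν (Q N) (γ₀ N) m μ z‖ₑ ^ 2) ∂(Q N) := by
          refine lintegral_mono fun z => ?_
          rw [heq]
          simp only [← enorm_pow, Real.enorm_of_nonneg (sq_nonneg _)]
          rw [← ENNReal.ofReal_add (sq_nonneg _) (sq_nonneg _),
            ← ENNReal.ofReal_add (by positivity) (sq_nonneg _),
            ← ENNReal.ofReal_mul (by norm_num)]
          refine ENNReal.ofReal_le_ofReal ?_
          generalize μ z.2.2 - theta0 ν = x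
          generalize z.1 / truePS (Q N) (γ₀ N) z.2.2 * (μ z.2.2 - z.2.1) = y
          generalize ifPi ν (Q N) (γ₀ N) m μ z = u
          -- The gap 3(x² + y² + u²) - (x - y + u)² is exactly the sum of these three squares.
          nlinarith [sq_nonneg (x + y), sq_nonneg (x - u), sq_nonneg (y + u)]
      _ ≤ ENNReal.ofReal 3 * (ENNReal.ofReal (c₁ * (labelProb (Q N))⁻¹) +
          ENNReal.ofReal (c₂ * (labelProb (Q N))⁻¹) +
          ENNReal.ofReal (B * (labelProb (Q N))⁻¹)) := by
          rw [lintegral_const_mul _ (by fun_prop), lintegral_add_left (by fun_prop),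
            lintegral_add_left (by fun_prop)]
          gcongr
          exact hB N hN
      _ = _ := by
          rw [← ENNReal.ofReal_add (by positivity) (by positivity),
            ← ENNReal.ofReal_add (by positivity) (by positivity),
            ← ENNReal.ofReal_mul (by norm_num)]
          congr 1
          ring
  refine ⟨memLp_two_of_lintegral_lt_top hmeas (key.trans_lt ENNReal.ofReal_lt_top), ?_⟩
  rw [integral_eq_lintegral_of_nonneg_ae (Eventually.of_forall fun z => sq_nonneg _)
    (hmeas.pow_const 2).aestronglyMeasurable]
  refine ENNReal.toReal_le_of_le_ofReal (by positivity) (le_of_eq_of_le ?_ key)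
  refine lintegral_congr fun z => ?_
  rw [← enorm_pow, Real.enorm_of_nonneg (sq_nonneg _)]

end DoublyRobust

end OffsetPS

end

/-! ### Assembly of the theorem. -/

theorem mainTheorem3
    {p K : ℕ} (hK : 2 ≤ K)
    -- the law of `(Y, X)`, with `Y` integrable and all exponential moments of `‖X‖`
    (ν : Measure (ℝ × OffsetPS.Cov p)) [IsProbabilityMeasure ν]
    (hY : Integrable (fun w : ℝ × OffsetPS.Cov p => w.1) ν)
    (hX : ∀ t : ℝ, 0 < t → Integrable (fun x : OffsetPS.Cov p => Real.exp (t * ‖x‖)) ν.snd)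
    -- the conditional mean `m` of `Y` given `X`, and the working limit `μ`
    (m μ : OffsetPS.Cov p → ℝ) (hm_meas : Measurable m) (hμ_meas : Measurable μ)
    (hm : ν[fun w : ℝ × OffsetPS.Cov p => w.1 | OffsetPS.sigmaX' p] =ᵐ[ν] fun w => m w.2)
    -- the laws of `(R, Y, X)` along the sequence, following the offset logistic model
    (Q : ℕ → Measure (OffsetPS.Pt p)) [∀ N, IsProbabilityMeasure (Q N)]
    (γ₀ : ℕ → OffsetPS.Par p)
    (hmodel : ∀ N, OffsetPS.IsOffsetModel ν (Q N) (γ₀ N))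
    (hrate : Tendsto (fun N : ℕ => (N : ℝ) * OffsetPS.labelProb (Q N)) atTop atTop)
    (C : ℝ) (hγ₀ : ∀ N, ‖γ₀ N‖ < C)
    (hpos : ∀ N, (OffsetPS.infoMatrix ν (γ₀ N) 1).PosDef)
    (hinv : ∀ N, ‖Matrix.toEuclideanCLM (𝕜 := ℝ) (OffsetPS.infoMatrix ν (γ₀ N) 1)⁻¹‖ < C)
    -- the samples and the random partitions into `K` folds
    {Ω : ℕ → Type*} [∀ N, MeasurableSpace (Ω N)] (P : ∀ N, Measure (Ω N))
    [∀ N, IsProbabilityMeasure (P N)]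
    (Z : ∀ N, Fin N → Ω N → OffsetPS.Pt p) (fold : ∀ N, Ω N → Fin N → Fin K)
    (hsample : ∀ N, OffsetPS.IsSample (P N) (Q N) (Z N) (fold N))
    (hfold : ∀ k : Fin K, OffsetPS.IsLittleOp P
      (fun N ω => ((Finset.univ.filter fun i => fold N ω i = k).card : ℝ) / N - 1 / K)
      (fun _ => 1))
    -- the offset logistic MLE and the outcome estimator
    (ghat : ∀ N, Finset (Fin N) → (Fin N → OffsetPS.Pt p) → OffsetPS.Par p)
    (hghat : ∀ N, OffsetPS.IsOffsetMLE (ghat N))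
    (mhat : ∀ N, Finset (Fin N) → (Fin N → OffsetPS.Pt p) → OffsetPS.Cov p → ℝ)
    (hmhat : ∀ N, OffsetPS.IsOutcomeEstimator (mhat N)) :
    -- asymptotic linearity and rate of the MLE, on the full sample and on each training sample
    (∀ o : Option (Fin K),
      OffsetPS.IsLittleOp P
        (fun N ω =>
          ghat N (OffsetPS.trainSet (fold N ω) o) (OffsetPS.obs (Z N) ω) - γ₀ N
            - ((OffsetPS.trainSet (fold N ω) o).card : ℝ)⁻¹ •
              ∑ i ∈ OffsetPS.trainSet (fold N ω) o,
                OffsetPS.ifGamma ν (Q N) (γ₀ N) (Z N i ω))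
        (fun N => (Real.sqrt (N * OffsetPS.labelProb (Q N)))⁻¹) ∧
      OffsetPS.IsBigOp P
        (fun N ω =>
          ghat N (OffsetPS.trainSet (fold N ω) o) (OffsetPS.obs (Z N) ω) - γ₀ N)
        (fun N => (Real.sqrt (N * OffsetPS.labelProb (Q N)))⁻¹)) ∧
    -- the order of the norms of the inverse propensity score, and of `a_N`
    (∀ r : ℝ, 0 < r →
      (∀ᶠ N in atTop, MemLp (fun x => (OffsetPS.truePS (Q N) (γ₀ N) x)⁻¹)
        (ENNReal.ofReal r) ν.snd) ∧
      OffsetPS.SameOrder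
        (fun N => (eLpNorm (fun x => (OffsetPS.truePS (Q N) (γ₀ N) x)⁻¹)
          (ENNReal.ofReal r) ν.snd).toReal)
        (fun N => (OffsetPS.labelProb (Q N))⁻¹)) ∧
    OffsetPS.SameOrder (fun N => OffsetPS.invMeanInvPS ν (Q N) (γ₀ N))
      (fun N => OffsetPS.labelProb (Q N)) ∧
    -- the error rates of the fitted propensity score
    (∀ o : Option (Fin K),
      OffsetPS.IsBigOp P
        (fun N ω => eLpNorm
          (fun x => 1 - OffsetPS.truePS (Q N) (γ₀ N) x /
            OffsetPS.fittedPS (ghat N) (OffsetPS.trainSet (fold N ω) o)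
              (OffsetPS.obs (Z N) ω) x) 2 ν.snd)
        (fun N => (Real.sqrt (N * OffsetPS.labelProb (Q N)))⁻¹) ∧
      OffsetPS.IsBigOp P
        (fun N ω => ∫⁻ x, ENNReal.ofReal
          (OffsetPS.invMeanInvPS ν (Q N) (γ₀ N) / OffsetPS.truePS (Q N) (γ₀ N) x *
            (1 - OffsetPS.truePS (Q N) (γ₀ N) x /
              OffsetPS.fittedPS (ghat N) (OffsetPS.trainSet (fold N ω) o)
                (OffsetPS.obs (Z N) ω) x) ^ 2) ∂ν.snd)
        (fun N => (N * OffsetPS.labelProb (Q N))⁻¹) ∧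
      OffsetPS.IsLittleOp P
        (fun N ω => ∫⁻ x, ENNReal.ofReal
          (OffsetPS.invMeanInvPS ν (Q N) (γ₀ N) / OffsetPS.truePS (Q N) (γ₀ N) x *
            (1 - OffsetPS.truePS (Q N) (γ₀ N) x /
              OffsetPS.fittedPS (ghat N) (OffsetPS.trainSet (fold N ω) o)
                (OffsetPS.obs (Z N) ω) x) ^ 2) ∂ν.snd)
        (fun _ => 1)) ∧
    -- the expansion of the bias term under outcome misspecification
    (∀ c : ℝ, 0 < c → MemLp (fun x => m x - μ x) (ENNReal.ofReal (2 + c)) ν.snd →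
      OffsetPS.IsLittleOp P
        (fun N ω =>
          OffsetPS.deltaHat (Q N) (γ₀ N) m μ
              (OffsetPS.crossPS (ghat N) (fold N ω) (OffsetPS.obs (Z N) ω))
              (fun i => Z N i ω)
            - (N : ℝ)⁻¹ * ∑ i, OffsetPS.ifPi ν (Q N) (γ₀ N) m μ (Z N i ω))
        (fun N => (Real.sqrt (N * OffsetPS.labelProb (Q N)))⁻¹)) ∧
    -- the weighted error rate of the outcome estimator
    (∀ c : ℝ, 0 < c →
      (∀ k : Fin K, OffsetPS.IsLittleOp P
        (fun N ω => eLpNorm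
          (fun x => mhat N (OffsetPS.trainSet (fold N ω) (some k)) (OffsetPS.obs (Z N) ω) x - μ x)
          (ENNReal.ofReal (2 + c)) ν.snd) (fun _ => 1)) →
      ∀ k : Fin K, OffsetPS.IsLittleOp P
        (fun N ω => ∫⁻ x, ENNReal.ofReal
          (OffsetPS.invMeanInvPS ν (Q N) (γ₀ N) / OffsetPS.truePS (Q N) (γ₀ N) x *
            (mhat N (OffsetPS.trainSet (fold N ω) (some k)) (OffsetPS.obs (Z N) ω) x
              - μ x) ^ 2) ∂ν.snd)
        (fun _ => 1)) ∧
    -- the adjusted expansion of the doubly robust estimator, and the moments of `Ψ`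
    (∀ c : ℝ, 0 < c → MemLp (fun x => m x - μ x) (ENNReal.ofReal (2 + c)) ν.snd →
      MemLp (fun w : ℝ × OffsetPS.Cov p => w.1) 2 ν →
      ∀ σ : ℝ,
      ν[fun w : ℝ × OffsetPS.Cov p => (w.1 - μ w.2) ^ 2 | OffsetPS.sigmaX' p]
        ≤ᵐ[ν] (fun _ => σ ^ 2) →
      (∀ c' : ℝ, 0 < c' →
        (∀ k : Fin K, OffsetPS.IsLittleOp P
          (fun N ω => eLpNorm
            (fun x =>
              mhat N (OffsetPS.trainSet (fold N ω) (some k)) (OffsetPS.obs (Z N) ω) x - μ x)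
            (ENNReal.ofReal (2 + c')) ν.snd) (fun _ => 1)) →
        OffsetPS.IsLittleOp P
          (fun N ω =>
            OffsetPS.thetaDRSS
                (OffsetPS.crossOutcome (mhat N) (fold N ω) (OffsetPS.obs (Z N) ω))
                (OffsetPS.crossPS (ghat N) (fold N ω) (OffsetPS.obs (Z N) ω))
                (fun i => Z N i ω)
              - OffsetPS.theta0 ν
              - (N : ℝ)⁻¹ * ∑ i, OffsetPS.adjustedIF ν (Q N) (γ₀ N) m μ (Z N i ω))
          (fun N => (Real.sqrt (N * OffsetPS.labelProb (Q N)))⁻¹)) ∧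
      (∀ N, 0 < OffsetPS.labelProb (Q N) →
        Integrable (OffsetPS.adjustedIF ν (Q N) (γ₀ N) m μ) (Q N) ∧
        ∫ z, OffsetPS.adjustedIF ν (Q N) (γ₀ N) m μ z ∂(Q N) = 0) ∧
      ∃ B : ℝ, ∀ᶠ N in atTop,
        MemLp (OffsetPS.adjustedIF ν (Q N) (γ₀ N) m μ) 2 (Q N) ∧
        ∫ z, OffsetPS.adjustedIF ν (Q N) (γ₀ N) m μ z ^ 2 ∂(Q N)
          ≤ B * (OffsetPS.labelProb (Q N))⁻¹) := by
  have h : OffsetPS.Regime ν Q γ₀ C P Z fold :=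
    { two_le := hK
      exp_moments := hX
      model := hmodel
      tendsto_size := hrate
      norm_le := fun N => (hγ₀ N).le
      const_pos := (norm_nonneg _).trans_lt (hγ₀ 0)
      posDef := hpos
      inv_le := fun N => (hinv N).le
      sample := hsample
      folds := hfold }
  have hmhat_meas : ∀ N (ω : Ω N) (k : Fin K), Measurable fun x =>
      mhat N (OffsetPS.trainSet (fold N ω) (some k)) (OffsetPS.obs (Z N) ω) x - μ x :=
    fun N ω k => (((hmhat N) _).2.comp measurable_prodMk_left).sub hμ_meas
  have hsize : ∀ η : ℝ, 0 < η → ∀ᶠ N : ℕ in atTop,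
      ((N : ℝ) * OffsetPS.labelProb (Q N))⁻¹ ≤ η * 1 := by
    intro η hη
    rw [mul_one]
    exact hrate.inv_tendsto_atTop.eventually_le_const hη
  refine ⟨fun o => OffsetPS.mle_asymptotics h hghat o,
    fun r hr => ⟨h.labelProb_pos.mono fun N hN => OffsetPS.memLp_inv_truePS h hN hr,
      OffsetPS.sameOrder_eLpNorm h hr⟩,
    OffsetPS.sameOrder_invMeanInvPS h, fun o => ?_, fun c hc hmem => ?_,
    fun c hc hlim k => OffsetPS.isLittleOp_weighted_outcome h hc (fun N ω => hmhat_meas N ω k)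
      (hlim k), fun c hc hmem hY2 σ hσ => ?_⟩
  · have hfit := OffsetPS.isBigOp_weighted_fit h hghat o
    simp only [OffsetPS.rate_mul_rate] at hfit
    exact ⟨OffsetPS.isBigOp_eLpNorm_fit h hghat o, hfit, hfit.isLittleOp hsize⟩
  · have hexp := OffsetPS.isLittleOp_expansion h hghat
      (OffsetPS.isOutcomeResidual_sub h hm_meas hμ_meas hc hmem)
    simp only [OffsetPS.deltaHat]
    exact hexp
  · have hμ2 := OffsetPS.memLp_comp_snd_of_condExp hm_meas hm hY2 hμ_meas hc hmem
    -- Taking Y instead of m in the residual gives the same bias vector, hence the same `ifPi`; for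
    -- this reason the influence function of the estimator is `psi` plus `ifPi`.
    have hW := OffsetPS.isOutcomeResidual_outcome h hm_meas hm hY2 hμ_meas hμ2 hσ
    obtain ⟨B, hB⟩ := OffsetPS.exists_integral_adjustedIF_sq_le h hμ2 hW hμ_meas
    exact ⟨fun c' hc' hlim =>
      OffsetPS.isLittleOp_thetaDRSS h hghat hmhat hμ_meas hW hc' hlim,
      fun N hN => OffsetPS.integrable_adjustedIF h hμ2 hY2 hW hμ_meas hN,
      B, h.labelProb_pos.mono fun N hN => hB N hN⟩
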